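/- Let $k$ be a field and let $\mathcal T$ be a $k$-linear idempotent complete pre-triangulated category (a triangulated category, possibly without the octahedral axiom) with $k$-linear translation functor $\Sigma$. All functors are $k$-linear. A triangle functor is a pair $(F,\omega)$ with $\omega\colon F\Sigma\to\Sigma F$ a natural isomorphism such that $(F,\omega)$ preserves exact triangles; transformations of triangle functors respect the connecting isomorphisms $\omega$. Let $G$ be a finite abelian group that splits over $k$, i.e. the group algebra $kG$ is isomorphic to a finite product of copies of $k$, and let $\widehat G=\mathrm{Hom}(G,k^*)$. Fix a $k$-linear triangle $G$-action on $\mathcal T$: triangle autoequivalences $(F_g,\omega_g)$ and isomorphisms of triangle functors $\varepsilon_{g,h}\colon F_gF_h\to F_{gh}$ with $\varepsilon_{gh,l}\circ\varepsilon_{g,h}F_l=\varepsilon_{g,hl}\circ F_g\varepsilon_{h,l}$ for all $g,h,l\in G$. Let $\mathcal T^G$ be the category of equivariant objects $(X,\alpha)$, where $\alpha_g\colon X\to F_g(X)$ $(g\in G)$ are isomorphisms with $\alpha_{gh}=(\varepsilon_{g,h})_X\circ F_g(\alpha_h)\circ\alpha_g$; a morphism $(X,\alpha)\to(Y,\beta)$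 is a morphism $f\colon X\to Y$ with $\beta_g\circ f=F_g(f)\circ\alpha_g$ for all $g$. Its translation functor is $\Sigma^G(X,\alpha)=(\Sigma X,((\omega_g)_X^{-1}\circ\Sigma(\alpha_g))_g)$, and a triangle in $\mathcal T^G$ is exact iff its underlying triangle in $\mathcal T$ is. The dual action is the strict triangle $\widehat G$-action on $\mathcal T^G$ given by $F_\chi(X,\alpha)=(X,(\chi(g^{-1})\alpha_g)_g)$, identity on morphisms, with trivial connecting isomorphism. Let $\mathrm{Aut}_\vartriangle(\mathcal T;G)$ be the group, under composition, of isomorphism classes $[(F,\omega),\delta]$ of $G$-equivariant triangle autoequivalences: $(F,\omega)$ is a triangle autoequivalence of $\mathcal T$, and $\delta_g\colon FF_g\to F_gF$ are isomorphisms of triangle functors with $\delta_{gh}\circ F\varepsilon_{g,h}=\varepsilon_{g,h}F\circ F_g\delta_h\circ\delta_gF_h$; an isomorphism $((F,\omega),\delta)\to((F',\omega'),\delta')$ is an isomorphism $\phi\colon F\to F'$ of triangle functors with $F_g\phi\circ\delta_g=\delta'_g\circ\phi F_g$ for all $g$. Let $\mathrm{Act}_\vartriangle(\mathcal T;G)$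 be its subgroup of those $[(F,\omega),\delta]$ with $(F,\omega)\cong(F_a,\omega_a)$ as triangle functors for some $a\in G$. Define $\mathrm{Aut}_\vartriangle(\mathcal T^G;\widehat G)$ and $\mathrm{Act}_\vartriangle(\mathcal T^G;\widehat G)$ in the same way for the dual action. Then the equivariantization homomorphism $$(-)^G\colon \mathrm{Aut}_\vartriangle(\mathcal T;G)\longrightarrow\mathrm{Aut}_\vartriangle(\mathcal T^G;\widehat G),\qquad [(F,\omega),\delta]\mapsto[(((F,\delta)^G,\omega^G),\mathrm{Id})],$$ where $(F,\delta)^G(X,\alpha)=(F(X),((\delta_g)_X\circ F(\alpha_g))_g)$, $(F,\delta)^G(f)=F(f)$ and $(\omega^G)_{(X,\alpha)}=\omega_X$, is an isomorphism of groups. Moreover, let $Z_\vartriangle$ denote the triangle center, i.e. the $k$-algebra of natural transformations $\lambda\colon\mathrm{Id}\to\mathrm{Id}$ with $\Sigma\lambda=\lambda\Sigma$. If $Z_\vartriangle(\mathcal T)=k=Z_\vartriangle(\mathcal T^G)$ (that is, the structure maps from $k$ are bijective), then $(-)^G$ restricts to an isomorphism of groups $$\mathrm{Act}_\vartriangle(\mathcal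 T;G)\longrightarrow\mathrm{Act}_\vartriangle(\mathcal T^G;\widehat G).$$ -/

import Mathlib

open CategoryTheory

/-- The data of a translation functor together with a class of exact triangles
`X ⟶ Y ⟶ Z ⟶ ΣX` on a `k`-linear category. It is the part of a pre-triangulated structure that the
notions of triangle functor, triangle action and triangle center refer to. Below it is only used
for a pre-triangulated category in the sense of Mathlib (`TriangleData.ofPretriangulated`) and for
its category of equivariant objects (`TriangleAction.equivariantTriangleData`). -/
structure TriangleData (k : Type*) [Field k] (C : Type*) [Category* C] [Preadditive C]
    [Linear k C] where
  /-- the translation functor `Σ` -/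
  shift : C ⥤ C
  shift_linear : shift.Linear k
  /-- the triangle `X ⟶ Y ⟶ Z ⟶ ΣX` is exact -/
  Exact : ∀ {X Y Z : C}, (X ⟶ Y) → (Y ⟶ Z) → (Z ⟶ shift.obj X) → Prop

/-- The translation functor and the exact triangles of a `k`-linear pre-triangulated category. -/
noncomputable def TriangleData.ofPretriangulated (k : Type*) [Field k] (T : Type*) [Category* T]
    [Preadditive T] [Linear k T] [Limits.HasZeroObject T] [HasShift T ℤ]
    [∀ n : ℤ, (shiftFunctor T n).Additive] [∀ n : ℤ, (shiftFunctor T n).Linear k]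
    [Pretriangulated T] : TriangleData k T where
  shift := shiftFunctor T (1 : ℤ)
  shift_linear := inferInstance
  Exact f g h := Pretriangulated.Triangle.mk f g h ∈
    Pretriangulated.distinguishedTriangles (C := T)

section

variable {k : Type*} [Field k] {C : Type*} [Category* C] [Preadditive C] [Linear k C]

/-- A `k`-linear triangle endofunctor `(F, ω)`: the connecting isomorphism is `ω : FΣ ≅ ΣF`. -/
structure TriangleFunctor (S : TriangleData k C) where
  functor : C ⥤ C
  additive : functor.Additive
  linear : functor.Linear k
  /-- the connecting isomorphism, with components `F(ΣX) ≅ Σ(FX)` -/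
  ω : S.shift ⋙ functor ≅ functor ⋙ S.shift
  map_exact : ∀ {X Y Z : C} (f : X ⟶ Y) (g : Y ⟶ Z) (h : Z ⟶ S.shift.obj X), S.Exact f g h →
    S.Exact (functor.map f) (functor.map g) (functor.map h ≫ ω.hom.app X)

namespace TriangleFunctor

variable {S : TriangleData k C}

/-- The identity triangle functor `(Id, Id_Σ)`. -/
def id (S : TriangleData k C) : TriangleFunctor S where
  functor := 𝟭 C
  additive := inferInstance
  linear := inferInstance
  ω := NatIso.ofComponents (fun X => Iso.refl (S.shift.obj X)) (by intros; simp)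
  map_exact f g h H := by simpa using H

/-- The composite `PQ` (first `Q`, then `P`), with connecting isomorphism
`PQΣ ⟶ PΣQ ⟶ ΣPQ`. -/
def comp (P Q : TriangleFunctor S) : TriangleFunctor S where
  functor := Q.functor ⋙ P.functor
  additive := by
    have := P.additive
    have := Q.additive
    infer_instance
  linear := by
    have := P.linear
    have := Q.linear
    infer_instance
  ω := NatIso.ofComponents
    (fun X => P.functor.mapIso (Q.ω.app X) ≪≫ P.ω.app (Q.functor.obj X)) (by
      intro X Y f
      have h1 := Q.ω.hom.naturality f
      have h2 := P.ω.hom.naturality (Q.functor.map f)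
      dsimp at h1 h2 ⊢
      rw [← Category.assoc, ← P.functor.map_comp, h1, P.functor.map_comp, Category.assoc, h2,
        Category.assoc])
  map_exact f g h H := by
    have := P.map_exact _ _ _ (Q.map_exact f g h H)
    simpa using this

@[simp] lemma id_functor : (TriangleFunctor.id S).functor = 𝟭 C := rfl

@[simp] lemma comp_functor (P Q : TriangleFunctor S) :
    (P.comp Q).functor = Q.functor ⋙ P.functor := rfl

@[simp] lemma id_ω_hom_app (X : C) :
    (TriangleFunctor.id S).ω.hom.app X = 𝟙 (S.shift.obj X) := rfl

@[simp] lemma comp_ω_hom_app (P Q : TriangleFunctor S) (X : C) :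
    (P.comp Q).ω.hom.app X =
      P.functor.map (Q.ω.hom.app X) ≫ P.ω.hom.app (Q.functor.obj X) := rfl

/-- A natural transformation of the underlying functors is a transformation of triangle functors
if it respects the connecting isomorphisms. -/
def IsTriangleNatTrans (P Q : TriangleFunctor S) (φ : P.functor ⟶ Q.functor) : Prop :=
  ∀ X : C, P.ω.hom.app X ≫ S.shift.map (φ.app X) = φ.app (S.shift.obj X) ≫ Q.ω.hom.app X

/-- Two triangle functors are isomorphic. -/
def IsIsomorphic (P Q : TriangleFunctor S) : Prop :=
  ∃ φ : P.functor ≅ Q.functor, IsTriangleNatTrans P Q φ.hom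

lemma IsIsomorphic.refl (P : TriangleFunctor S) : IsIsomorphic P P :=
  ⟨Iso.refl _, fun X => by simp⟩

lemma IsIsomorphic.symm {P Q : TriangleFunctor S} (h : IsIsomorphic P Q) : IsIsomorphic Q P := by
  obtain ⟨φ, hφ⟩ := h
  refine ⟨φ.symm, fun X => ?_⟩
  rw [← cancel_epi (φ.hom.app (S.shift.obj X)), ← Category.assoc, ← hφ X]
  simp [← S.shift.map_comp]

lemma IsIsomorphic.trans {P Q R : TriangleFunctor S} (h : IsIsomorphic P Q)
    (h' : IsIsomorphic Q R) : IsIsomorphic P R := by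
  obtain ⟨φ, hφ⟩ := h
  obtain ⟨ψ, hψ⟩ := h'
  refine ⟨φ ≪≫ ψ, fun X => ?_⟩
  simp only [Iso.trans_hom, NatTrans.comp_app, Functor.map_comp]
  rw [← Category.assoc, hφ X, Category.assoc, hψ X, Category.assoc]

lemma IsIsomorphic.comp {P P' Q Q' : TriangleFunctor S} (h : IsIsomorphic P P')
    (h' : IsIsomorphic Q Q') : IsIsomorphic (P.comp Q) (P'.comp Q') := by
  obtain ⟨φ, hφ⟩ := h
  obtain ⟨ψ, hψ⟩ := h'
  refine ⟨Functor.isoWhiskerRight ψ P.functor ≪≫ Functor.isoWhiskerLeft Q'.functor φ,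
    fun X => ?_⟩
  have h1 := P.ω.hom.naturality (ψ.hom.app X)
  have h2 := φ.hom.naturality (Q'.ω.hom.app X)
  have h3 := hφ (Q'.functor.obj X)
  have h4 := congrArg P.functor.map (hψ X)
  simp only [Functor.map_comp] at h4
  dsimp at h1 h2 h3 h4 ⊢
  simp only [Functor.map_comp, Category.assoc] at *
  rw [← reassoc_of% h1, h3, ← reassoc_of% h2, reassoc_of% h4]

end TriangleFunctor

/-- The triangle center of `C`: the natural transformations `λ : Id ⟶ Id` with `Σλ = λΣ`. -/
def TriangleData.center (S : TriangleData k C) : Set (CatCenter C) :=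
  {z | ∀ X : C, S.shift.map (z.app X) = z.app (S.shift.obj X)}

/-- The triangle center equals `k`: the structure map `c ↦ c • Id` is a bijection from `k` onto the
triangle center. -/
def TriangleData.CenterEqScalars (S : TriangleData k C) : Prop :=
  Set.BijOn (Linear.toCatCenter k C) Set.univ S.center

/-- A `k`-linear triangle action `{(F_g, ω_g), ε_{g,h}}` of a group `G`. The isomorphism
`ε_{g,h} : F_g F_h ⟶ F_{gh}` is indexed by `g`, `h`, `m` and a proof of `g * h = m`, with target
`F_m`; since `m` is determined by `g` and `h`, this is the same datum, and it makes the cocycle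
condition free of transports along associativity of `G`. -/
structure TriangleAction (G : Type*) [Group G] (S : TriangleData k C) where
  F : G → TriangleFunctor S
  isEquivalence : ∀ g, (F g).functor.IsEquivalence
  ε : ∀ {g h m : G}, g * h = m → ((F h).functor ⋙ (F g).functor ≅ (F m).functor)
  ε_triangle : ∀ {g h m : G} (e : g * h = m),
    TriangleFunctor.IsTriangleNatTrans ((F g).comp (F h)) (F m) (ε e).hom
  /-- `ε_{gh,l} ∘ ε_{g,h}F_l = ε_{g,hl} ∘ F_g ε_{h,l}` -/
  cocycle : ∀ {g h l gh hl ghl : G} (e₁ : g * h = gh) (e₂ : h * l = hl) (e₃ : gh * l = ghl)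
    (e₄ : g * hl = ghl) (X : C),
    (ε e₁).hom.app ((F l).functor.obj X) ≫ (ε e₃).hom.app X =
      (F g).functor.map ((ε e₂).hom.app X) ≫ (ε e₄).hom.app X

namespace TriangleAction

variable {G : Type*} [Group G] {S : TriangleData k C} (A : TriangleAction G S)

/-- A `G`-equivariant object `(X, α)`: isomorphisms `α_g : X ⟶ F_g X` with
`α_{gh} = (ε_{g,h})_X ∘ F_g(α_h) ∘ α_g`. -/
structure EquivariantObject where
  obj : C
  α : ∀ g : G, obj ≅ (A.F g).functor.obj obj
  α_mul : ∀ {g h m : G} (e : g * h = m),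
    (α m).hom = (α g).hom ≫ (A.F g).functor.map (α h).hom ≫ (A.ε e).hom.app obj

variable {A}

/-- Morphisms `f` of equivariant objects: those with `β_g ∘ f = F_g(f) ∘ α_g` for all `g`. -/
def homSubmodule (X Y : A.EquivariantObject) : Submodule k (X.obj ⟶ Y.obj) where
  carrier := {f | ∀ g, f ≫ (Y.α g).hom = (X.α g).hom ≫ (A.F g).functor.map f}
  add_mem' {f f'} hf hf' g := by
    have := (A.F g).additive
    simp [Functor.map_add, hf g, hf' g]
  zero_mem' g := by
    have := (A.F g).additive
    simp
  smul_mem' c f hf g := by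
    have := (A.F g).linear
    simp [Functor.map_smul, hf g]

/-- A morphism of equivariant objects. -/
@[ext]
structure EquivariantHom (X Y : A.EquivariantObject) where
  f : X.obj ⟶ Y.obj
  comm : ∀ g, f ≫ (Y.α g).hom = (X.α g).hom ≫ (A.F g).functor.map f

instance : Category A.EquivariantObject where
  Hom X Y := EquivariantHom X Y
  id X := ⟨𝟙 _, by simp⟩
  comp f g := ⟨f.f ≫ g.f, fun a => by
    simp only [Functor.map_comp, Category.assoc]
    rw [g.comm a, ← Category.assoc, f.comm a, Category.assoc]⟩
  id_comp f := by ext; simp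
  comp_id f := by ext; simp
  assoc f g h := by ext; simp

@[ext]
lemma hom_ext {X Y : A.EquivariantObject} {a b : X ⟶ Y} (h : a.f = b.f) : a = b :=
  EquivariantHom.ext h

@[simp] lemma id_f (X : A.EquivariantObject) : (𝟙 X : X ⟶ X).f = 𝟙 X.obj := rfl

@[simp] lemma comp_f {X Y Z : A.EquivariantObject} (a : X ⟶ Y) (b : Y ⟶ Z) :
    (a ≫ b).f = a.f ≫ b.f := rfl

/-- Morphisms of equivariant objects form a `k`-subspace of the morphisms of `C`. -/
def homEquiv (X Y : A.EquivariantObject) : (X ⟶ Y) ≃ homSubmodule X Y where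
  toFun a := ⟨a.f, a.comm⟩
  invFun a := ⟨a.1, a.2⟩
  left_inv _ := rfl
  right_inv _ := rfl

instance : Preadditive A.EquivariantObject where
  homGroup X Y := (homEquiv X Y).addCommGroup
  add_comp _ _ _ f f' g := hom_ext (Preadditive.add_comp _ _ _ f.f f'.f g.f)
  comp_add _ _ _ f g g' := hom_ext (Preadditive.comp_add _ _ _ f.f g.f g'.f)

instance : Linear k A.EquivariantObject where
  homModule X Y := (homEquiv X Y).module k
  smul_comp _ _ _ r f g := hom_ext (Linear.smul_comp _ _ _ r f.f g.f)
  comp_smul _ _ _ f r g := hom_ext (Linear.comp_smul _ _ _ f.f r g.f)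

@[simp] lemma add_f {X Y : A.EquivariantObject} (a b : X ⟶ Y) : (a + b).f = a.f + b.f := rfl

@[simp] lemma smul_f {X Y : A.EquivariantObject} (c : k) (a : X ⟶ Y) :
    (c • a).f = c • a.f := rfl

/-- An isomorphism of underlying objects compatible with the equivariant structures. -/
def isoMk {X Y : A.EquivariantObject} (i : X.obj ≅ Y.obj)
    (h : ∀ g, i.hom ≫ (Y.α g).hom = (X.α g).hom ≫ (A.F g).functor.map i.hom) : X ≅ Y where
  hom := ⟨i.hom, h⟩
  inv := ⟨i.inv, fun g => by
    rw [Iso.inv_comp_eq, ← Category.assoc, h g, Category.assoc, ← Functor.map_comp]; simp⟩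
  hom_inv_id := by ext; simp
  inv_hom_id := by ext; simp

@[simp] lemma isoMk_hom_f {X Y : A.EquivariantObject} (i : X.obj ≅ Y.obj) (h) :
    (isoMk i h : X ≅ Y).hom.f = i.hom := rfl

@[simp] lemma isoMk_inv_f {X Y : A.EquivariantObject} (i : X.obj ≅ Y.obj) (h) :
    (isoMk i h : X ≅ Y).inv.f = i.inv := rfl

variable (A)

/-- The translation functor `Σ^G` on equivariant objects: `Σ^G(X, α) = (ΣX, α')` with
`α'_g = (ω_g)_X⁻¹ ∘ Σ(α_g)`, acting on morphisms by `Σ`. -/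
def equivariantShift : A.EquivariantObject ⥤ A.EquivariantObject where
  obj X :=
    { obj := S.shift.obj X.obj
      α := fun g => S.shift.mapIso (X.α g) ≪≫ ((A.F g).ω.app X.obj).symm
      α_mul := by
        intro g h m e
        have h1 := A.ε_triangle e X.obj
        have h2 := (A.F g).ω.inv.naturality (X.α h).hom
        dsimp at h1 h2 ⊢
        rw [X.α_mul e]
        simp only [Functor.map_comp, Category.assoc]
        rw [← cancel_mono ((A.F m).ω.hom.app X.obj)]
        simp only [Category.assoc, Iso.inv_hom_id_app, Functor.comp_obj, Category.comp_id]
        rw [← h1, ← reassoc_of% h2]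
        simp only [← Functor.map_comp_assoc]
        simp }
  map a := ⟨S.shift.map a.f, fun g => by
    have h1 := (A.F g).ω.inv.naturality a.f
    have h2 := congrArg S.shift.map (a.comm g)
    dsimp at h1 h2 ⊢
    simp only [Functor.map_comp] at h2
    rw [Category.assoc, ← h1, reassoc_of% h2]⟩
  map_id X := by ext; simp
  map_comp a b := by ext; simp

@[simp] lemma equivariantShift_obj_obj (X : A.EquivariantObject) :
    (A.equivariantShift.obj X).obj = S.shift.obj X.obj := rfl

@[simp] lemma equivariantShift_map_f {X Y : A.EquivariantObject} (a : X ⟶ Y) :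
    (A.equivariantShift.map a).f = S.shift.map a.f := rfl

@[simp] lemma equivariantShift_obj_α_hom (X : A.EquivariantObject) (g : G) :
    ((A.equivariantShift.obj X).α g).hom =
      S.shift.map (X.α g).hom ≫ (A.F g).ω.inv.app X.obj := rfl

/-- The pre-triangulated structure on the category of equivariant objects: the translation functor
is `Σ^G`, and a triangle is exact iff the triangle of underlying objects is exact. -/
def equivariantTriangleData : TriangleData k A.EquivariantObject where
  shift := A.equivariantShift
  shift_linear := ⟨fun a c =>
    have := S.shift_linear
    hom_ext (Functor.Linear.map_smul a.f c)⟩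
  Exact f g h := S.Exact f.f g.f h.f

@[simp] lemma equivariantTriangleData_shift :
    A.equivariantTriangleData.shift = A.equivariantShift := rfl

section Dual

/-- Rescaling of an isomorphism by a nonzero scalar. -/
def scaleIso (c : kˣ) {X Y : C} (i : X ≅ Y) : X ≅ Y where
  hom := (c : k) • i.hom
  inv := ((c⁻¹ : kˣ) : k) • i.inv
  hom_inv_id := by simp [smul_smul]
  inv_hom_id := by simp [smul_smul]

variable {A}

/-- The equivariant object `(X, χ ⊗ α)` with `(χ ⊗ α)_g = χ(g⁻¹) α_g`. -/
def twist (χ : G →* kˣ) (X : A.EquivariantObject) : A.EquivariantObject where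
  obj := X.obj
  α g := scaleIso (χ g⁻¹) (X.α g)
  α_mul := by
    intro g h m e
    have := (A.F g).linear
    subst e
    have h1 : ((χ (g * h)⁻¹ : kˣ) : k) = ((χ g⁻¹ : kˣ) : k) * ((χ h⁻¹ : kˣ) : k) := by
      rw [mul_inv_rev, map_mul, Units.val_mul, mul_comm]
    have h2 : (A.F g).functor.map (((χ h⁻¹ : kˣ) : k) • (X.α h).hom) =
        ((χ h⁻¹ : kˣ) : k) • (A.F g).functor.map (X.α h).hom := Functor.Linear.map_smul _ _
    simp only [scaleIso]
    rw [h1, h2, X.α_mul rfl]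
    erw [Linear.smul_comp, Linear.smul_comp, Linear.comp_smul, smul_smul]

@[simp] lemma twist_obj (χ : G →* kˣ) (X : A.EquivariantObject) : (twist χ X).obj = X.obj := rfl

lemma twist_α_hom (χ : G →* kˣ) (X : A.EquivariantObject) (g : G) :
    ((twist χ X).α g).hom = ((χ g⁻¹ : kˣ) : k) • (X.α g).hom := rfl

variable (A)

/-- The automorphism `F_χ : (X, α) ↦ (X, χ ⊗ α)` of the category of equivariant objects, acting on
morphisms by the identity. -/
def twistFunctor (χ : G →* kˣ) : A.EquivariantObject ⥤ A.EquivariantObject where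
  obj := twist χ
  map {X Y} a := ⟨a.f, fun g => by
    rw [twist_α_hom, twist_α_hom]
    exact (Linear.comp_smul _ _ _ a.f _ _).trans ((congrArg _ (a.comm g)).trans
      (Linear.smul_comp _ _ _ _ _ _).symm)⟩
  map_id _ := rfl
  map_comp _ _ := rfl

@[simp] lemma twistFunctor_obj (χ : G →* kˣ) (X : A.EquivariantObject) :
    (A.twistFunctor χ).obj X = twist χ X := rfl

@[simp] lemma twistFunctor_map_f (χ : G →* kˣ) {X Y : A.EquivariantObject} (a : X ⟶ Y) :
    ((A.twistFunctor χ).map a).f = a.f := rfl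

/-- The automorphism `F_χ` as a triangle functor. Its connecting isomorphism is trivial, that is,
the identity on underlying objects. -/
def dualFunctor (χ : G →* kˣ) : TriangleFunctor A.equivariantTriangleData where
  functor := A.twistFunctor χ
  additive := ⟨rfl⟩
  linear := ⟨fun _ _ => rfl⟩
  ω := NatIso.ofComponents (fun X => isoMk (Iso.refl (S.shift.obj X.obj)) (fun g => by
    have := S.shift_linear
    have h : S.shift.map (((χ g⁻¹ : kˣ) : k) • (X.α g).hom) ≫ (A.F g).ω.inv.app X.obj =
        ((χ g⁻¹ : kˣ) : k) • (S.shift.map (X.α g).hom ≫ (A.F g).ω.inv.app X.obj) := by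
      rw [Functor.map_smul, Linear.smul_comp]
    refine (Category.id_comp _).trans (h.trans ?_)
    exact ((congrArg _ ((A.F g).functor.map_id _)).trans (Category.comp_id _)).symm)) (by
      intro X Y a
      apply hom_ext
      exact (Category.comp_id (S.shift.map a.f)).trans (Category.id_comp _).symm)
  map_exact {X Y Z} f g h H := by
    have e : h.f ≫ 𝟙 (S.shift.obj X.obj) = h.f := Category.comp_id _
    change S.Exact f.f g.f (h.f ≫ 𝟙 (S.shift.obj X.obj))
    rw [e]
    exact H

@[simp] lemma dualFunctor_functor (χ : G →* kˣ) :
    (A.dualFunctor χ).functor = A.twistFunctor χ := rfl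

@[simp] lemma dualFunctor_ω_hom_app_f (χ : G →* kˣ) (X : A.EquivariantObject) :
    ((A.dualFunctor χ).ω.hom.app X).f = 𝟙 (S.shift.obj X.obj) := rfl

/-- The dual action of the character group `Ĝ = Hom(G, kˣ)` on the category of equivariant objects,
`χ ↦ F_χ`. It is strict: the isomorphisms `F_χ F_χ' ≅ F_{χχ'}` are identities on underlying
objects. -/
def dualAction : TriangleAction (G →* kˣ) A.equivariantTriangleData where
  F := A.dualFunctor
  isEquivalence χ :=
    { faithful := ⟨fun {X Y a b} h => hom_ext (by
        have := congrArg (fun x => EquivariantHom.f x) h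
        exact this)⟩
      full := ⟨fun {X Y} a => ⟨⟨a.f, fun g => by
        have h := a.comm g
        have h1 : ∀ f : X.obj ⟶ Y.obj, f ≫ (((χ g⁻¹ : kˣ) : k) • (Y.α g).hom) =
            (((χ g⁻¹ : kˣ) : k) • (X.α g).hom) ≫ (A.F g).functor.map f →
            f ≫ (Y.α g).hom = (X.α g).hom ≫ (A.F g).functor.map f := by
          intro f hf
          rw [Linear.comp_smul, Linear.smul_comp] at hf
          exact smul_right_injective _ (χ g⁻¹).ne_zero hf
        exact h1 a.f h⟩, rfl⟩⟩
      essSurj := ⟨fun X => ⟨twist χ⁻¹ X, ⟨isoMk (Iso.refl X.obj) (fun g => by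
        have h : ((χ g⁻¹ : kˣ) : k) • (((χ⁻¹ g⁻¹ : kˣ) : k) • (X.α g).hom) = (X.α g).hom := by
          simp [smul_smul]
        refine (Category.id_comp _).trans (h.symm.trans ?_)
        exact ((congrArg _ ((A.F g).functor.map_id _)).trans (Category.comp_id _)).symm)⟩⟩⟩ }
  ε {χ χ' ψ} e := NatIso.ofComponents (fun X => isoMk (Iso.refl X.obj) (fun g => by
      subst e
      have h : ((χ g⁻¹ : kˣ) : k) • (((χ' g⁻¹ : kˣ) : k) • (X.α g).hom) =
          (((χ * χ') g⁻¹ : kˣ) : k) • (X.α g).hom := by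
        simp [smul_smul]
      refine (Category.id_comp _).trans (h.symm.trans ?_)
      exact ((congrArg _ ((A.F g).functor.map_id _)).trans (Category.comp_id _)).symm)) (by
    intro X Y a
    apply hom_ext
    exact (Category.comp_id a.f).trans (Category.id_comp _).symm)
  ε_triangle {χ χ' ψ} e X := by
    apply hom_ext
    change (𝟙 _ ≫ 𝟙 _) ≫ S.shift.map (𝟙 X.obj) = 𝟙 (S.shift.obj X.obj) ≫ 𝟙 _
    simp
  cocycle e₁ e₂ e₃ e₄ X := rfl

end Dual

/-- A `k`-linear `G`-equivariant triangle autoequivalence `((F, ω), δ)`: a triangle functor `(F, ω)`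
that is an autoequivalence, with isomorphisms `δ_g : F F_g ⟶ F_g F` of triangle functors such that
`δ_{gh} ∘ F ε_{g,h} = ε_{g,h} F ∘ (F_g δ_h ∘ δ_g F_h)`. -/
structure EquivariantAutoequivalence where
  toTriangleFunctor : TriangleFunctor S
  isEquivalence : toTriangleFunctor.functor.IsEquivalence
  δ : ∀ g : G, (A.F g).functor ⋙ toTriangleFunctor.functor ≅
    toTriangleFunctor.functor ⋙ (A.F g).functor
  δ_triangle : ∀ g : G, TriangleFunctor.IsTriangleNatTrans
    (toTriangleFunctor.comp (A.F g)) ((A.F g).comp toTriangleFunctor) (δ g).hom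
  δ_mul : ∀ {g h m : G} (e : g * h = m) (X : C),
    toTriangleFunctor.functor.map ((A.ε e).hom.app X) ≫ (δ m).hom.app X =
      (δ g).hom.app ((A.F h).functor.obj X) ≫ (A.F g).functor.map ((δ h).hom.app X) ≫
        (A.ε e).hom.app (toTriangleFunctor.functor.obj X)

variable {A}

namespace EquivariantAutoequivalence

/-- An isomorphism of equivariant triangle autoequivalences: an isomorphism `φ : F ⟶ F'` of triangle
functors with `F_g φ ∘ δ_g = δ'_g ∘ φ F_g`. -/
def IsIsomorphic (P Q : A.EquivariantAutoequivalence) : Prop :=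
  ∃ φ : P.toTriangleFunctor.functor ≅ Q.toTriangleFunctor.functor,
    TriangleFunctor.IsTriangleNatTrans P.toTriangleFunctor Q.toTriangleFunctor φ.hom ∧
    ∀ (g : G) (X : C), (P.δ g).hom.app X ≫ (A.F g).functor.map (φ.hom.app X) =
      φ.hom.app ((A.F g).functor.obj X) ≫ (Q.δ g).hom.app X

instance setoid : Setoid A.EquivariantAutoequivalence where
  r := IsIsomorphic
  iseqv :=
    { refl := fun P => ⟨Iso.refl _, fun X => by simp, fun g X => by simp⟩
      symm := by
        rintro P Q ⟨φ, hφ, hδ⟩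
        refine ⟨φ.symm, fun X => ?_, fun g X => ?_⟩
        · rw [← cancel_epi (φ.hom.app (S.shift.obj X)), ← Category.assoc, ← hφ X]
          simp [← S.shift.map_comp]
        · rw [← cancel_epi (φ.hom.app ((A.F g).functor.obj X)), ← Category.assoc, ← hδ g X]
          simp [← (A.F g).functor.map_comp]
      trans := by
        rintro P Q R ⟨φ, hφ, hδ⟩ ⟨ψ, hψ, hδ'⟩
        refine ⟨φ ≪≫ ψ, fun X => ?_, fun g X => ?_⟩
        · simp only [Iso.trans_hom, NatTrans.comp_app, Functor.map_comp]
          rw [← Category.assoc, hφ X, Category.assoc, hψ X, Category.assoc]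
        · simp only [Iso.trans_hom, NatTrans.comp_app, Functor.map_comp]
          rw [← Category.assoc, hδ g X, Category.assoc, hδ' g X, Category.assoc] }

variable (A) in
/-- The identity transformations `Id F_g ⟶ F_g Id`. -/
def oneδ (g : G) : (A.F g).functor ⋙ 𝟭 C ≅ 𝟭 C ⋙ (A.F g).functor :=
  NatIso.ofComponents (fun X => Iso.refl ((A.F g).functor.obj X)) (by intros; simp)

@[simp] lemma oneδ_hom_app (g : G) (X : C) :
    (oneδ A g).hom.app X = 𝟙 ((A.F g).functor.obj X) := rfl

variable (A) in
/-- The identity equivariant triangle autoequivalence `(Id, Id)`. -/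
def one : A.EquivariantAutoequivalence where
  toTriangleFunctor := TriangleFunctor.id S
  isEquivalence := inferInstanceAs (𝟭 C).IsEquivalence
  δ g := oneδ A g
  δ_triangle g X := by simp
  δ_mul e X := by simp

@[simp] lemma one_toTriangleFunctor : (one A).toTriangleFunctor = TriangleFunctor.id S := rfl

@[simp] lemma one_δ_hom_app (g : G) (X : C) :
    ((one A).δ g).hom.app X = 𝟙 ((A.F g).functor.obj X) := rfl

/-- The composite transformations `δ_g F' ∘ F δ'_g`. -/
def mulδ (P Q : A.EquivariantAutoequivalence) (g : G) :
    (A.F g).functor ⋙ Q.toTriangleFunctor.functor ⋙ P.toTriangleFunctor.functor ≅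
      (Q.toTriangleFunctor.functor ⋙ P.toTriangleFunctor.functor) ⋙ (A.F g).functor :=
  NatIso.ofComponents
    (fun X => P.toTriangleFunctor.functor.mapIso ((Q.δ g).app X) ≪≫
      (P.δ g).app (Q.toTriangleFunctor.functor.obj X)) (by
      intro X Y f
      have h1 := congrArg P.toTriangleFunctor.functor.map ((Q.δ g).hom.naturality f)
      have h2 := (P.δ g).hom.naturality (Q.toTriangleFunctor.functor.map f)
      dsimp at h1 h2 ⊢
      simp only [Functor.map_comp] at h1
      rw [reassoc_of% h1, h2, Category.assoc])

@[simp] lemma mulδ_hom_app (P Q : A.EquivariantAutoequivalence) (g : G) (X : C) :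
    (mulδ P Q g).hom.app X = P.toTriangleFunctor.functor.map ((Q.δ g).hom.app X) ≫
      (P.δ g).hom.app (Q.toTriangleFunctor.functor.obj X) := rfl

/-- The composite `(FF', δF' ∘ Fδ')` of `(F, δ)` and `(F', δ')` (first `F'`, then `F`). -/
def mul (P Q : A.EquivariantAutoequivalence) : A.EquivariantAutoequivalence where
  toTriangleFunctor := P.toTriangleFunctor.comp Q.toTriangleFunctor
  isEquivalence := by
    have := P.isEquivalence
    have := Q.isEquivalence
    exact inferInstanceAs
      (Q.toTriangleFunctor.functor ⋙ P.toTriangleFunctor.functor).IsEquivalence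
  δ g := mulδ P Q g
  δ_triangle g X := by
    have h1 := congrArg P.toTriangleFunctor.functor.map (Q.δ_triangle g X)
    have h2 := P.δ_triangle g (Q.toTriangleFunctor.functor.obj X)
    have h3 := P.toTriangleFunctor.ω.hom.naturality ((Q.δ g).hom.app X)
    have h4 := (P.δ g).hom.naturality (Q.toTriangleFunctor.ω.hom.app X)
    dsimp at h1 h2 h3 h4 ⊢
    simp only [Functor.map_comp, Category.assoc] at *
    rw [← reassoc_of% h3, reassoc_of% h1, h2, reassoc_of% h4]
  δ_mul {g h m} e X := by
    have h1 := congrArg P.toTriangleFunctor.functor.map (Q.δ_mul e X)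
    have h2 := P.δ_mul e (Q.toTriangleFunctor.functor.obj X)
    have h3 := (P.δ g).hom.naturality ((Q.δ h).hom.app X)
    dsimp at h1 h2 h3 ⊢
    simp only [Functor.map_comp, Category.assoc] at *
    rw [reassoc_of% h1, h2, reassoc_of% h3]

@[simp] lemma mul_toTriangleFunctor (P Q : A.EquivariantAutoequivalence) :
    (P.mul Q).toTriangleFunctor = P.toTriangleFunctor.comp Q.toTriangleFunctor := rfl

@[simp] lemma mul_δ_hom_app (P Q : A.EquivariantAutoequivalence) (g : G) (X : C) :
    ((P.mul Q).δ g).hom.app X = P.toTriangleFunctor.functor.map ((Q.δ g).hom.app X) ≫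
      (P.δ g).hom.app (Q.toTriangleFunctor.functor.obj X) := rfl

lemma mul_congr {P P' Q Q' : A.EquivariantAutoequivalence} (h : IsIsomorphic P P')
    (h' : IsIsomorphic Q Q') : IsIsomorphic (mul P Q) (mul P' Q') := by
  obtain ⟨φ, hφ, hδ⟩ := h
  obtain ⟨ψ, hψ, hδ'⟩ := h'
  refine ⟨Functor.isoWhiskerRight ψ P.toTriangleFunctor.functor ≪≫
    Functor.isoWhiskerLeft Q'.toTriangleFunctor.functor φ, fun X => ?_, fun g X => ?_⟩
  · have h1 := P.toTriangleFunctor.ω.hom.naturality (ψ.hom.app X)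
    have h2 := φ.hom.naturality (Q'.toTriangleFunctor.ω.hom.app X)
    have h3 := hφ (Q'.toTriangleFunctor.functor.obj X)
    have h4 := congrArg P.toTriangleFunctor.functor.map (hψ X)
    dsimp at h1 h2 h3 h4 ⊢
    simp only [Functor.map_comp, Category.assoc] at *
    rw [← reassoc_of% h1, h3, ← reassoc_of% h2, reassoc_of% h4]
  · have h1 := (P.δ g).hom.naturality (ψ.hom.app X)
    have h2 := φ.hom.naturality ((Q'.δ g).hom.app X)
    have h3 := hδ g (Q'.toTriangleFunctor.functor.obj X)
    have h4 := congrArg P.toTriangleFunctor.functor.map (hδ' g X)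
    dsimp at h1 h2 h3 h4 ⊢
    simp only [Functor.map_comp, Category.assoc] at *
    rw [← reassoc_of% h1, h3, ← reassoc_of% h2, reassoc_of% h4]

end EquivariantAutoequivalence

variable (A)

/-- The group `Aut_Δ(C; G)` of isoclasses of `k`-linear equivariant triangle autoequivalences. -/
def Aut := Quotient (EquivariantAutoequivalence.setoid (A := A))

namespace Aut

variable {A}

/-- The isoclass `[(F, ω), δ]`. -/
def mk (P : A.EquivariantAutoequivalence) : A.Aut := Quotient.mk _ P

/-- The multiplication of `Aut_Δ(C; G)` is induced by composition. Associativity and unit hold for any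
`TriangleData`; the existence of inverses uses the axioms of a pre-triangulated category, as a
quasi-inverse of a triangle autoequivalence has to send exact triangles to exact triangles. -/
instance : Monoid A.Aut where
  one := mk (EquivariantAutoequivalence.one A)
  mul := Quotient.map₂ EquivariantAutoequivalence.mul
    (fun _ _ h _ _ h' => EquivariantAutoequivalence.mul_congr h h')
  mul_assoc := by
    rintro ⟨P⟩ ⟨Q⟩ ⟨R⟩
    refine Quotient.sound ⟨Functor.associator _ _ _ |>.symm, fun X => ?_, fun g X => ?_⟩ <;>
    simp
  one_mul := by
    rintro ⟨P⟩
    refine Quotient.sound ⟨Functor.rightUnitor _, fun X => ?_, fun g X => ?_⟩ <;>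
    simp
  mul_one := by
    rintro ⟨P⟩
    refine Quotient.sound ⟨Functor.leftUnitor _, fun X => ?_, fun g X => ?_⟩ <;>
    simp

lemma mk_mul (P Q : A.EquivariantAutoequivalence) : mk P * mk Q = mk (P.mul Q) := rfl

end Aut

/-- The unit `u : F_e ⟶ Id` of the action, determined by `ε_{e,e} = F_e u`. -/
noncomputable def unit : (A.F 1).functor ≅ 𝟭 C :=
  have := A.isEquivalence 1
  ((Functor.FullyFaithful.ofFullyFaithful (A.F 1).functor).whiskeringRight C).preimageIso
    (A.ε (one_mul 1))

lemma map_unit_hom_app (X : C) :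
    (A.F 1).functor.map (A.unit.hom.app X) = (A.ε (one_mul 1)).hom.app X := by
  have := A.isEquivalence 1
  have h : Functor.whiskerRight A.unit.hom (A.F 1).functor = (A.ε (one_mul 1)).hom :=
    ((Functor.FullyFaithful.ofFullyFaithful (A.F 1).functor).whiskeringRight C).map_preimage
      (X := (A.F 1).functor) (Y := 𝟭 C) (A.ε (one_mul 1)).hom
  exact congrArg (fun t => NatTrans.app t X) h

lemma unit_triangle :
    TriangleFunctor.IsTriangleNatTrans (A.F 1) (TriangleFunctor.id S) A.unit.hom := by
  intro X
  have := A.isEquivalence 1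
  have h1 := A.ε_triangle (one_mul 1) X
  have h2 := (A.F 1).ω.hom.naturality (A.unit.hom.app X)
  have h3 := A.map_unit_hom_app X
  have h4 := A.map_unit_hom_app (S.shift.obj X)
  have h5 : (A.F 1).ω.hom.app X ≫ S.shift.map (A.unit.hom.app X) =
      A.unit.hom.app (S.shift.obj X) := by
    apply (A.F 1).functor.map_injective
    rw [← cancel_mono ((A.F 1).ω.hom.app X)]
    dsimp at h1 h2 h3 h4 ⊢
    simp only [Functor.map_comp, Category.assoc] at *
    rw [h2, h3, h4, ← h1]
  exact h5.trans (Category.comp_id _).symm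

/-- The subgroup `Act_Δ(C; G)` of `Aut_Δ(C; G)`: the isoclasses `[(F, ω), δ]` such that `(F, ω)` is
isomorphic to `(F_a, ω_a)`, as a triangle functor, for some `a ∈ G`. As above, only closure under
products and the unit are recorded. -/
def Act : Submonoid A.Aut where
  carrier := {x | ∃ P : A.EquivariantAutoequivalence, Aut.mk P = x ∧
    ∃ a : G, TriangleFunctor.IsIsomorphic P.toTriangleFunctor (A.F a)}
  one_mem' := ⟨EquivariantAutoequivalence.one A, rfl, 1,
    TriangleFunctor.IsIsomorphic.symm ⟨A.unit, A.unit_triangle⟩⟩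
  mul_mem' := by
    rintro _ _ ⟨P, rfl, a, ha⟩ ⟨Q, rfl, b, hb⟩
    exact ⟨P.mul Q, rfl, a * b, (ha.comp hb).trans ⟨A.ε rfl, A.ε_triangle rfl⟩⟩

section Equivariantization

variable {A}

/-- The functor `(F, δ)^G : (X, α) ↦ (FX, α')` with `α'_g = (δ_g)_X ∘ F(α_g)`, acting on morphisms
by `F`. -/
def equivariantFunctor (P : A.EquivariantAutoequivalence) :
    A.EquivariantObject ⥤ A.EquivariantObject where
  obj X :=
    { obj := P.toTriangleFunctor.functor.obj X.obj
      α := fun g => P.toTriangleFunctor.functor.mapIso (X.α g) ≪≫ (P.δ g).app X.obj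
      α_mul := by
        intro g h m e
        have h1 := P.δ_mul e X.obj
        have h2 := (P.δ g).hom.naturality (X.α h).hom
        dsimp at h1 h2 ⊢
        rw [X.α_mul e]
        simp only [Functor.map_comp, Category.assoc]
        rw [h1, reassoc_of% h2] }
  map a := ⟨P.toTriangleFunctor.functor.map a.f, fun g => by
    have h1 := (P.δ g).hom.naturality a.f
    have h2 := congrArg P.toTriangleFunctor.functor.map (a.comm g)
    dsimp at h1 h2 ⊢
    simp only [Functor.map_comp] at h2
    rw [reassoc_of% h2, h1, Category.assoc]⟩
  map_id X := by ext; simp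
  map_comp a b := by ext; simp

@[simp] lemma equivariantFunctor_obj_obj (P : A.EquivariantAutoequivalence)
    (X : A.EquivariantObject) :
    ((equivariantFunctor P).obj X).obj = P.toTriangleFunctor.functor.obj X.obj := rfl

@[simp] lemma equivariantFunctor_map_f (P : A.EquivariantAutoequivalence)
    {X Y : A.EquivariantObject} (a : X ⟶ Y) :
    ((equivariantFunctor P).map a).f = P.toTriangleFunctor.functor.map a.f := rfl

lemma equivariantFunctor_obj_α_hom (P : A.EquivariantAutoequivalence)
    (X : A.EquivariantObject) (g : G) :
    (((equivariantFunctor P).obj X).α g).hom =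
      P.toTriangleFunctor.functor.map (X.α g).hom ≫ (P.δ g).hom.app X.obj := rfl

lemma equivariantFunctor_isEquivalence (P : A.EquivariantAutoequivalence) :
    (equivariantFunctor P).IsEquivalence := by
  have := P.isEquivalence
  refine { faithful := ⟨?_⟩, full := ⟨?_⟩, essSurj := ⟨?_⟩ }
  · intro X Y a b h
    apply hom_ext
    apply P.toTriangleFunctor.functor.map_injective
    exact congrArg (fun t => EquivariantHom.f t) h
  · intro X Y a
    obtain ⟨f, hf⟩ := P.toTriangleFunctor.functor.map_surjective a.f
    refine ⟨⟨f, fun g => ?_⟩, hom_ext hf⟩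
    apply P.toTriangleFunctor.functor.map_injective
    have h1 := a.comm g
    have h2 := (P.δ g).hom.naturality f
    rw [equivariantFunctor_obj_α_hom, equivariantFunctor_obj_α_hom, ← hf] at h1
    rw [← cancel_mono ((P.δ g).hom.app Y.obj)]
    dsimp at h1 h2 ⊢
    simp only [Functor.map_comp, Category.assoc] at *
    rw [h1, h2]
  · intro Z
    let θ := P.toTriangleFunctor.functor.objObjPreimageIso Z.obj
    let X := P.toTriangleFunctor.functor.objPreimage Z.obj
    let α : ∀ g, X ≅ (A.F g).functor.obj X := fun g =>
      P.toTriangleFunctor.functor.preimageIso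
        (θ ≪≫ Z.α g ≪≫ (A.F g).functor.mapIso θ.symm ≪≫ ((P.δ g).app X).symm)
    have hα : ∀ g, P.toTriangleFunctor.functor.map (α g).hom ≫ (P.δ g).hom.app X =
        θ.hom ≫ (Z.α g).hom ≫ (A.F g).functor.map θ.inv := by
      intro g
      simp [α]
      exact Category.comp_id _
    refine ⟨⟨X, α, ?_⟩, ⟨isoMk θ ?_⟩⟩
    · intro g h m e
      apply P.toTriangleFunctor.functor.map_injective
      rw [← cancel_mono ((P.δ m).hom.app X), hα m]
      have h1 := P.δ_mul e X
      have h2 := (P.δ g).hom.naturality (α h).hom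
      have h3 := hα g
      have h4 := congrArg (A.F g).functor.map (hα h)
      have h5 := (A.ε e).hom.naturality θ.inv
      have h6 := Z.α_mul e
      dsimp at h1 h2 h3 h4 h5 h6 ⊢
      simp only [Functor.map_comp, Category.assoc] at *
      rw [h1, reassoc_of% h2, reassoc_of% h3, reassoc_of% h4, h6, h5]
      simp only [← Functor.map_comp_assoc]
      simp
    · intro g
      have h := hα g
      have h7 : (P.toTriangleFunctor.functor.map (α g).hom ≫ (P.δ g).hom.app X) ≫
          (A.F g).functor.map θ.hom = θ.hom ≫ (Z.α g).hom := by
        rw [h, Category.assoc, Category.assoc, ← Functor.map_comp]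
        simp
      exact h7.symm

/-- The triangle functor `((F, δ)^G, ω^G)`, whose connecting isomorphism has components
`(ω^G)_{(X, α)} = ω_X`. -/
def equivariantTriangleFunctor (P : A.EquivariantAutoequivalence) :
    TriangleFunctor A.equivariantTriangleData where
  functor := equivariantFunctor P
  additive := ⟨by
    intro X Y a b
    have := P.toTriangleFunctor.additive
    exact hom_ext (P.toTriangleFunctor.functor.map_add (f := a.f) (g := b.f))⟩
  linear := ⟨by
    intro X Y a c
    have := P.toTriangleFunctor.linear
    exact hom_ext (Functor.Linear.map_smul a.f c)⟩
  ω := NatIso.ofComponents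
    (fun X => isoMk (P.toTriangleFunctor.ω.app X.obj) (by
      intro g
      have h1 := P.toTriangleFunctor.ω.hom.naturality (X.α g).hom
      have h2 := P.δ_triangle g X.obj
      change P.toTriangleFunctor.ω.hom.app X.obj ≫
          (S.shift.map (P.toTriangleFunctor.functor.map (X.α g).hom ≫ (P.δ g).hom.app X.obj) ≫
            (A.F g).ω.inv.app (P.toTriangleFunctor.functor.obj X.obj)) =
        (P.toTriangleFunctor.functor.map (S.shift.map (X.α g).hom ≫ (A.F g).ω.inv.app X.obj) ≫
          (P.δ g).hom.app (S.shift.obj X.obj)) ≫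
            (A.F g).functor.map (P.toTriangleFunctor.ω.hom.app X.obj)
      rw [← cancel_mono ((A.F g).ω.hom.app (P.toTriangleFunctor.functor.obj X.obj))]
      dsimp at h1 h2 ⊢
      simp only [Functor.map_comp, Category.assoc] at *
      rw [← h2, ← reassoc_of% h1]
      simp [← Functor.map_comp_assoc])) (by
      intro X Y a
      apply hom_ext
      exact P.toTriangleFunctor.ω.hom.naturality a.f)
  map_exact f g h H := P.toTriangleFunctor.map_exact f.f g.f h.f H

@[simp] lemma equivariantTriangleFunctor_functor (P : A.EquivariantAutoequivalence) :
    (equivariantTriangleFunctor P).functor = equivariantFunctor P := rfl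

lemma equivariantTriangleFunctor_ω_hom_app_f (P : A.EquivariantAutoequivalence)
    (X : A.EquivariantObject) :
    ((equivariantTriangleFunctor P).ω.hom.app X).f =
      P.toTriangleFunctor.ω.hom.app X.obj := rfl

/-- The strictly `Ĝ`-equivariant triangle autoequivalence `((F, ω), δ)^G` for the dual action. The
isomorphisms `(F, δ)^G F_χ ≅ F_χ (F, δ)^G` are identities on underlying objects. -/
def equivariantize (P : A.EquivariantAutoequivalence) :
    A.dualAction.EquivariantAutoequivalence where
  toTriangleFunctor := equivariantTriangleFunctor P
  isEquivalence := equivariantFunctor_isEquivalence P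
  δ χ := NatIso.ofComponents
    (fun X => isoMk (Iso.refl (P.toTriangleFunctor.functor.obj X.obj)) (by
      intro g
      have := P.toTriangleFunctor.linear
      change 𝟙 (P.toTriangleFunctor.functor.obj X.obj) ≫ (((χ g⁻¹ : kˣ) : k) •
          (P.toTriangleFunctor.functor.map (X.α g).hom ≫ (P.δ g).hom.app X.obj)) =
        (P.toTriangleFunctor.functor.map (((χ g⁻¹ : kˣ) : k) • (X.α g).hom) ≫
          (P.δ g).hom.app X.obj) ≫ (A.F g).functor.map (𝟙 _)
      rw [Functor.Linear.map_smul]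
      simp)) (by
      intro X Y a
      apply hom_ext
      exact (Category.comp_id (P.toTriangleFunctor.functor.map a.f)).trans
        (Category.id_comp _).symm)
  δ_triangle χ X := by
    apply hom_ext
    change (P.toTriangleFunctor.functor.map (𝟙 (S.shift.obj X.obj)) ≫
        P.toTriangleFunctor.ω.hom.app X.obj) ≫ S.shift.map (𝟙 _) =
      𝟙 _ ≫ P.toTriangleFunctor.ω.hom.app X.obj ≫ 𝟙 _
    simp
  δ_mul e X := by
    apply hom_ext
    change P.toTriangleFunctor.functor.map (𝟙 X.obj) ≫ 𝟙 _ = 𝟙 _ ≫ 𝟙 _ ≫ 𝟙 _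
    simp

lemma equivariantize_δ_hom_app_f (P : A.EquivariantAutoequivalence) (χ : G →* kˣ)
    (X : A.EquivariantObject) :
    (((equivariantize P).δ χ).hom.app X).f = 𝟙 (P.toTriangleFunctor.functor.obj X.obj) := rfl

lemma equivariantize_congr {P Q : A.EquivariantAutoequivalence} (h : P.IsIsomorphic Q) :
    (equivariantize P).IsIsomorphic (equivariantize Q) := by
  obtain ⟨φ, hφ, hδ⟩ := h
  refine ⟨NatIso.ofComponents (fun X => isoMk (φ.app X.obj) (fun g => ?_)) (fun {X Y} a => ?_),
    fun X => ?_, fun χ X => ?_⟩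
  · have h1 := φ.hom.naturality (X.α g).hom
    have h2 := hδ g X.obj
    change φ.hom.app X.obj ≫ Q.toTriangleFunctor.functor.map (X.α g).hom ≫
        (Q.δ g).hom.app X.obj =
      (P.toTriangleFunctor.functor.map (X.α g).hom ≫ (P.δ g).hom.app X.obj) ≫
        (A.F g).functor.map (φ.hom.app X.obj)
    rw [Category.assoc, h2, ← Category.assoc, ← h1, Category.assoc]
  · exact hom_ext (φ.hom.naturality a.f)
  · exact hom_ext (hφ X.obj)
  · apply hom_ext
    exact (Category.id_comp _).trans (Category.comp_id (φ.hom.app X.obj)).symm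

variable (A)

/-- The equivariantization homomorphism
`(-)^G : Aut_Δ(C; G) ⟶ Aut_Δ(C^G; Ĝ)`, `[(F, ω), δ] ↦ [((F, ω), δ)^G]`. -/
def equivariantization : A.Aut →* A.dualAction.Aut where
  toFun := Quotient.map equivariantize (fun _ _ h => equivariantize_congr h)
  map_one' := by
    refine Quotient.sound ⟨NatIso.ofComponents
      (fun X => isoMk (Iso.refl X.obj) (fun g => ?_)) (fun {X Y} a => ?_),
      fun X => ?_, fun χ X => ?_⟩
    · change 𝟙 X.obj ≫ (X.α g).hom = ((X.α g).hom ≫ 𝟙 _) ≫ (A.F g).functor.map (𝟙 X.obj)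
      simp
    · exact hom_ext ((Category.comp_id a.f).trans (Category.id_comp a.f).symm)
    · apply hom_ext
      change 𝟙 (S.shift.obj X.obj) ≫ S.shift.map (𝟙 X.obj) = 𝟙 _ ≫ 𝟙 _
      simp
    · exact hom_ext rfl
  map_mul' := by
    rintro ⟨P⟩ ⟨Q⟩
    refine Quotient.sound ⟨NatIso.ofComponents
      (fun X => isoMk (Iso.refl (P.toTriangleFunctor.functor.obj
        (Q.toTriangleFunctor.functor.obj X.obj))) (fun g => ?_)) (fun {X Y} a => ?_),
      fun X => ?_, fun χ X => ?_⟩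
    · change 𝟙 _ ≫ P.toTriangleFunctor.functor.map
          (Q.toTriangleFunctor.functor.map (X.α g).hom ≫ (Q.δ g).hom.app X.obj) ≫
            (P.δ g).hom.app (Q.toTriangleFunctor.functor.obj X.obj) =
        (P.toTriangleFunctor.functor.map (Q.toTriangleFunctor.functor.map (X.α g).hom) ≫
          P.toTriangleFunctor.functor.map ((Q.δ g).hom.app X.obj) ≫
            (P.δ g).hom.app (Q.toTriangleFunctor.functor.obj X.obj)) ≫ (A.F g).functor.map (𝟙 _)
      simp
    · apply hom_ext
      exact (Category.comp_id (P.toTriangleFunctor.functor.map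
        (Q.toTriangleFunctor.functor.map a.f))).trans (Category.id_comp _).symm
    · apply hom_ext
      change (P.toTriangleFunctor.functor.map (Q.toTriangleFunctor.ω.hom.app X.obj) ≫
          P.toTriangleFunctor.ω.hom.app (Q.toTriangleFunctor.functor.obj X.obj)) ≫
            S.shift.map (𝟙 _) =
        𝟙 _ ≫ P.toTriangleFunctor.functor.map (Q.toTriangleFunctor.ω.hom.app X.obj) ≫
          P.toTriangleFunctor.ω.hom.app (Q.toTriangleFunctor.functor.obj X.obj)
      simp
    · apply hom_ext
      change 𝟙 (P.toTriangleFunctor.functor.obj (Q.toTriangleFunctor.functor.obj X.obj)) ≫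
          𝟙 _ = 𝟙 _ ≫ P.toTriangleFunctor.functor.map (𝟙 _) ≫ 𝟙 _
      simp

@[simp] lemma equivariantization_mk (P : A.EquivariantAutoequivalence) :
    A.equivariantization (Aut.mk P) = Aut.mk (equivariantize P) := rfl

end Equivariantization

end TriangleAction

end

/-- A finite group `G` splits over `k`: the group algebra `kG` is isomorphic, as a `k`-algebra, to a
finite product of copies of `k`. -/
def SplitsOver (k : Type*) [Field k] (G : Type*) [Group G] : Prop :=
  ∃ n : ℕ, Nonempty (MonoidAlgebra k G ≃ₐ[k] (Fin n → k))

/-! The theorem is a duality statement. Write `Ψ` for the functor of `Ĝ`-invariants from `(T^G)^Ĝ`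
to `T`: an object of the source is an object of `T` with a `G`-equivariant structure and a
compatible action of all characters, and `Ψ` takes the image of the averaging idempotent `|G|⁻¹ ∑
χ`. As `G` splits over `k`, `|G|` is invertible in `k` and both orthogonality relations hold. Hence
the underlying object is the direct sum of its isotypic components, and the structure map `α_g`
identifies the component of `g` with `F_g` of the invariants. This makes `Ψ` an equivalence; the
induced objects `⨁ F_h X` give essential surjectivity. Under the evaluation isomorphism between `G`
and its double dual, `Ψ` is an equivariant triangle functor (`invariantsTri`) that also reflects
exact triangles (`exact_of_invariantsFunctor_map_exact`).

The decisive fact is `doubleEquivariant_comp_invariantsTri`: `Ψ` intertwines `(P^G)^Ĝ` with `P`. So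
`P` is recovered from `P^G`, which is injectivity. For surjectivity, given `Q` on `T^G`, the functor
`Q^Ĝ` is transported along `Ψ` to some `P` on `T`; then `(P^G)^Ĝ ≅ Q^Ĝ`, and injectivity for the
dual action gives `P^G ≅ Q`.

The argument is applied both to `T` and to `T^G`, so it uses only properties that pass to
equivariant objects: idempotent completeness, finite biproducts, and closure of exact triangles
under retracts of finite direct sums (`TriangleData.RetractClosed`). The axioms of a
pre-triangulated category enter only in proving this closure for `T` and in inverting
autoequivalences of `T`.

For the subgroups, let `F ≅ F_a`. The equivariant structure of `F` and the canonical one of `F_a`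
differ by automorphisms of the functors `F_{ga}`. When the triangle center is `k` these are scalars
`χ(g)`, and `χ` is a character, so `F^G` is a twist functor of the dual action. The converse is the
same statement for the dual action, brought back along `Ψ`. -/

/-! ### Characters of a finite abelian group that splits over `k`. -/

/-- The characters of a group that splits over `k` separate its elements. -/
lemma SplitsOver.exists_monoidHom_ne_one {k : Type*} [Field k] {G : Type*} [Group G]
    (h : SplitsOver k G) {g : G} (hg : g ≠ 1) : ∃ χ : G →* kˣ, χ g ≠ 1 := by
  obtain ⟨n, ⟨e⟩⟩ := h
  by_contra! H
  -- Each coordinate of `e`, restricted to `G`, is a character. If all characters are trivial at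
  -- `g`, then `e` takes the same value at `g` and at `1`.
  refine hg (MonoidAlgebra.of_injective (R := k) (e.injective (funext fun i => ?_)))
  let φ : G →* k :=
    ((Pi.evalRingHom (fun _ : Fin n => k) i).toMonoidHom.comp
      (e : MonoidAlgebra k G →* (Fin n → k))).comp (MonoidAlgebra.of k G)
  have h1 : φ g = 1 := by
    rw [← φ.coe_toHomUnits g, H, Units.val_one]
  have h2 : φ 1 = 1 := map_one φ
  exact h1.trans h2.symm

/-- A field over which a finite abelian group splits has enough roots of unity for that group. -/
lemma SplitsOver.hasEnoughRootsOfUnity {k : Type*} [Field k] {G : Type*} [CommGroup G] [Finite G]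
    (h : SplitsOver k G) : HasEnoughRootsOfUnity k (Monoid.exponent G) := by
  have : NeZero (Monoid.exponent G) := ⟨Monoid.exponent_ne_zero_of_finite⟩
  -- Characters take values in the roots of unity of order dividing the exponent. If `N` is the
  -- number of these, every character kills `g ^ N`; since characters separate elements, `g ^ N =
  -- 1`, so the exponent divides `N`.
  refine HasEnoughRootsOfUnity.of_card_le (Nat.le_of_dvd Nat.card_pos ?_)
  rw [Monoid.exponent_dvd_iff_forall_pow_eq_one]
  intro g
  by_contra hg
  obtain ⟨χ, hχ⟩ := h.exists_monoidHom_ne_one hg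
  apply hχ
  let x : rootsOfUnity (Monoid.exponent G) k :=
    ⟨χ g, by rw [mem_rootsOfUnity, ← map_pow, Monoid.pow_exponent_eq_one, map_one]⟩
  have := congrArg Subtype.val (pow_card_eq_one' (x := x))
  rw [map_pow]
  simpa [x] using this

/-- First orthogonality relation: translation by `g` permutes the summands and multiplies the sum by
`χ g`, which is not `1` for a suitable `g`. -/
lemma sum_character_apply {k : Type*} [Field k] {G : Type*} [CommGroup G] [Fintype G]
    (χ : G →* kˣ) (hχ : χ ≠ 1) : ∑ g, (χ g : k) = 0 := by
  obtain ⟨g, hg⟩ : ∃ g, χ g ≠ 1 := by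
    by_contra! H
    exact hχ (MonoidHom.ext H)
  have h : (χ g : k) * ∑ h, (χ h : k) = ∑ h, (χ h : k) := by
    rw [Finset.mul_sum]
    exact Fintype.sum_equiv (Equiv.mulLeft g) _ _ fun h => by simp
  have h2 : ((χ g : k) - 1) * ∑ h, (χ h : k) = 0 := by rw [sub_mul, h, one_mul, sub_self]
  exact (mul_eq_zero.mp h2).resolve_left fun h3 =>
    hg (Units.ext (by simpa using sub_eq_zero.mp h3))

/-- Second orthogonality relation: the same argument with multiplication by a character `ψ` such
that `ψ g ≠ 1`. -/
lemma sum_characters_apply {k : Type*} [Field k] {G : Type*} [CommGroup G] [Finite G]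
    [Fintype (G →* kˣ)] [HasEnoughRootsOfUnity k (Monoid.exponent G)] (g : G) (hg : g ≠ 1) :
    ∑ χ : G →* kˣ, (χ g : k) = 0 := by
  obtain ⟨ψ, hψ⟩ := CommGroup.exists_apply_ne_one_of_hasEnoughRootsOfUnity G k hg
  have h : (ψ g : k) * ∑ χ : G →* kˣ, (χ g : k) = ∑ χ : G →* kˣ, (χ g : k) := by
    rw [Finset.mul_sum]
    exact Fintype.sum_equiv (Equiv.mulLeft ψ) _ _ fun χ => by simp
  have h2 : ((ψ g : k) - 1) * ∑ χ : G →* kˣ, (χ g : k) = 0 := by rw [sub_mul, h, one_mul, sub_self]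
  exact (mul_eq_zero.mp h2).resolve_left fun h3 =>
    hψ (Units.ext (by simpa using sub_eq_zero.mp h3))

/-- If the characteristic `p` divided the order, Cauchy's theorem would make `p` divide the
exponent, whereas a primitive root of unity of order `n` in a field forces `n ≠ 0` there. This
permits averaging over characters. -/
lemma natCard_ne_zero_of_hasEnoughRootsOfUnity (k : Type*) [Field k] (G : Type*) [CommGroup G]
    [Finite G] [HasEnoughRootsOfUnity k (Monoid.exponent G)] :
    (Nat.card G : k) ≠ 0 := by
  intro h0
  obtain ⟨p, hp⟩ := CharP.exists k
  have hpc : p ∣ Nat.card G := (CharP.cast_eq_zero_iff k p _).mp h0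
  rcases CharP.char_is_prime_or_zero k p with hp' | rfl
  · have : Fact p.Prime := ⟨hp'⟩
    obtain ⟨g, hg⟩ := exists_prime_orderOf_dvd_card' p hpc
    have h1 : p ∣ Monoid.exponent G := hg ▸ Monoid.order_dvd_exponent g
    have : NeZero (Monoid.exponent G) := ⟨Monoid.exponent_ne_zero_of_finite⟩
    obtain ⟨ζ, hζ⟩ := HasEnoughRootsOfUnity.exists_primitiveRoot k (Monoid.exponent G)
    exact hζ.neZero'.out ((CharP.cast_eq_zero_iff k p _).mpr h1)
  · exact Nat.card_pos.ne' (zero_dvd_iff.mp hpc)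

/-- Since `Ĝ` is non-canonically isomorphic to `G`, every result proved for `A` also applies to
`A.dualAction`. -/
lemma hasEnoughRootsOfUnity_characters (k : Type*) [Field k] (G : Type*) [CommGroup G] [Finite G]
    [HasEnoughRootsOfUnity k (Monoid.exponent G)] :
    HasEnoughRootsOfUnity k (Monoid.exponent (G →* kˣ)) := by
  obtain ⟨e⟩ := CommGroup.monoidHom_mulEquiv_of_hasEnoughRootsOfUnity G k
  rw [Monoid.exponent_eq_of_mulEquiv e]
  infer_instance

/-- Injective because characters separate elements; bijective because `G`, its dual and its double
dual have the same cardinality. -/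
lemma characterEval_bijective (k : Type*) [Field k] (G : Type*) [CommGroup G] [Finite G]
    [HasEnoughRootsOfUnity k (Monoid.exponent G)] :
    Function.Bijective (MonoidHom.eval : G →* (G →* kˣ) →* kˣ) := by
  have := hasEnoughRootsOfUnity_characters k G
  rw [Nat.bijective_iff_injective_and_card,
    CommGroup.card_monoidHom_of_hasEnoughRootsOfUnity,
    CommGroup.card_monoidHom_of_hasEnoughRootsOfUnity]
  refine ⟨fun g h e => (CommGroup.forall_apply_eq_apply_iff G (M := k)).mp fun χ => ?_, rfl⟩
  exact DFunLike.congr_fun e χ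

/-! ### Exact triangles are closed under retracts of finite direct sums. -/

/-- A triangle is a retract of a finite direct sum of the exact triangles `X_j ⟶ Y_j ⟶ Z_j ⟶ ΣX_j`
if there are morphisms of triangles `i_j` from and `p_j` to these triangles with `∑ p_j i_j = 1`.
The property says that such a triangle is exact. -/
def TriangleData.RetractClosed {k : Type*} [Field k] {C : Type*} [Category* C] [Preadditive C]
    [Linear k C] (S : TriangleData k C) : Prop :=
  ∀ (n : ℕ) {X Y Z : C} (f : X ⟶ Y) (g : Y ⟶ Z) (h : Z ⟶ S.shift.obj X) (X' Y' Z' : Fin n → C)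
    (f' : ∀ j, X' j ⟶ Y' j) (g' : ∀ j, Y' j ⟶ Z' j) (h' : ∀ j, Z' j ⟶ S.shift.obj (X' j))
    (_ : ∀ j, S.Exact (f' j) (g' j) (h' j))
    (iX : ∀ j, X' j ⟶ X) (iY : ∀ j, Y' j ⟶ Y) (iZ : ∀ j, Z' j ⟶ Z)
    (pX : ∀ j, X ⟶ X' j) (pY : ∀ j, Y ⟶ Y' j) (pZ : ∀ j, Z ⟶ Z' j)
    (_ : ∀ j, f' j ≫ iY j = iX j ≫ f) (_ : ∀ j, g' j ≫ iZ j = iY j ≫ g)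
    (_ : ∀ j, h' j ≫ S.shift.map (iX j) = iZ j ≫ h)
    (_ : ∀ j, f ≫ pY j = pX j ≫ f' j) (_ : ∀ j, g ≫ pZ j = pY j ≫ g' j)
    (_ : ∀ j, h ≫ S.shift.map (pX j) = pZ j ≫ h' j)
    (_ : ∑ j, pX j ≫ iX j = 𝟙 X) (_ : ∑ j, pY j ≫ iY j = 𝟙 Y) (_ : ∑ j, pZ j ≫ iZ j = 𝟙 Z),
    S.Exact f g h

namespace TriangleData.RetractClosed

variable {k : Type*} [Field k] {C : Type*} [Category* C] [Preadditive C] [Linear k C]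
  {S : TriangleData k C}

lemma exact_of_fintype (H : S.RetractClosed) {J : Type*} [Fintype J] {X Y Z : C} (f : X ⟶ Y)
    (g : Y ⟶ Z) (h : Z ⟶ S.shift.obj X) (X' Y' Z' : J → C)
    (f' : ∀ j, X' j ⟶ Y' j) (g' : ∀ j, Y' j ⟶ Z' j) (h' : ∀ j, Z' j ⟶ S.shift.obj (X' j))
    (hE : ∀ j, S.Exact (f' j) (g' j) (h' j))
    (iX : ∀ j, X' j ⟶ X) (iY : ∀ j, Y' j ⟶ Y) (iZ : ∀ j, Z' j ⟶ Z)
    (pX : ∀ j, X ⟶ X' j) (pY : ∀ j, Y ⟶ Y' j) (pZ : ∀ j, Z ⟶ Z' j)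
    (h1 : ∀ j, f' j ≫ iY j = iX j ≫ f) (h2 : ∀ j, g' j ≫ iZ j = iY j ≫ g)
    (h3 : ∀ j, h' j ≫ S.shift.map (iX j) = iZ j ≫ h)
    (h4 : ∀ j, f ≫ pY j = pX j ≫ f' j) (h5 : ∀ j, g ≫ pZ j = pY j ≫ g' j)
    (h6 : ∀ j, h ≫ S.shift.map (pX j) = pZ j ≫ h' j)
    (hX : ∑ j, pX j ≫ iX j = 𝟙 X) (hY : ∑ j, pY j ≫ iY j = 𝟙 Y)
    (hZ : ∑ j, pZ j ≫ iZ j = 𝟙 Z) : S.Exact f g h := by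
  let e := (Fintype.equivFin J).symm
  exact H (Fintype.card J) f g h (X' ∘ e) (Y' ∘ e) (Z' ∘ e) (fun j => f' (e j))
    (fun j => g' (e j)) (fun j => h' (e j)) (fun j => hE _) (fun j => iX (e j))
    (fun j => iY (e j)) (fun j => iZ (e j)) (fun j => pX (e j)) (fun j => pY (e j))
    (fun j => pZ (e j)) (fun _ => h1 _) (fun _ => h2 _) (fun _ => h3 _) (fun _ => h4 _)
    (fun _ => h5 _) (fun _ => h6 _) (by rw [← hX]; exact e.sum_comp fun j => pX j ≫ iX j)
    (by rw [← hY]; exact e.sum_comp fun j => pY j ≫ iY j)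
    (by rw [← hZ]; exact e.sum_comp fun j => pZ j ≫ iZ j)

lemma exact_of_retract (H : S.RetractClosed) {X Y Z X' Y' Z' : C} {f : X ⟶ Y}
    {g : Y ⟶ Z} {h : Z ⟶ S.shift.obj X} {f' : X' ⟶ Y'} {g' : Y' ⟶ Z'}
    {h' : Z' ⟶ S.shift.obj X'} (hE : S.Exact f' g' h')
    (iX : X' ⟶ X) (iY : Y' ⟶ Y) (iZ : Z' ⟶ Z) (pX : X ⟶ X') (pY : Y ⟶ Y') (pZ : Z ⟶ Z')
    (h1 : f' ≫ iY = iX ≫ f) (h2 : g' ≫ iZ = iY ≫ g) (h3 : h' ≫ S.shift.map iX = iZ ≫ h)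
    (h4 : f ≫ pY = pX ≫ f') (h5 : g ≫ pZ = pY ≫ g') (h6 : h ≫ S.shift.map pX = pZ ≫ h')
    (hX : pX ≫ iX = 𝟙 X) (hY : pY ≫ iY = 𝟙 Y) (hZ : pZ ≫ iZ = 𝟙 Z) : S.Exact f g h :=
  H.exact_of_fintype (J := Unit) f g h (fun _ => X') (fun _ => Y') (fun _ => Z') (fun _ => f')
    (fun _ => g') (fun _ => h') (fun _ => hE) (fun _ => iX) (fun _ => iY) (fun _ => iZ)
    (fun _ => pX) (fun _ => pY) (fun _ => pZ) (fun _ => h1) (fun _ => h2) (fun _ => h3)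
    (fun _ => h4) (fun _ => h5) (fun _ => h6) (by simpa using hX) (by simpa using hY)
    (by simpa using hZ)

lemma exact_of_iso (H : S.RetractClosed) {X Y Z X' Y' Z' : C} {f : X ⟶ Y}
    {g : Y ⟶ Z} {h : Z ⟶ S.shift.obj X} {f' : X' ⟶ Y'} {g' : Y' ⟶ Z'}
    {h' : Z' ⟶ S.shift.obj X'} (hE : S.Exact f' g' h') (eX : X' ≅ X) (eY : Y' ≅ Y) (eZ : Z' ≅ Z)
    (h1 : f' ≫ eY.hom = eX.hom ≫ f) (h2 : g' ≫ eZ.hom = eY.hom ≫ g)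
    (h3 : h' ≫ S.shift.map eX.hom = eZ.hom ≫ h) : S.Exact f g h :=
  H.exact_of_retract hE eX.hom eY.hom eZ.hom eX.inv eY.inv eZ.inv h1 h2 h3
    (by rw [Iso.comp_inv_eq, Category.assoc, h1, Iso.inv_hom_id_assoc])
    (by rw [Iso.comp_inv_eq, Category.assoc, h2, Iso.inv_hom_id_assoc])
    (by rw [← Functor.mapIso_inv, Iso.comp_inv_eq, Functor.mapIso_hom, Category.assoc, h3,
      Iso.inv_hom_id_assoc])
    (by simp) (by simp) (by simp)

end TriangleData.RetractClosed

open Pretriangulated in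
-- Complete `f` to a distinguished triangle with cone `W` and compare `W` with `Z` in both
-- directions, by gluing the third components of morphisms of triangles to and from the summands.
-- Both composites turn out to be isomorphisms, so the given triangle is isomorphic to the
-- distinguished one. No octahedral axiom is needed.
lemma TriangleData.ofPretriangulated_retractClosed (k : Type*) [Field k] (T : Type*) [Category* T]
    [Preadditive T] [Linear k T] [Limits.HasZeroObject T] [HasShift T ℤ]
    [∀ n : ℤ, (shiftFunctor T n).Additive] [∀ n : ℤ, (shiftFunctor T n).Linear k]
    [Pretriangulated T] : (TriangleData.ofPretriangulated k T).RetractClosed := by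
  intro n X Y Z f g h X' Y' Z' f' g' h' hE iX iY iZ pX pY pZ h1 h2 h3 h4 h5 h6 hX hY hZ
  change ∀ j, Triangle.mk (f' j) (g' j) (h' j) ∈ distTriang T at hE
  change Z ⟶ X⟦(1 : ℤ)⟧ at h
  change ∀ j, Z' j ⟶ (X' j)⟦(1 : ℤ)⟧ at h'
  change ∀ j, h' j ≫ (iX j)⟦(1 : ℤ)⟧' = iZ j ≫ h at h3
  change ∀ j, h ≫ (pX j)⟦(1 : ℤ)⟧' = pZ j ≫ h' j at h6
  change Triangle.mk f g h ∈ distTriang T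
  obtain ⟨W, g₁, k₁, hW⟩ := distinguished_cocone_triangle f
  have hu : ∀ j, ∃ u : W ⟶ Z' j, g₁ ≫ u = pY j ≫ g' j ∧
      k₁ ≫ (pX j)⟦(1 : ℤ)⟧' = u ≫ h' j := fun j =>
    complete_distinguished_triangle_morphism _ _ hW (hE j) (pX j) (pY j) (h4 j)
  have hv : ∀ j, ∃ v : Z' j ⟶ W, g' j ≫ v = iY j ≫ g₁ ∧
      h' j ≫ (iX j)⟦(1 : ℤ)⟧' = v ≫ k₁ := fun j =>
    complete_distinguished_triangle_morphism _ _ (hE j) hW (iX j) (iY j) (h1 j)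
  choose u hu₁ hu₂ using hu
  choose v hv₁ hv₂ using hv
  have hX' : ∑ j, (pX j)⟦(1 : ℤ)⟧' ≫ (iX j)⟦(1 : ℤ)⟧' = 𝟙 (X⟦(1 : ℤ)⟧) := by
    simp only [← Functor.map_comp]
    rw [← Functor.map_sum, hX, CategoryTheory.Functor.map_id]
  have sumY : ∀ {V : T} (a : Y ⟶ V), ∑ j, pY j ≫ iY j ≫ a = a := fun a => by
    simp only [← Category.assoc]
    rw [← Preadditive.sum_comp, hY, Category.id_comp]
  have sumX : ∀ {V : T} (a : V ⟶ X⟦(1 : ℤ)⟧),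
      ∑ j, a ≫ (pX j)⟦(1 : ℤ)⟧' ≫ (iX j)⟦(1 : ℤ)⟧' = a := fun a => by
    rw [← Preadditive.comp_sum, hX', Category.comp_id]
  -- `φ` and `ψ` are compatible with the maps from `Y` and to `ΣX` because the projections and
  -- inclusions of the summands compose and sum to the identity.
  let φ : W ⟶ Z := ∑ j, u j ≫ iZ j
  let ψ : Z ⟶ W := ∑ j, pZ j ≫ v j
  have hφ₁ : g₁ ≫ φ = g := by
    rw [← sumY g, Preadditive.comp_sum]
    exact Finset.sum_congr rfl fun j _ => by
      rw [← Category.assoc, hu₁, Category.assoc, h2]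
  have hφ₂ : φ ≫ h = k₁ := by
    rw [← sumX k₁, Preadditive.sum_comp]
    exact Finset.sum_congr rfl fun j _ => by
      rw [Category.assoc, ← h3, ← Category.assoc, ← hu₂, Category.assoc]
  have hψ₁ : g ≫ ψ = g₁ := by
    rw [← sumY g₁, Preadditive.comp_sum]
    exact Finset.sum_congr rfl fun j _ => by
      rw [← Category.assoc, h5, Category.assoc, hv₁]
  have hψ₂ : ψ ≫ k₁ = h := by
    rw [← sumX h, Preadditive.sum_comp]
    exact Finset.sum_congr rfl fun j _ => by
      rw [Category.assoc, ← hv₂, ← Category.assoc, ← h6, Category.assoc]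
  clear_value φ ψ
  -- An endomorphism of a distinguished triangle that is the identity on two terms is invertible on
  -- the third.
  have i₁ : IsIso (φ ≫ ψ) :=
    isIso₃_of_isIso₁₂ (T := Triangle.mk f g₁ k₁) (T' := Triangle.mk f g₁ k₁)
      { hom₁ := 𝟙 X, hom₂ := 𝟙 Y, hom₃ := φ ≫ ψ
        comm₁ := (Category.comp_id f).trans (Category.id_comp f).symm
        comm₂ := ((Category.assoc g₁ φ ψ).symm.trans (hφ₁ ▸ hψ₁)).trans
          (Category.id_comp g₁).symm
        comm₃ := by
          refine Eq.trans ?_ (Category.assoc φ ψ k₁).symm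
          rw [hψ₂, hφ₂]
          exact (congrArg _ (CategoryTheory.Functor.map_id _ X)).trans (Category.comp_id k₁) }
      hW hW (IsIso.id X) (IsIso.id Y)
  -- The other composite lives on a triangle not yet known to be distinguished, so the five lemma is
  -- unavailable. Its difference from `𝟙 Z` is killed by `h`; on each summand it therefore factors
  -- through `g' j`, and altogether it factors through `g`.
  have hfac : ∃ s : Z ⟶ Y, ψ ≫ φ - 𝟙 Z = s ≫ g := by
    have hs : ∀ j, ∃ s : Z ⟶ Y' j, (ψ ≫ φ - 𝟙 Z) ≫ pZ j = s ≫ g' j := fun j =>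
      Triangle.coyoneda_exact₃ _ (hE j) _ (by
        change ((ψ ≫ φ - 𝟙 Z) ≫ pZ j) ≫ h' j = 0
        rw [Category.assoc, ← h6, ← Category.assoc, Preadditive.sub_comp, Category.assoc, hφ₂,
          hψ₂, Category.id_comp, sub_self, Limits.zero_comp])
    choose s hs using hs
    refine ⟨∑ j, s j ≫ iY j, ?_⟩
    refine (Category.comp_id (ψ ≫ φ - 𝟙 Z)).symm.trans ?_
    refine (congrArg (fun t => (ψ ≫ φ - 𝟙 Z) ≫ t) hZ.symm).trans ?_
    rw [Preadditive.comp_sum, Preadditive.sum_comp]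
    exact Finset.sum_congr rfl fun j _ => by
      rw [← Category.assoc, hs, Category.assoc, h2, Category.assoc]
  obtain ⟨s, hs⟩ := hfac
  -- The difference factors through `g` and is also annihilated by precomposition with `g`, hence
  -- has square zero; `𝟙 Z` plus a square-zero endomorphism is invertible.
  have hsq : (ψ ≫ φ - 𝟙 Z) ≫ (ψ ≫ φ - 𝟙 Z) = 0 := by
    nth_rw 1 [hs]
    rw [Category.assoc, Preadditive.comp_sub, ← Category.assoc g, hψ₁, hφ₁, Category.comp_id,
      sub_self, Limits.comp_zero]
  have i₂ : IsIso (ψ ≫ φ) := by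
    have e : ψ ≫ φ = 𝟙 Z + (ψ ≫ φ - 𝟙 Z) := (add_sub_cancel (𝟙 Z) (ψ ≫ φ)).symm
    rw [e]
    clear e
    refine ⟨𝟙 Z - (ψ ≫ φ - 𝟙 Z), ?_, ?_⟩
    · rw [Preadditive.add_comp, Preadditive.comp_sub (f := ψ ≫ φ - 𝟙 Z), hsq, Category.comp_id,
        Category.id_comp, sub_zero, sub_add_cancel]
    · rw [Preadditive.sub_comp, Preadditive.comp_add _ _ _ (ψ ≫ φ - 𝟙 Z), hsq, Category.comp_id,
        Category.id_comp, add_zero, add_sub_cancel_right]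
  have i₃ : IsIso φ := by
    have : IsSplitMono φ := ⟨⟨ψ ≫ inv (φ ≫ ψ), by rw [← Category.assoc, IsIso.hom_inv_id]⟩⟩
    have : Epi φ := epi_of_epi ψ φ
    exact isIso_of_epi_of_isSplitMono φ
  refine isomorphic_distinguished _ hW _ (Triangle.isoMk _ _ (Iso.refl X) (Iso.refl Y)
    (asIso φ).symm ?_ ?_ ?_)
  · exact (Category.comp_id f).trans (Category.id_comp f).symm
  · exact ((asIso φ).comp_inv_eq.mpr hφ₁.symm).trans (Category.id_comp g₁).symm
  · refine ((congrArg _ (CategoryTheory.Functor.map_id _ X)).trans (Category.comp_id h)).trans ?_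
    exact ((asIso φ).inv_comp_eq.mpr hφ₂.symm).symm

/-! ### Descent along equivalences, and triangle functors between different categories. -/

namespace CategoryTheory.Functor

variable {C D E : Type*} [Category* C] [Category* D] [Category* E]

/-- Natural transformations that agree on the image of an essentially surjective functor agree. -/
lemma natTrans_app_eq_of_essSurj (Ψ : D ⥤ C) [Ψ.EssSurj] {P Q : C ⥤ E} {σ τ : P ⟶ Q}
    (h : ∀ Z, σ.app (Ψ.obj Z) = τ.app (Ψ.obj Z)) (X : C) : σ.app X = τ.app X := by
  let e := Ψ.objObjPreimageIso X
  rw [← cancel_epi (P.map e.hom), σ.naturality, τ.naturality, h]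

/-- An isomorphism `Ψ ⋙ P ≅ Ψ ⋙ Q` descends along an equivalence `Ψ`. -/
noncomputable def descendIso (Ψ : D ⥤ C) [Ψ.IsEquivalence] {P Q : C ⥤ E}
    (σ : Ψ ⋙ P ≅ Ψ ⋙ Q) : P ≅ Q :=
  NatIso.ofComponents (fun X => P.mapIso (Ψ.objObjPreimageIso X).symm ≪≫
    σ.app (Ψ.objPreimage X) ≪≫ Q.mapIso (Ψ.objObjPreimageIso X)) (by
      intro X Y f
      let a := Ψ.objObjPreimageIso X
      let b := Ψ.objObjPreimageIso Y
      obtain ⟨f', hf'⟩ := Ψ.map_surjective (a.hom ≫ f ≫ b.inv)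
      have h : P.map (Ψ.map f') ≫ σ.hom.app _ = σ.hom.app _ ≫ Q.map (Ψ.map f') :=
        σ.hom.naturality f'
      have h1 : f = a.inv ≫ Ψ.map f' ≫ b.hom := by rw [hf']; simp
      change P.map f ≫ P.map b.inv ≫ σ.hom.app _ ≫ Q.map b.hom =
        (P.map a.inv ≫ σ.hom.app _ ≫ Q.map a.hom) ≫ Q.map f
      rw [h1]
      simp only [Functor.map_comp, Category.assoc, ← P.map_comp_assoc b.hom, b.hom_inv_id,
        P.map_id, Category.id_comp, reassoc_of% h, ← Q.map_comp_assoc a.hom, a.hom_inv_id,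
        Q.map_id])

/-- The chosen isomorphism from the preimage of `Ψ Z` is itself of the form `Ψ f`, so naturality of
`σ` removes it. This formula characterizes the descended transformation. -/
lemma descendIso_hom_app (Ψ : D ⥤ C) [Ψ.IsEquivalence] {P Q : C ⥤ E}
    (σ : Ψ ⋙ P ≅ Ψ ⋙ Q) (Z : D) :
    (Ψ.descendIso σ).hom.app (Ψ.obj Z) = σ.hom.app Z := by
  obtain ⟨f, hf⟩ := Ψ.map_surjective (Ψ.objObjPreimageIso (Ψ.obj Z)).hom
  have h := σ.hom.naturality f
  dsimp [descendIso] at h ⊢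
  rw [hf] at h
  rw [← h, ← P.map_comp_assoc]
  simp

end CategoryTheory.Functor

section

variable {k : Type*} [Field k]
  {C : Type*} [Category* C] [Preadditive C] [Linear k C]
  {D : Type*} [Category* D] [Preadditive D] [Linear k D]
  {E : Type*} [Category* E] [Preadditive E] [Linear k E]

/-- A `k`-linear triangle functor between two categories with translation and exact triangles. -/
structure TriFunctor (S : TriangleData k C) (S' : TriangleData k D) where
  functor : C ⥤ D
  additive : functor.Additive
  linear : functor.Linear k
  /-- the connecting isomorphism, with components `F(ΣX) ≅ Σ(FX)` -/
  ω : S.shift ⋙ functor ≅ functor ⋙ S'.shift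
  map_exact : ∀ {X Y Z : C} (f : X ⟶ Y) (g : Y ⟶ Z) (h : Z ⟶ S.shift.obj X), S.Exact f g h →
    S'.Exact (functor.map f) (functor.map g) (functor.map h ≫ ω.hom.app X)

namespace TriFunctor

variable {S : TriangleData k C} {S' : TriangleData k D} {S'' : TriangleData k E}

/-- A triangle endofunctor. -/
def ofEndo (P : TriangleFunctor S) : TriFunctor S S where
  functor := P.functor
  additive := P.additive
  linear := P.linear
  ω := P.ω
  map_exact := P.map_exact

/-- The composite, in diagrammatic order. -/
def comp (P : TriFunctor S S') (Q : TriFunctor S' S'') : TriFunctor S S'' where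
  functor := P.functor ⋙ Q.functor
  additive := by
    have := P.additive
    have := Q.additive
    infer_instance
  linear := by
    have := P.linear
    have := Q.linear
    infer_instance
  ω := NatIso.ofComponents
    (fun X => Q.functor.mapIso (P.ω.app X) ≪≫ Q.ω.app (P.functor.obj X)) (by
      intro X Y f
      have h1 := P.ω.hom.naturality f
      have h2 := Q.ω.hom.naturality (P.functor.map f)
      dsimp at h1 h2 ⊢
      rw [← Category.assoc, ← Q.functor.map_comp, h1, Q.functor.map_comp, Category.assoc, h2,
        Category.assoc])
  map_exact f g h H := by
    have := Q.map_exact _ _ _ (P.map_exact f g h H)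
    simpa using this

/-- The transformation `φ` respects the connecting isomorphisms. -/
def Compatible {P Q : TriFunctor S S'} (φ : P.functor ⟶ Q.functor) : Prop :=
  ∀ X : C, P.ω.hom.app X ≫ S'.shift.map (φ.app X) = φ.app (S.shift.obj X) ≫ Q.ω.hom.app X

/-- Two triangle functors are isomorphic. -/
def IsIsomorphic (P Q : TriFunctor S S') : Prop :=
  ∃ φ : P.functor ≅ Q.functor, Compatible φ.hom

@[simp] lemma comp_functor (P : TriFunctor S S') (Q : TriFunctor S' S'') :
    (P.comp Q).functor = P.functor ⋙ Q.functor := rfl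

@[simp] lemma comp_ω_hom_app (P : TriFunctor S S') (Q : TriFunctor S' S'') (X : C) :
    (P.comp Q).ω.hom.app X =
      Q.functor.map (P.ω.hom.app X) ≫ Q.ω.hom.app (P.functor.obj X) := rfl

lemma Compatible.symm {P Q : TriFunctor S S'} {φ : P.functor ≅ Q.functor}
    (hφ : Compatible φ.hom) : Compatible (P := Q) (Q := P) φ.inv := fun X => by
  rw [← cancel_epi (φ.hom.app (S.shift.obj X)), ← Category.assoc, ← hφ X]
  simp [← S'.shift.map_comp]

lemma Compatible.trans {P Q R : TriFunctor S S'} {φ : P.functor ⟶ Q.functor}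
    {ψ : Q.functor ⟶ R.functor} (hφ : Compatible φ) (hψ : Compatible ψ) :
    Compatible (P := P) (Q := R) (φ ≫ ψ) := fun X => by
  simp only [NatTrans.comp_app, Functor.map_comp]
  rw [← Category.assoc, hφ X, Category.assoc, hψ X, Category.assoc]

lemma Compatible.whiskerRight {P Q : TriFunctor S S'} {φ : P.functor ⟶ Q.functor}
    (hφ : Compatible φ) (R : TriFunctor S' S'') :
    Compatible (P := P.comp R) (Q := Q.comp R) (Functor.whiskerRight φ R.functor) := fun X => by
  have h1 := congrArg R.functor.map (hφ X)
  have h2 := R.ω.hom.naturality (φ.app X)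
  dsimp at h1 h2 ⊢
  rw [Functor.map_comp, Functor.map_comp] at h1
  rw [Category.assoc, ← h2, reassoc_of% h1]

/-- Compatibility is an equality of two natural transformations, so it may be tested on the image of
`P`, where the value of the descended isomorphism is known. -/
lemma Compatible.descend {P : TriFunctor S S'} [P.functor.IsEquivalence] {Q R : TriFunctor S' S''}
    {σ : P.functor ⋙ Q.functor ≅ P.functor ⋙ R.functor}
    (hσ : Compatible (P := P.comp Q) (Q := P.comp R) σ.hom) :
    Compatible (P := Q) (Q := R) (P.functor.descendIso σ).hom := fun X => by
  refine P.functor.natTrans_app_eq_of_essSurj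
    (σ := Q.ω.hom ≫ Functor.whiskerRight (P.functor.descendIso σ).hom S''.shift)
    (τ := Functor.whiskerLeft S'.shift (P.functor.descendIso σ).hom ≫ R.ω.hom) (fun Z => ?_) X
  have h1 := hσ Z
  have h2 := (P.functor.descendIso σ).hom.naturality (P.ω.hom.app Z)
  have h3 := P.functor.descendIso_hom_app σ Z
  have h4 := P.functor.descendIso_hom_app σ (S.shift.obj Z)
  dsimp at h1 h2 h3 h4 ⊢
  have := Functor.map_isIso Q.functor (P.ω.hom.app Z)
  rw [h3, ← cancel_epi (Q.functor.map (P.ω.hom.app Z)), reassoc_of% h2, h4, ← h1,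
    Category.assoc]

lemma IsIsomorphic.symm {P Q : TriFunctor S S'} (h : P.IsIsomorphic Q) : Q.IsIsomorphic P := by
  obtain ⟨φ, hφ⟩ := h
  exact ⟨φ.symm, hφ.symm⟩

lemma IsIsomorphic.trans {P Q R : TriFunctor S S'} (h : P.IsIsomorphic Q)
    (h' : Q.IsIsomorphic R) : P.IsIsomorphic R := by
  obtain ⟨φ, hφ⟩ := h
  obtain ⟨ψ, hψ⟩ := h'
  exact ⟨φ ≪≫ ψ, hφ.trans hψ⟩

lemma IsIsomorphic.whiskerRight {P Q : TriFunctor S S'} (h : P.IsIsomorphic Q)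
    (R : TriFunctor S' S'') : (P.comp R).IsIsomorphic (Q.comp R) := by
  obtain ⟨φ, hφ⟩ := h
  exact ⟨Functor.isoWhiskerRight φ R.functor, hφ.whiskerRight R⟩

lemma IsIsomorphic.cancel_left {P : TriFunctor S S'} (hP : P.functor.IsEquivalence)
    {Q R : TriFunctor S' S''} (h : (P.comp Q).IsIsomorphic (P.comp R)) : Q.IsIsomorphic R := by
  obtain ⟨φ, hφ⟩ := h
  exact ⟨P.functor.descendIso φ, hφ.descend⟩

end TriFunctor

end

/-! ### Equivariant triangle functors and their extension along equivalences. -/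

section

variable {k : Type*} [Field k]
  {C : Type*} [Category* C] [Preadditive C] [Linear k C]
  {D : Type*} [Category* D] [Preadditive D] [Linear k D]
  {E : Type*} [Category* E] [Preadditive E] [Linear k E]

/-- A `G`-equivariant triangle functor between categories with triangle `G`-actions. -/
structure EquivariantTriFunctor {G : Type*} [Group G] {S : TriangleData k C}
    {S' : TriangleData k D} (A : TriangleAction G S) (B : TriangleAction G S') extends
    TriFunctor S S' where
  δ : ∀ g : G, (A.F g).functor ⋙ functor ≅ functor ⋙ (B.F g).functor
  δ_triangle : ∀ (g : G) (X : C), functor.map ((A.F g).ω.hom.app X) ≫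
      ω.hom.app ((A.F g).functor.obj X) ≫ S'.shift.map ((δ g).hom.app X) =
    (δ g).hom.app (S.shift.obj X) ≫ (B.F g).functor.map (ω.hom.app X) ≫
      (B.F g).ω.hom.app (functor.obj X)
  δ_mul : ∀ {g h m : G} (e : g * h = m) (X : C),
    functor.map ((A.ε e).hom.app X) ≫ (δ m).hom.app X =
      (δ g).hom.app ((A.F h).functor.obj X) ≫ (B.F g).functor.map ((δ h).hom.app X) ≫
        (B.ε e).hom.app (functor.obj X)

namespace EquivariantTriFunctor

variable {G : Type*} [Group G] {S : TriangleData k C} {S' : TriangleData k D}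
  {S'' : TriangleData k E} {A : TriangleAction G S} {B : TriangleAction G S'}
  {N : TriangleAction G S''}

/-- The composite transformations `F_g (PQ) ≅ (PQ) F_g`. -/
def compδ (P : EquivariantTriFunctor A B) (Q : EquivariantTriFunctor B N) (g : G) :
    (A.F g).functor ⋙ P.functor ⋙ Q.functor ≅ (P.functor ⋙ Q.functor) ⋙ (N.F g).functor :=
  NatIso.ofComponents
    (fun X => Q.functor.mapIso ((P.δ g).app X) ≪≫ (Q.δ g).app (P.functor.obj X)) (by
      intro X Y f
      have h1 := congrArg Q.functor.map ((P.δ g).hom.naturality f)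
      have h2 := (Q.δ g).hom.naturality (P.functor.map f)
      dsimp at h1 h2 ⊢
      simp only [Functor.map_comp] at h1
      rw [reassoc_of% h1, h2, Category.assoc])

@[simp] lemma compδ_hom_app (P : EquivariantTriFunctor A B) (Q : EquivariantTriFunctor B N)
    (g : G) (X : C) :
    (compδ P Q g).hom.app X = Q.functor.map ((P.δ g).hom.app X) ≫
      (Q.δ g).hom.app (P.functor.obj X) := rfl

/-- The composite, in diagrammatic order. -/
def comp (P : EquivariantTriFunctor A B) (Q : EquivariantTriFunctor B N) :
    EquivariantTriFunctor A N where
  toTriFunctor := P.toTriFunctor.comp Q.toTriFunctor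
  δ g := compδ P Q g
  δ_triangle g X := by
    have h1 := congrArg Q.functor.map (P.δ_triangle g X)
    have h2 := Q.δ_triangle g (P.functor.obj X)
    have h3 := Q.ω.hom.naturality ((P.δ g).hom.app X)
    have h4 := (Q.δ g).hom.naturality (P.ω.hom.app X)
    dsimp at h1 h2 h3 h4 ⊢
    simp only [Functor.map_comp, Category.assoc] at *
    rw [← reassoc_of% h3, reassoc_of% h1, h2, reassoc_of% h4]
  δ_mul {g h m} e X := by
    have h1 := congrArg Q.functor.map (P.δ_mul e X)
    have h2 := Q.δ_mul e (P.functor.obj X)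
    have h3 := (Q.δ g).hom.naturality ((P.δ h).hom.app X)
    dsimp at h1 h2 h3 ⊢
    simp only [Functor.map_comp, Category.assoc] at *
    rw [reassoc_of% h1, h2, reassoc_of% h3]

@[simp] lemma comp_functor (P : EquivariantTriFunctor A B) (Q : EquivariantTriFunctor B N) :
    (P.comp Q).functor = P.functor ⋙ Q.functor := rfl

@[simp] lemma comp_toTriFunctor (P : EquivariantTriFunctor A B) (Q : EquivariantTriFunctor B N) :
    (P.comp Q).toTriFunctor = P.toTriFunctor.comp Q.toTriFunctor := rfl

@[simp] lemma comp_δ_hom_app (P : EquivariantTriFunctor A B) (Q : EquivariantTriFunctor B N)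
    (g : G) (X : C) :
    ((P.comp Q).δ g).hom.app X = Q.functor.map ((P.δ g).hom.app X) ≫
      (Q.δ g).hom.app (P.functor.obj X) := rfl

/-- The transformation `φ` respects the equivariant structures. -/
def Compatible {P Q : EquivariantTriFunctor A B} (φ : P.functor ⟶ Q.functor) : Prop :=
  ∀ (g : G) (X : C), (P.δ g).hom.app X ≫ (B.F g).functor.map (φ.app X) =
    φ.app ((A.F g).functor.obj X) ≫ (Q.δ g).hom.app X

/-- Two equivariant triangle functors are isomorphic. -/
def IsIsomorphic (P Q : EquivariantTriFunctor A B) : Prop :=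
  ∃ φ : P.functor ≅ Q.functor, TriFunctor.Compatible (P := P.toTriFunctor)
    (Q := Q.toTriFunctor) φ.hom ∧ Compatible φ.hom

lemma IsIsomorphic.symm {P Q : EquivariantTriFunctor A B} (h : P.IsIsomorphic Q) :
    Q.IsIsomorphic P := by
  obtain ⟨φ, hφ, hδ⟩ := h
  refine ⟨φ.symm, hφ.symm, fun g X => ?_⟩
  rw [← cancel_epi (φ.hom.app ((A.F g).functor.obj X)), ← Category.assoc, ← hδ g X]
  simp [← (B.F g).functor.map_comp]

lemma IsIsomorphic.trans {P Q R : EquivariantTriFunctor A B} (h : P.IsIsomorphic Q)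
    (h' : Q.IsIsomorphic R) : P.IsIsomorphic R := by
  obtain ⟨φ, hφ, hδ⟩ := h
  obtain ⟨ψ, hψ, hδ'⟩ := h'
  refine ⟨φ ≪≫ ψ, hφ.trans hψ, fun g X => ?_⟩
  simp only [Iso.trans_hom, NatTrans.comp_app, Functor.map_comp]
  rw [← Category.assoc, hδ g X, Category.assoc, hδ' g X, Category.assoc]

lemma IsIsomorphic.whiskerRight {P Q : EquivariantTriFunctor A B} (h : P.IsIsomorphic Q)
    (R : EquivariantTriFunctor B N) : (P.comp R).IsIsomorphic (Q.comp R) := by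
  obtain ⟨φ, hφ, hδ⟩ := h
  refine ⟨Functor.isoWhiskerRight φ R.functor, hφ.whiskerRight R.toTriFunctor, fun g X => ?_⟩
  have h1 := congrArg R.functor.map (hδ g X)
  have h2 := (R.δ g).hom.naturality (φ.hom.app X)
  dsimp at h1 h2 ⊢
  rw [Functor.map_comp, Functor.map_comp] at h1
  rw [Category.assoc, ← h2, reassoc_of% h1]

lemma IsIsomorphic.cancel_left {P : EquivariantTriFunctor A B} (hP : P.functor.IsEquivalence)
    {Q R : EquivariantTriFunctor B N} (h : (P.comp Q).IsIsomorphic (P.comp R)) :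
    Q.IsIsomorphic R := by
  obtain ⟨φ, hφ, hδ⟩ := h
  refine ⟨P.functor.descendIso φ, hφ.descend, fun g X => ?_⟩
  refine P.functor.natTrans_app_eq_of_essSurj
    (σ := (Q.δ g).hom ≫ Functor.whiskerRight (P.functor.descendIso φ).hom (N.F g).functor)
    (τ := Functor.whiskerLeft (B.F g).functor (P.functor.descendIso φ).hom ≫ (R.δ g).hom)
    (fun Z => ?_) X
  have h1 := hδ g Z
  have h2 := (P.functor.descendIso φ).hom.naturality ((P.δ g).hom.app Z)
  have h3 := P.functor.descendIso_hom_app φ Z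
  have h4 := P.functor.descendIso_hom_app φ ((A.F g).functor.obj Z)
  dsimp at h1 h2 h3 h4 ⊢
  have := Functor.map_isIso Q.functor ((P.δ g).hom.app Z)
  rw [h3, ← cancel_epi (Q.functor.map ((P.δ g).hom.app Z)), reassoc_of% h2, h4, ← h1,
    Category.assoc]

/-- Full faithfulness of `R` lifts the isomorphism; both compatibilities hold after applying `R`,
once the isomorphisms `R.ω` and `R.δ` are cancelled. -/
lemma IsIsomorphic.cancel_right {P Q : EquivariantTriFunctor A B} {R : EquivariantTriFunctor B N}
    (hR : R.functor.IsEquivalence) (h : (P.comp R).IsIsomorphic (Q.comp R)) :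
    P.IsIsomorphic Q := by
  obtain ⟨φ, hφ, hδ⟩ := h
  let ψ : P.functor ≅ Q.functor :=
    ((Functor.FullyFaithful.ofFullyFaithful R.functor).whiskeringRight C).preimageIso φ
  have hψ : ∀ X, R.functor.map (ψ.hom.app X) = φ.hom.app X := fun X =>
    congrArg (fun t => NatTrans.app t X)
      (((Functor.FullyFaithful.ofFullyFaithful R.functor).whiskeringRight C).map_preimage
        (X := P.functor) (Y := Q.functor) φ.hom)
  refine ⟨ψ, fun X => ?_, fun g X => ?_⟩
  · apply R.functor.map_injective
    have h1 := hφ X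
    have h2 := R.ω.hom.naturality (ψ.hom.app X)
    have h3 := hψ (S.shift.obj X)
    dsimp at h1 h2 h3 ⊢
    rw [← hψ X, ← h3, Category.assoc, ← h2] at h1
    rw [← cancel_mono (R.ω.hom.app (Q.functor.obj X))]
    simpa only [Functor.map_comp, Category.assoc] using h1
  · apply R.functor.map_injective
    have h1 := hδ g X
    have h2 := (R.δ g).hom.naturality (ψ.hom.app X)
    have h3 := hψ ((A.F g).functor.obj X)
    dsimp at h1 h2 h3 ⊢
    rw [← hψ X, ← h3, Category.assoc, ← h2] at h1
    rw [← cancel_mono ((R.δ g).hom.app (Q.functor.obj X))]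
    simpa only [Functor.map_comp, Category.assoc] using h1

end EquivariantTriFunctor

section Extension

variable {S : TriangleData k C} {S' : TriangleData k D} {S'' : TriangleData k E}

/-- A functor `Q` together with an isomorphism `Ψ ⋙ Q ≅ M` of functors is a triangle functor if
`Ψ` and `M` are triangle functors and `Ψ` is an equivalence that reflects exact triangles. -/
lemma TriFunctor.exists_extension (hS : S'.RetractClosed) (hS'' : S''.RetractClosed)
    (Ψ : TriFunctor S S') [Ψ.functor.IsEquivalence]
    (hΨ : ∀ {X Y Z : C} (f : X ⟶ Y) (g : Y ⟶ Z) (h : Z ⟶ S.shift.obj X),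
      S'.Exact (Ψ.functor.map f) (Ψ.functor.map g) (Ψ.functor.map h ≫ Ψ.ω.hom.app X) →
        S.Exact f g h)
    (M : TriFunctor S S'') :
    ∃ (Q : TriFunctor S' S'') (φ : Ψ.functor ⋙ Q.functor ≅ M.functor),
      Compatible (P := Ψ.comp Q) (Q := M) φ.hom := by
  have := Ψ.additive
  have := Ψ.linear
  have := M.additive
  have := M.linear
  -- The extension is a quasi-inverse of `Ψ` followed by `M`.
  let Q : D ⥤ E := Ψ.functor.inv ⋙ M.functor
  let φ : Ψ.functor ⋙ Q ≅ M.functor :=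
    (Functor.associator _ _ _).symm ≪≫
      Functor.isoWhiskerRight Ψ.functor.asEquivalence.unitIso.symm M.functor ≪≫
        Functor.leftUnitor _
  have : Ψ.functor.asEquivalence.functor.Additive := Ψ.additive
  have e₁ : Ψ.functor.inv.Additive := Ψ.functor.asEquivalence.inverse_additive
  have : Ψ.functor.asEquivalence.functor.Linear k := Ψ.linear
  have e₂ : Ψ.functor.inv.Linear k := Ψ.functor.asEquivalence.inverseLinear k
  -- Compatibility of `φ` with the connecting isomorphisms prescribes the connecting isomorphism of
  -- `Q` on the image of `Ψ`; this prescription then descends.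
  let σ : Ψ.functor ⋙ S'.shift ⋙ Q ≅ Ψ.functor ⋙ Q ⋙ S''.shift :=
    Functor.isoWhiskerRight Ψ.ω.symm Q ≪≫ Functor.isoWhiskerLeft S.shift φ ≪≫ M.ω ≪≫
      Functor.isoWhiskerRight φ.symm S''.shift
  let ω : S'.shift ⋙ Q ≅ Q ⋙ S''.shift := Ψ.functor.descendIso σ
  have hω : ∀ X, (Q.map (Ψ.ω.hom.app X) ≫ ω.hom.app (Ψ.functor.obj X)) ≫
      S''.shift.map (φ.hom.app X) = φ.hom.app (S.shift.obj X) ≫ M.ω.hom.app X := by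
    intro X
    have h : ω.hom.app (Ψ.functor.obj X) = _ := Ψ.functor.descendIso_hom_app σ X
    rw [h]
    change (Q.map (Ψ.ω.hom.app X) ≫ Q.map (Ψ.ω.inv.app X) ≫ φ.hom.app (S.shift.obj X) ≫
      M.ω.hom.app X ≫ S''.shift.map (φ.inv.app X)) ≫ S''.shift.map (φ.hom.app X) = _
    rw [← Q.map_comp_assoc, Iso.hom_inv_id_app, Q.map_id, Category.id_comp, Category.assoc,
      Category.assoc, ← S''.shift.map_comp, Iso.inv_hom_id_app, S''.shift.map_id]
    exact congrArg _ (Category.comp_id _)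
  refine ⟨⟨Q, inferInstance, inferInstance, ω, ?_⟩, φ, hω⟩
  -- Exactness: replace the triangle by an isomorphic one in the image of `Ψ`, reflect it to `C`,
  -- apply `M`, and return along `φ`.
  intro X Y Z f g h hE
  let eX := Ψ.functor.objObjPreimageIso X
  let eY := Ψ.functor.objObjPreimageIso Y
  let eZ := Ψ.functor.objObjPreimageIso Z
  obtain ⟨f', hf⟩ := Ψ.functor.map_surjective (eX.hom ≫ f ≫ eY.inv)
  obtain ⟨g', hg⟩ := Ψ.functor.map_surjective (eY.hom ≫ g ≫ eZ.inv)
  obtain ⟨h', hh⟩ := Ψ.functor.map_surjective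
    (eZ.hom ≫ h ≫ S'.shift.map eX.inv ≫ Ψ.ω.inv.app _)
  have hf' : Ψ.functor.map f' ≫ eY.hom = eX.hom ≫ f := by rw [hf]; simp
  have hg' : Ψ.functor.map g' ≫ eZ.hom = eY.hom ≫ g := by rw [hg]; simp
  have hh' : (Ψ.functor.map h' ≫ Ψ.ω.hom.app _) ≫ S'.shift.map eX.hom = eZ.hom ≫ h := by
    rw [hh]
    simp only [Category.assoc, Iso.inv_hom_id_app_assoc, ← S'.shift.map_comp, Iso.inv_hom_id,
      S'.shift.map_id, Category.comp_id]
  have hE' : S'.Exact (Ψ.functor.map f') (Ψ.functor.map g')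
      (Ψ.functor.map h' ≫ Ψ.ω.hom.app _) := by
    refine hS.exact_of_iso hE eX.symm eY.symm eZ.symm ?_ ?_ ?_
    · rw [Iso.symm_hom, Iso.symm_hom, Iso.comp_inv_eq, Category.assoc, hf',
        Iso.inv_hom_id_assoc]
    · rw [Iso.symm_hom, Iso.symm_hom, Iso.comp_inv_eq, Category.assoc, hg',
        Iso.inv_hom_id_assoc]
    · rw [Iso.symm_hom, Iso.symm_hom, ← Functor.mapIso_inv, Iso.comp_inv_eq,
        Functor.mapIso_hom, Category.assoc, hh', Iso.inv_hom_id_assoc]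
  have hM := M.map_exact _ _ _ (hΨ _ _ _ hE')
  refine hS''.exact_of_iso hM ((φ.app _).symm ≪≫ Q.mapIso eX)
    ((φ.app _).symm ≪≫ Q.mapIso eY) ((φ.app _).symm ≪≫ Q.mapIso eZ) ?_ ?_ ?_
  · have h1 := φ.inv.naturality f'
    have h2 := congrArg Q.map hf'
    rw [Functor.map_comp, Functor.map_comp] at h2
    dsimp only [Iso.trans_hom, Iso.symm_hom, Functor.mapIso_hom, Iso.app_inv,
      Functor.comp_map] at h1 ⊢
    rw [reassoc_of% h1, h2, Category.assoc]
  · have h1 := φ.inv.naturality g'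
    have h2 := congrArg Q.map hg'
    rw [Functor.map_comp, Functor.map_comp] at h2
    dsimp only [Iso.trans_hom, Iso.symm_hom, Functor.mapIso_hom, Iso.app_inv,
      Functor.comp_map] at h1 ⊢
    rw [reassoc_of% h1, h2, Category.assoc]
  · have h1 := φ.inv.naturality h'
    have h2 := congrArg Q.map hh'
    have h3 := hω (Ψ.functor.objPreimage X)
    have h4 := ω.hom.naturality eX.hom
    rw [Functor.map_comp, Functor.map_comp, Functor.map_comp] at h2
    dsimp only [Iso.trans_hom, Iso.symm_hom, Functor.mapIso_hom, Iso.app_inv,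
      Functor.comp_map] at h1 h4 ⊢
    have h5 : M.ω.hom.app (Ψ.functor.objPreimage X) ≫ S''.shift.map (φ.inv.app _) =
        φ.inv.app _ ≫ Q.map (Ψ.ω.hom.app (Ψ.functor.objPreimage X)) ≫ ω.hom.app _ := by
      rw [← cancel_epi (φ.hom.app _), ← reassoc_of% h3, ← S''.shift.map_comp]
      simp
    rw [Functor.map_comp, Category.assoc, reassoc_of% h5, reassoc_of% h1, ← h4,
      reassoc_of% h2, Category.assoc]

/-- An equivariant triangle functor extends along an equivariant triangle equivalence that reflects
exact triangles. -/
lemma EquivariantTriFunctor.exists_extension {G : Type*} [Group G] {A : TriangleAction G S}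
    {B : TriangleAction G S'} {N : TriangleAction G S''}
    (hS : S'.RetractClosed) (hS'' : S''.RetractClosed)
    (Ψ : EquivariantTriFunctor A B) (hE : Ψ.functor.IsEquivalence)
    (hΨ : ∀ {X Y Z : C} (f : X ⟶ Y) (g : Y ⟶ Z) (h : Z ⟶ S.shift.obj X),
      S'.Exact (Ψ.functor.map f) (Ψ.functor.map g) (Ψ.functor.map h ≫ Ψ.ω.hom.app X) →
        S.Exact f g h)
    (M : EquivariantTriFunctor A N) :
    ∃ Q : EquivariantTriFunctor B N, (Ψ.comp Q).IsIsomorphic M := by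
  obtain ⟨Q, φ, hφ⟩ := Ψ.toTriFunctor.exists_extension hS hS'' hΨ M.toTriFunctor
  -- As with `ω`, the equivariant structure is forced on the image of `Ψ` by the compatibility of
  -- `φ`, and descends from there.
  let σ : ∀ g, Ψ.functor ⋙ (B.F g).functor ⋙ Q.functor ≅
      Ψ.functor ⋙ Q.functor ⋙ (N.F g).functor := fun g =>
    Functor.isoWhiskerRight (Ψ.δ g).symm Q.functor ≪≫
      Functor.isoWhiskerLeft (A.F g).functor φ ≪≫ M.δ g ≪≫
        Functor.isoWhiskerRight φ.symm (N.F g).functor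
  let δ : ∀ g, (B.F g).functor ⋙ Q.functor ≅ Q.functor ⋙ (N.F g).functor := fun g =>
    Ψ.functor.descendIso (σ g)
  have hδ : ∀ g X, (Q.functor.map ((Ψ.δ g).hom.app X) ≫ (δ g).hom.app (Ψ.functor.obj X)) ≫
      (N.F g).functor.map (φ.hom.app X) =
        φ.hom.app ((A.F g).functor.obj X) ≫ (M.δ g).hom.app X := by
    intro g X
    have h : (δ g).hom.app (Ψ.functor.obj X) = _ := Ψ.functor.descendIso_hom_app (σ g) X
    rw [h]
    change (Q.functor.map ((Ψ.δ g).hom.app X) ≫ Q.functor.map ((Ψ.δ g).inv.app X) ≫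
      φ.hom.app ((A.F g).functor.obj X) ≫ (M.δ g).hom.app X ≫
        (N.F g).functor.map (φ.inv.app X)) ≫ (N.F g).functor.map (φ.hom.app X) = _
    rw [← Q.functor.map_comp_assoc, Iso.hom_inv_id_app, Q.functor.map_id, Category.id_comp,
      Category.assoc, Category.assoc, ← (N.F g).functor.map_comp, Iso.inv_hom_id_app,
      (N.F g).functor.map_id]
    exact congrArg _ (Category.comp_id _)
  refine ⟨⟨Q, δ, fun g X => ?_, fun {g h m} e X => ?_⟩, φ, hφ, fun g X => hδ g X⟩
  -- This identity and the next are natural in `X`, so it suffices to treat `X = Ψ Z`. After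
  -- composing with isomorphisms coming from `Ψ` and `φ`, each becomes the corresponding identity
  -- for `M`.
  · refine Ψ.functor.natTrans_app_eq_of_essSurj
      (σ := Functor.whiskerRight (B.F g).ω.hom Q.functor ≫
        Functor.whiskerLeft (B.F g).functor Q.ω.hom ≫ Functor.whiskerRight (δ g).hom S''.shift)
      (τ := Functor.whiskerLeft S'.shift (δ g).hom ≫
        Functor.whiskerRight Q.ω.hom (N.F g).functor ≫
          Functor.whiskerLeft Q.functor (N.F g).ω.hom) (fun Z => ?_) X
    have h1 := Ψ.δ_triangle g Z
    have h2 := M.δ_triangle g Z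
    have h3 := hφ ((A.F g).functor.obj Z)
    have h4 := congrArg S''.shift.map (hδ g Z)
    have h5 := hδ g (S.shift.obj Z)
    have h6 := congrArg (N.F g).functor.map (hφ Z)
    have h7 := Q.ω.hom.naturality ((Ψ.δ g).hom.app Z)
    have h8 := (δ g).hom.naturality (Ψ.ω.hom.app Z)
    have h9 := φ.hom.naturality ((A.F g).ω.hom.app Z)
    have h10 := (N.F g).ω.hom.naturality (φ.hom.app Z)
    have h11 := congrArg Q.functor.map h1
    have := Functor.map_isIso Q.functor ((Ψ.δ g).hom.app (S.shift.obj Z))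
    have := Functor.map_isIso Q.functor ((B.F g).functor.map (Ψ.ω.hom.app Z))
    have := Functor.map_isIso S''.shift ((N.F g).functor.map (φ.hom.app Z))
    rw [← cancel_epi (Q.functor.map ((B.F g).functor.map (Ψ.ω.hom.app Z))),
      ← cancel_epi (Q.functor.map ((Ψ.δ g).hom.app (S.shift.obj Z))),
      ← cancel_mono (S''.shift.map ((N.F g).functor.map (φ.hom.app Z)))]
    dsimp at h1 h2 h3 h4 h5 h6 h7 h8 h9 h10 h11 ⊢
    simp only [Functor.map_comp, Category.assoc] at *
    rw [← reassoc_of% h11, reassoc_of% h7, h4, reassoc_of% h3, reassoc_of% h9, h2,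
      reassoc_of% h8, ← h10, reassoc_of% h6, reassoc_of% h5]
  · refine Ψ.functor.natTrans_app_eq_of_essSurj
      (σ := Functor.whiskerRight (B.ε e).hom Q.functor ≫ (δ m).hom)
      (τ := Functor.whiskerLeft (B.F h).functor (δ g).hom ≫
        Functor.whiskerRight (δ h).hom (N.F g).functor ≫
          Functor.whiskerLeft Q.functor (N.ε e).hom) (fun Z => ?_) X
    have h1 := congrArg Q.functor.map (Ψ.δ_mul e Z)
    have h2 := M.δ_mul e Z
    have h3 := hδ m Z
    have h4 := hδ g ((A.F h).functor.obj Z)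
    have h5 := congrArg (N.F g).functor.map (hδ h Z)
    have h6 := φ.hom.naturality ((A.ε e).hom.app Z)
    have h7 := (N.ε e).hom.naturality (φ.hom.app Z)
    have h8 := (δ g).hom.naturality ((Ψ.δ h).hom.app Z)
    have := Functor.map_isIso Q.functor ((Ψ.δ g).hom.app ((A.F h).functor.obj Z))
    have := Functor.map_isIso Q.functor ((B.F g).functor.map ((Ψ.δ h).hom.app Z))
    rw [← cancel_epi (Q.functor.map ((B.F g).functor.map ((Ψ.δ h).hom.app Z))),
      ← cancel_epi (Q.functor.map ((Ψ.δ g).hom.app ((A.F h).functor.obj Z))),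
      ← cancel_mono ((N.F m).functor.map (φ.hom.app Z))]
    dsimp at h1 h2 h3 h4 h5 h6 h7 h8 ⊢
    simp only [Functor.map_comp, Category.assoc] at *
    rw [← reassoc_of% h1, h3, reassoc_of% h6, h2, reassoc_of% h8, ← h7, reassoc_of% h5,
      reassoc_of% h4]

end Extension

end

/-! ### Restriction along group homomorphisms, and autoequivalences as equivariant functors. -/

section

variable {k : Type*} [Field k] {C : Type*} [Category* C] [Preadditive C] [Linear k C]
  {D : Type*} [Category* D] [Preadditive D] [Linear k D]
  {S : TriangleData k C} {S' : TriangleData k D}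

/-- The restriction of an action along a group homomorphism. -/
def TriangleAction.restrict {G H : Type*} [Group G] [Group H] (A : TriangleAction G S)
    (κ : H →* G) : TriangleAction H S where
  F h := A.F (κ h)
  isEquivalence h := A.isEquivalence (κ h)
  ε e := A.ε (by rw [← map_mul, e])
  ε_triangle _ := A.ε_triangle _
  cocycle _ _ _ _ X := A.cocycle _ _ _ _ X

/-- The restriction of an equivariant functor along a group homomorphism. -/
def EquivariantTriFunctor.restrict {G H : Type*} [Group G] [Group H] {A : TriangleAction G S}
    {B : TriangleAction G S'} (P : EquivariantTriFunctor A B) (κ : H →* G) :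
    EquivariantTriFunctor (A.restrict κ) (B.restrict κ) where
  toTriFunctor := P.toTriFunctor
  δ h := P.δ (κ h)
  δ_triangle h := P.δ_triangle (κ h)
  δ_mul e X := P.δ_mul (by rw [← map_mul, e]) X

lemma EquivariantTriFunctor.isIsomorphic_restrict_iff {G H : Type*} [Group G] [Group H]
    {A : TriangleAction G S} {B : TriangleAction G S'} {P Q : EquivariantTriFunctor A B}
    {κ : H →* G} (hκ : Function.Surjective κ) :
    (P.restrict κ).IsIsomorphic (Q.restrict κ) ↔ P.IsIsomorphic Q := by
  constructor
  · rintro ⟨φ, hφ, hδ⟩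
    refine ⟨φ, hφ, fun g X => ?_⟩
    obtain ⟨h, rfl⟩ := hκ g
    exact hδ h X
  · rintro ⟨φ, hφ, hδ⟩
    exact ⟨φ, hφ, fun h X => hδ (κ h) X⟩

namespace TriangleAction.EquivariantAutoequivalence

variable {G : Type*} [Group G] {A : TriangleAction G S}

/-- The underlying equivariant triangle functor. -/
def toTri (P : A.EquivariantAutoequivalence) : EquivariantTriFunctor A A where
  toTriFunctor := .ofEndo P.toTriangleFunctor
  δ := P.δ
  δ_triangle g X := by
    exact (Category.assoc _ _ _).symm.trans (P.δ_triangle g X)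
  δ_mul e X := P.δ_mul e X

/-- An equivariant triangle functor that is an autoequivalence. -/
def ofTri (P : EquivariantTriFunctor A A) (hP : P.functor.IsEquivalence) :
    A.EquivariantAutoequivalence where
  toTriangleFunctor := ⟨P.functor, P.additive, P.linear, P.ω, P.map_exact⟩
  isEquivalence := hP
  δ := P.δ
  δ_triangle g X := by
    exact (Category.assoc _ _ _).trans (P.δ_triangle g X)
  δ_mul e X := P.δ_mul e X

lemma isIsomorphic_iff_toTri {P Q : A.EquivariantAutoequivalence} :
    P.IsIsomorphic Q ↔ P.toTri.IsIsomorphic Q.toTri := Iff.rfl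

lemma mk_eq_mk_iff {P Q : A.EquivariantAutoequivalence} :
    Aut.mk P = Aut.mk Q ↔ P.IsIsomorphic Q := Quotient.eq

end TriangleAction.EquivariantAutoequivalence

/-! ### Characters acting on an object of `(T^G)^Ĝ`, and the projector onto its invariants. -/

namespace TriangleAction

variable {G : Type*} [CommGroup G] {A : TriangleAction G S}

section Character

variable (Z : A.dualAction.EquivariantObject)

/-- The action of a character on the underlying object of a `Ĝ`-equivariant object. -/
def charMap (χ : G →* kˣ) : Z.obj.obj ⟶ Z.obj.obj := (Z.α χ).hom.f

/-- The dual action is strict, so the cocycle condition for `Z` becomes multiplicativity. -/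
lemma charMap_mul (χ ψ : G →* kˣ) : charMap Z χ ≫ charMap Z ψ = charMap Z (χ * ψ) := by
  have h := congrArg (fun t => EquivariantHom.f t) (Z.α_mul (rfl : χ * ψ = χ * ψ))
  refine (h.trans ?_).symm
  change charMap Z χ ≫ charMap Z ψ ≫ 𝟙 _ = _
  rw [Category.comp_id]

/-- It is idempotent by multiplicativity, and invertible. -/
lemma charMap_one : charMap Z 1 = 𝟙 Z.obj.obj := by
  have h : charMap Z 1 ≫ charMap Z 1 = charMap Z 1 :=
    (charMap_mul Z 1 1).trans (congrArg _ (mul_one (1 : G →* kˣ)))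
  obtain ⟨j, hj⟩ : ∃ j : Z.obj.obj ⟶ Z.obj.obj, charMap Z 1 ≫ j = 𝟙 _ :=
    ⟨(Z.α 1).inv.f, congrArg (fun t => EquivariantHom.f t) (Z.α 1).hom_inv_id⟩
  rw [← Category.comp_id (charMap Z 1), ← hj, ← Category.assoc, h]

/-- The structure map `Z.α χ` is a morphism to the twist of `Z.obj` by `χ`. So the action of `χ`
commutes with `α_g` only up to the scalar `χ g`; this scalar is the source of the isotypic
decomposition. -/
lemma charMap_comp_α (χ : G →* kˣ) (g : G) :
    charMap Z χ ≫ (Z.obj.α g).hom =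
      (χ g : k) • (Z.obj.α g).hom ≫ (A.F g).functor.map (charMap Z χ) := by
  have h : charMap Z χ ≫ (((χ g⁻¹ : kˣ) : k) • (Z.obj.α g).hom) =
    (Z.obj.α g).hom ≫ (A.F g).functor.map (charMap Z χ) := (Z.α χ).hom.comm g
  rw [← h, Linear.comp_smul, smul_smul]
  simp

lemma α_comp_map_charMap (χ : G →* kˣ) (g : G) :
    (Z.obj.α g).hom ≫ (A.F g).functor.map (charMap Z χ) =
      (χ g⁻¹ : k) • charMap Z χ ≫ (Z.obj.α g).hom := by
  rw [charMap_comp_α, smul_smul]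
  simp

variable {Z}

lemma comp_charMap {W : A.dualAction.EquivariantObject} (f : Z ⟶ W) (χ : G →* kˣ) :
    f.f.f ≫ charMap W χ = charMap Z χ ≫ f.f.f :=
  congrArg (fun t => EquivariantHom.f t) (f.comm χ)

end Character

section Invariants

variable [Fintype (G →* kˣ)]

/-- The projector onto the `Ĝ`-invariants. -/
noncomputable def invariantsIdem (Z : A.dualAction.EquivariantObject) :
    Z.obj.obj ⟶ Z.obj.obj :=
  (Nat.card G : k)⁻¹ • ∑ χ : G →* kˣ, charMap Z χ

lemma charMap_comp_invariantsIdem (Z : A.dualAction.EquivariantObject) (χ : G →* kˣ) :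
    charMap Z χ ≫ invariantsIdem Z = invariantsIdem Z := by
  rw [invariantsIdem, Linear.comp_smul, Preadditive.comp_sum]
  simp only [charMap_mul]
  congr 1
  exact Fintype.sum_equiv (Equiv.mulLeft χ) _ _ fun _ => rfl

lemma invariantsIdem_comp_charMap (Z : A.dualAction.EquivariantObject) (χ : G →* kˣ) :
    invariantsIdem Z ≫ charMap Z χ = invariantsIdem Z := by
  rw [invariantsIdem, Linear.smul_comp, Preadditive.sum_comp]
  simp only [charMap_mul]
  congr 1
  exact Fintype.sum_equiv (Equiv.mulRight χ) _ _ fun _ => rfl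

lemma comp_invariantsIdem {Z W : A.dualAction.EquivariantObject} (f : Z ⟶ W) :
    f.f.f ≫ invariantsIdem W = invariantsIdem Z ≫ f.f.f := by
  rw [invariantsIdem, invariantsIdem, Linear.smul_comp, Preadditive.sum_comp, Linear.comp_smul,
    Preadditive.comp_sum]
  simp only [comp_charMap]

variable [Finite G] [HasEnoughRootsOfUnity k (Monoid.exponent G)]

lemma card_characters_smul {X Y : C} (f : X ⟶ Y) :
    (Nat.card G : k)⁻¹ • ∑ _χ : G →* kˣ, f = f := by
  rw [Finset.sum_const, Finset.card_univ, ← Nat.card_eq_fintype_card,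
    CommGroup.card_monoidHom_of_hasEnoughRootsOfUnity, ← Nat.cast_smul_eq_nsmul k, smul_smul,
    inv_mul_cancel₀ (natCard_ne_zero_of_hasEnoughRootsOfUnity k G), one_smul]

lemma invariantsIdem_idem (Z : A.dualAction.EquivariantObject) :
    invariantsIdem Z ≫ invariantsIdem Z = invariantsIdem Z := by
  conv_lhs => enter [1]; unfold invariantsIdem
  rw [Linear.smul_comp, Preadditive.sum_comp]
  simp only [charMap_comp_invariantsIdem]
  exact card_characters_smul _

lemma invariantsIdem_comp_of_charMap_comp {Z : A.dualAction.EquivariantObject} {X : C}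
    {t : Z.obj.obj ⟶ X} (ht : ∀ χ, charMap Z χ ≫ t = t) : invariantsIdem Z ≫ t = t := by
  rw [invariantsIdem, Linear.smul_comp, Preadditive.sum_comp]
  simp only [ht]
  exact card_characters_smul _

/-- The conjugates of the projector onto the invariants are the projectors onto the isotypic
components, which sum up to the identity. -/
lemma sum_conj_invariantsIdem [Fintype G] (Z : A.dualAction.EquivariantObject) :
    ∑ g, (Z.obj.α g).hom ≫ (A.F g).functor.map (invariantsIdem Z) ≫ (Z.obj.α g).inv =
      𝟙 Z.obj.obj := by
  classical
  have h : ∀ g, (Z.obj.α g).hom ≫ (A.F g).functor.map (invariantsIdem Z) ≫ (Z.obj.α g).inv =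
      (Nat.card G : k)⁻¹ • ∑ χ : G →* kˣ, (χ g⁻¹ : k) • charMap Z χ := by
    intro g
    have := (A.F g).additive
    have := (A.F g).linear
    rw [← Category.assoc, Iso.comp_inv_eq, invariantsIdem, Functor.map_smul, Functor.map_sum,
      Linear.comp_smul, Preadditive.comp_sum, Linear.smul_comp, Preadditive.sum_comp]
    congr 1
    exact Finset.sum_congr rfl fun χ _ => by rw [α_comp_map_charMap, Linear.smul_comp]
  simp only [h]
  rw [← Finset.smul_sum, Finset.sum_comm]
  simp only [← Finset.sum_smul]
  -- Conjugating by `α_g` multiplies the coefficient of `χ` by `χ g⁻¹`. Summing over `g`,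
  -- orthogonality leaves only `χ = 1`.
  have h1 : ∀ χ : G →* kˣ, χ ≠ 1 → ∑ g, (χ g⁻¹ : k) = 0 := fun χ hχ => by
    rw [← sum_character_apply χ hχ]
    exact Fintype.sum_equiv (Equiv.inv G) _ _ fun _ => rfl
  rw [Finset.sum_eq_single 1 (fun χ _ hχ => by rw [h1 χ hχ, zero_smul])
    (fun h => absurd (Finset.mem_univ _) h), charMap_one]
  simp only [MonoidHom.one_apply, Units.val_one, Finset.sum_const, Finset.card_univ,
    ← Nat.card_eq_fintype_card, nsmul_eq_mul, mul_one]
  rw [smul_smul, inv_mul_cancel₀ (natCard_ne_zero_of_hasEnoughRootsOfUnity k G), one_smul]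

variable [IsIdempotentComplete C]

lemma exists_invariants (Z : A.dualAction.EquivariantObject) :
    ∃ (Y : C) (i : Y ⟶ Z.obj.obj) (p : Z.obj.obj ⟶ Y), i ≫ p = 𝟙 Y ∧ p ≫ i = invariantsIdem Z :=
  IsIdempotentComplete.idempotents_split _ _ (invariantsIdem_idem Z)

/-- The `Ĝ`-invariants of a `Ĝ`-equivariant object of the category of `G`-equivariant objects. -/
noncomputable def invariantsObj (Z : A.dualAction.EquivariantObject) : C :=
  (exists_invariants Z).choose

/-- The inclusion of the invariants. -/
noncomputable def invariantsObjι (Z : A.dualAction.EquivariantObject) :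
    invariantsObj Z ⟶ Z.obj.obj :=
  (exists_invariants Z).choose_spec.choose

/-- The projection onto the invariants. -/
noncomputable def invariantsObjπ (Z : A.dualAction.EquivariantObject) :
    Z.obj.obj ⟶ invariantsObj Z :=
  (exists_invariants Z).choose_spec.choose_spec.choose

@[simp]
lemma invariantsObjι_π (Z : A.dualAction.EquivariantObject) :
    invariantsObjι Z ≫ invariantsObjπ Z = 𝟙 _ :=
  (exists_invariants Z).choose_spec.choose_spec.choose_spec.1

lemma invariantsObjπ_ι (Z : A.dualAction.EquivariantObject) :
    invariantsObjπ Z ≫ invariantsObjι Z = invariantsIdem Z :=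
  (exists_invariants Z).choose_spec.choose_spec.choose_spec.2

attribute [irreducible] invariantsObj invariantsObjι invariantsObjπ

end Invariants

end TriangleAction

end

/-! ### The functor of invariants as an equivariant triangle functor. -/

section

/-- An isomorphism that intertwines two split idempotents induces an isomorphism of their images. -/
def CategoryTheory.Iso.image {C : Type*} [Category* C] {X X' Y Y' : C} (a : X ≅ X')
    {i : Y ⟶ X} {p : X ⟶ Y} {i' : Y' ⟶ X'} {p' : X' ⟶ Y'} (h : i ≫ p = 𝟙 Y)
    (h' : i' ≫ p' = 𝟙 Y') (ha : (p ≫ i) ≫ a.hom = a.hom ≫ p' ≫ i') : Y ≅ Y' where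
  hom := i ≫ a.hom ≫ p'
  inv := i' ≫ a.inv ≫ p
  hom_inv_id := by
    simp only [Category.assoc] at *
    rw [← reassoc_of% ha, a.hom_inv_id_assoc, h, Category.comp_id, h]
  inv_hom_id := by
    simp only [Category.assoc] at *
    rw [reassoc_of% ha, a.inv_hom_id_assoc, h', Category.comp_id, h']

lemma CategoryTheory.Iso.comp_image_hom {C : Type*} [Category* C] {X X' Y Y' : C} (a : X ≅ X')
    {i : Y ⟶ X} {p : X ⟶ Y} {i' : Y' ⟶ X'} {p' : X' ⟶ Y'} (h : i ≫ p = 𝟙 Y)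
    (h' : i' ≫ p' = 𝟙 Y') (ha : (p ≫ i) ≫ a.hom = a.hom ≫ p' ≫ i') :
    p ≫ (a.image h h' ha).hom = a.hom ≫ p' := by
  rw [Category.assoc] at ha
  change p ≫ i ≫ a.hom ≫ p' = _
  rw [reassoc_of% ha, h', Category.comp_id]

variable {k : Type*} [Field k] {C : Type*} [Category* C] [Preadditive C] [Linear k C]
  {S : TriangleData k C}

namespace TriangleAction

variable {G : Type*} [CommGroup G] {A : TriangleAction G S}

variable [Finite G] [Fintype (G →* kˣ)] [HasEnoughRootsOfUnity k (Monoid.exponent G)]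
  [IsIdempotentComplete C]

/-- A morphism commutes with the projectors, so it passes to their images; this gives functoriality.
-/
lemma invariantsObjπ_ι_comp {Z W : A.dualAction.EquivariantObject} (f : Z ⟶ W) :
    invariantsObjπ Z ≫ invariantsObjι Z ≫ f.f.f ≫ invariantsObjπ W =
      f.f.f ≫ invariantsObjπ W := by
  rw [← Category.assoc, invariantsObjπ_ι, ← reassoc_of% comp_invariantsIdem f,
    ← invariantsObjπ_ι, Category.assoc, invariantsObjι_π, Category.comp_id]

variable (A) in
/-- The functor of `Ĝ`-invariants. -/
noncomputable def invariantsFunctor : A.dualAction.EquivariantObject ⥤ C where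
  obj := invariantsObj
  map {Z W} f := invariantsObjι Z ≫ f.f.f ≫ invariantsObjπ W
  map_id Z := (congrArg _ (Category.id_comp _)).trans (invariantsObjι_π Z)
  map_comp {Z W V} f g := by
    change invariantsObjι Z ≫ (f.f.f ≫ g.f.f) ≫ invariantsObjπ V = _
    simp only [Category.assoc, invariantsObjπ_ι_comp]

/-- The inclusion of the invariants. -/
noncomputable def invariantsι (Z : A.dualAction.EquivariantObject) :
    (invariantsFunctor A).obj Z ⟶ Z.obj.obj := invariantsObjι Z

/-- The projection onto the invariants. -/
noncomputable def invariantsπ (Z : A.dualAction.EquivariantObject) :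
    Z.obj.obj ⟶ (invariantsFunctor A).obj Z := invariantsObjπ Z

lemma invariantsι_π (Z : A.dualAction.EquivariantObject) :
    invariantsι Z ≫ invariantsπ Z = 𝟙 _ := invariantsObjι_π Z

lemma invariantsπ_ι (Z : A.dualAction.EquivariantObject) :
    invariantsπ Z ≫ invariantsι Z = invariantsIdem Z := invariantsObjπ_ι Z

lemma invariantsFunctor_map {Z W : A.dualAction.EquivariantObject} (f : Z ⟶ W) :
    (invariantsFunctor A).map f = invariantsι Z ≫ f.f.f ≫ invariantsπ W := rfl

instance (Z : A.dualAction.EquivariantObject) : Epi (invariantsπ Z) :=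
  have : IsSplitEpi (invariantsπ Z) := ⟨⟨invariantsι Z, invariantsι_π Z⟩⟩
  inferInstance

lemma invariantsπ_comp_map {Z W : A.dualAction.EquivariantObject} (f : Z ⟶ W) :
    invariantsπ Z ≫ (invariantsFunctor A).map f = f.f.f ≫ invariantsπ W :=
  invariantsObjπ_ι_comp f

lemma invariantsπ_map_ι {Z W : A.dualAction.EquivariantObject} (f : Z ⟶ W) :
    invariantsπ Z ≫ (invariantsFunctor A).map f ≫ invariantsι W =
      invariantsIdem Z ≫ f.f.f := by
  rw [reassoc_of% invariantsπ_comp_map, invariantsπ_ι, comp_invariantsIdem]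

attribute [irreducible] invariantsFunctor invariantsι invariantsπ

instance invariantsFunctor_additive : (invariantsFunctor A).Additive := ⟨fun {Z W f g} => by
  simp only [invariantsFunctor_map]
  change invariantsι Z ≫ (f.f.f + g.f.f) ≫ invariantsπ W = _
  rw [Preadditive.add_comp, Preadditive.comp_add]⟩

instance invariantsFunctor_linear : (invariantsFunctor A).Linear k := ⟨fun {Z W} f c => by
  simp only [invariantsFunctor_map]
  change invariantsι Z ≫ (c • f.f.f) ≫ invariantsπ W = _
  rw [Linear.smul_comp, Linear.comp_smul]⟩

section Shift

/-- The projection onto the invariants of a translate. -/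
noncomputable def shiftπ (Z : A.dualAction.EquivariantObject) :
    S.shift.obj Z.obj.obj ⟶ (invariantsFunctor A).obj (A.dualAction.equivariantShift.obj Z) :=
  invariantsπ (A.dualAction.equivariantShift.obj Z)

/-- The inclusion of the invariants of a translate. -/
noncomputable def shiftι (Z : A.dualAction.EquivariantObject) :
    (invariantsFunctor A).obj (A.dualAction.equivariantShift.obj Z) ⟶ S.shift.obj Z.obj.obj :=
  invariantsι (A.dualAction.equivariantShift.obj Z)

instance (Z : A.dualAction.EquivariantObject) : Epi (shiftπ Z) :=
  have h : Epi (invariantsπ (A.dualAction.equivariantShift.obj Z)) := inferInstance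
  h

lemma shiftι_π (Z : A.dualAction.EquivariantObject) : shiftι Z ≫ shiftπ Z = 𝟙 _ := by
  have h := invariantsι_π (A.dualAction.equivariantShift.obj Z)
  exact h

lemma shiftπ_comp_map {Z W : A.dualAction.EquivariantObject} (f : Z ⟶ W) :
    shiftπ Z ≫ (invariantsFunctor A).map (A.dualAction.equivariantShift.map f) =
      S.shift.map f.f.f ≫ shiftπ W := by
  have h := invariantsπ_comp_map (A.dualAction.equivariantShift.map f)
  exact h

variable [S.shift.Additive]

/-- The characters act on a translate by the translates of their actions, because the connecting
isomorphisms of the dual action are identities. By additivity the projector of the translate is the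
translate of the projector. -/
lemma shiftπ_ι (Z : A.dualAction.EquivariantObject) :
    shiftπ Z ≫ shiftι Z = S.shift.map (invariantsIdem Z) := by
  have := S.shift_linear
  have h := invariantsπ_ι (A.dualAction.equivariantShift.obj Z)
  refine h.trans ?_
  rw [invariantsIdem, invariantsIdem, Functor.map_smul, Functor.map_sum]
  congr 1
  exact Finset.sum_congr rfl fun χ _ => Category.comp_id (S.shift.map (charMap Z χ))

lemma shiftπ_ι_intertwines (Z : A.dualAction.EquivariantObject) :
    (shiftπ Z ≫ shiftι Z) ≫ 𝟙 (S.shift.obj Z.obj.obj) =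
      𝟙 _ ≫ S.shift.map (invariantsπ Z) ≫ S.shift.map (invariantsι Z) := by
  rw [Category.id_comp, ← S.shift.map_comp, invariantsπ_ι, shiftπ_ι, Category.comp_id]

/-- The translation functor commutes with taking invariants. -/
noncomputable def invariantsShiftIso (Z : A.dualAction.EquivariantObject) :
    (invariantsFunctor A).obj (A.dualAction.equivariantShift.obj Z) ≅
      S.shift.obj ((invariantsFunctor A).obj Z) :=
  Iso.image (Iso.refl (S.shift.obj Z.obj.obj)) (i := shiftι Z) (p := shiftπ Z)
    (i' := S.shift.map (invariantsι Z)) (p' := S.shift.map (invariantsπ Z)) (shiftι_π Z)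
    (by rw [← S.shift.map_comp, invariantsι_π, S.shift.map_id]) (shiftπ_ι_intertwines Z)

lemma shiftπ_comp_shiftIso (Z : A.dualAction.EquivariantObject) :
    shiftπ Z ≫ (invariantsShiftIso Z).hom = S.shift.map (invariantsπ Z) :=
  (Iso.comp_image_hom _ _ _ _).trans (Category.id_comp _)

variable (A) in
/-- The connecting isomorphism of the functor of invariants. -/
noncomputable def invariantsω : A.dualAction.equivariantShift ⋙ invariantsFunctor A ≅
    invariantsFunctor A ⋙ S.shift :=
  NatIso.ofComponents invariantsShiftIso (fun {Z W} f => (cancel_epi (shiftπ Z)).mp (by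
    change shiftπ Z ≫ (invariantsFunctor A).map (A.dualAction.equivariantShift.map f) ≫
        (invariantsShiftIso W).hom =
      shiftπ Z ≫ (invariantsShiftIso Z).hom ≫ S.shift.map ((invariantsFunctor A).map f)
    rw [reassoc_of% shiftπ_comp_map, shiftπ_comp_shiftIso, reassoc_of% shiftπ_comp_shiftIso,
      ← S.shift.map_comp, ← S.shift.map_comp]
    exact congrArg S.shift.map (invariantsπ_comp_map f).symm))

end Shift

section Twist

/-- The projection onto the invariants of a twist. -/
noncomputable def twistπ (g : G) (Z : A.dualAction.EquivariantObject) :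
    Z.obj.obj ⟶ (invariantsFunctor A).obj ((A.dualAction.twistFunctor (MonoidHom.eval g)).obj Z) :=
  (invariantsπ ((A.dualAction.twistFunctor (MonoidHom.eval g)).obj Z) :)

/-- The inclusion of the invariants of a twist. -/
noncomputable def twistι (g : G) (Z : A.dualAction.EquivariantObject) :
    (invariantsFunctor A).obj ((A.dualAction.twistFunctor (MonoidHom.eval g)).obj Z) ⟶ Z.obj.obj :=
  (invariantsι ((A.dualAction.twistFunctor (MonoidHom.eval g)).obj Z) :)

instance (g : G) (Z : A.dualAction.EquivariantObject) : Epi (twistπ g Z) :=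
  have h : Epi (invariantsπ ((A.dualAction.twistFunctor (MonoidHom.eval g)).obj Z)) := inferInstance
  h

lemma twistι_π (g : G) (Z : A.dualAction.EquivariantObject) : twistι g Z ≫ twistπ g Z = 𝟙 _ := by
  have h := invariantsι_π ((A.dualAction.twistFunctor (MonoidHom.eval g)).obj Z)
  exact h

lemma twistπ_comp_map (g : G) {Z W : A.dualAction.EquivariantObject} (f : Z ⟶ W) :
    twistπ g Z ≫ (invariantsFunctor A).map
        ((A.dualAction.twistFunctor (MonoidHom.eval g)).map f) = f.f.f ≫ twistπ g W := by
  have h := invariantsπ_comp_map ((A.dualAction.twistFunctor (MonoidHom.eval g)).map f)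
  exact h

/-- Twisting by evaluation at `g` rescales the action of `χ` by `χ g⁻¹`. The invariants of the twist
are thus the isotypic component on which each `χ` acts by `χ g`. -/
lemma twistπ_ι (g : G) (Z : A.dualAction.EquivariantObject) :
    twistπ g Z ≫ twistι g Z =
      (Nat.card G : k)⁻¹ • ∑ χ : G →* kˣ, (χ g⁻¹ : k) • charMap Z χ := by
  have h := invariantsπ_ι ((A.dualAction.twistFunctor (MonoidHom.eval g)).obj Z)
  refine h.trans ?_
  refine congrArg ((Nat.card G : k)⁻¹ • ·) (Finset.sum_congr rfl fun χ _ => ?_)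
  rw [map_inv]
  rfl

/-- Hence `α_g` restricts to an isomorphism from the component of `g` onto `F_g` of the invariants,
which is the equivariant structure of the functor of invariants. -/
lemma twistπ_ι_comp_α (g : G) (Z : A.dualAction.EquivariantObject) :
    (twistπ g Z ≫ twistι g Z) ≫ (Z.obj.α g).hom =
      (Z.obj.α g).hom ≫ (A.F g).functor.map (invariantsπ Z) ≫
        (A.F g).functor.map (invariantsι Z) := by
  have := (A.F g).additive
  have := (A.F g).linear
  rw [← Functor.map_comp, invariantsπ_ι, twistπ_ι, invariantsIdem, Functor.map_smul,
    Functor.map_sum, Linear.smul_comp, Preadditive.sum_comp, Linear.comp_smul,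
    Preadditive.comp_sum]
  congr 1
  exact Finset.sum_congr rfl fun χ _ => by rw [α_comp_map_charMap, Linear.smul_comp]

/-- The twist by `g` of a `Ĝ`-equivariant object has invariants `F_g` applied to the invariants. -/
noncomputable def invariantsTwistIso (g : G) (Z : A.dualAction.EquivariantObject) :
    (invariantsFunctor A).obj ((A.dualAction.twistFunctor (MonoidHom.eval g)).obj Z) ≅
      (A.F g).functor.obj ((invariantsFunctor A).obj Z) :=
  Iso.image (Z.obj.α g) (i := twistι g Z) (p := twistπ g Z)
    (i' := (A.F g).functor.map (invariantsι Z)) (p' := (A.F g).functor.map (invariantsπ Z))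
    (twistι_π g Z)
    (by rw [← Functor.map_comp, invariantsι_π, CategoryTheory.Functor.map_id])
    (twistπ_ι_comp_α g Z)

lemma twistπ_comp_twistIso (g : G) (Z : A.dualAction.EquivariantObject) :
    twistπ g Z ≫ (invariantsTwistIso g Z).hom =
      (Z.obj.α g).hom ≫ (A.F g).functor.map (invariantsπ Z) :=
  Iso.comp_image_hom _ _ _ _

variable (A) in
/-- The functor of invariants is compatible with the action of `G`. -/
noncomputable def invariantsδ (g : G) :
    A.dualAction.twistFunctor (MonoidHom.eval g) ⋙ invariantsFunctor A ≅
      invariantsFunctor A ⋙ (A.F g).functor :=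
  NatIso.ofComponents (invariantsTwistIso g) (fun {Z W} f => (cancel_epi (twistπ g Z)).mp (by
    change twistπ g Z ≫ (invariantsFunctor A).map
        ((A.dualAction.twistFunctor (MonoidHom.eval g)).map f) ≫ (invariantsTwistIso g W).hom =
      twistπ g Z ≫ (invariantsTwistIso g Z).hom ≫
        (A.F g).functor.map ((invariantsFunctor A).map f)
    have h1 := congrArg (A.F g).functor.map (invariantsπ_comp_map f)
    rw [Functor.map_comp, Functor.map_comp] at h1
    rw [reassoc_of% twistπ_comp_map, twistπ_comp_twistIso, reassoc_of% twistπ_comp_twistIso]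
    refine ((Category.assoc _ _ _).symm.trans (congrArg (· ≫ _) (f.f.comm g))).trans ?_
    exact (Category.assoc _ _ _).trans (congrArg _ h1.symm)))

end Twist

lemma map_comp_invariantsι {Z W : A.dualAction.EquivariantObject} (f : Z ⟶ W) :
    (invariantsFunctor A).map f ≫ invariantsι W = invariantsι Z ≫ f.f.f := by
  rw [← cancel_epi (invariantsπ Z), invariantsπ_map_ι, ← Category.assoc, invariantsπ_ι]

lemma comp_shift_invariantsIdem [S.shift.Additive] {X Z : A.dualAction.EquivariantObject}
    (h : Z ⟶ A.dualAction.equivariantShift.obj X) :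
    (h.f.f : Z.obj.obj ⟶ S.shift.obj X.obj.obj) ≫ S.shift.map (invariantsIdem X) =
      invariantsIdem Z ≫ h.f.f := by
  rw [← shiftπ_ι]
  exact (congrArg _ (invariantsπ_ι (A.dualAction.equivariantShift.obj X))).trans
    (comp_invariantsIdem h)

lemma invariantsπ_comp_map_ω [S.shift.Additive] {X Z : A.dualAction.EquivariantObject}
    (h : Z ⟶ A.dualAction.equivariantShift.obj X) :
    invariantsπ Z ≫ (invariantsFunctor A).map h ≫ (invariantsShiftIso X).hom =
      (h.f.f : Z.obj.obj ⟶ S.shift.obj X.obj.obj) ≫ S.shift.map (invariantsπ X) := by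
  rw [reassoc_of% invariantsπ_comp_map]
  exact congrArg _ (shiftπ_comp_shiftIso X)

lemma map_ω_comp_invariantsι [S.shift.Additive] {X Z : A.dualAction.EquivariantObject}
    (h : Z ⟶ A.dualAction.equivariantShift.obj X) :
    ((invariantsFunctor A).map h ≫ (invariantsShiftIso X).hom) ≫ S.shift.map (invariantsι X) =
      invariantsι Z ≫ (h.f.f : Z.obj.obj ⟶ S.shift.obj X.obj.obj) := by
  have key : ∀ h' : Z.obj.obj ⟶ S.shift.obj X.obj.obj,
      invariantsπ Z ≫ (invariantsFunctor A).map h ≫ (invariantsShiftIso X).hom =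
        h' ≫ S.shift.map (invariantsπ X) →
      h' ≫ S.shift.map (invariantsIdem X) = invariantsIdem Z ≫ h' →
      ((invariantsFunctor A).map h ≫ (invariantsShiftIso X).hom) ≫ S.shift.map (invariantsι X) =
        invariantsι Z ≫ h' := fun h' h1 h2 => by
    rw [← cancel_epi (invariantsπ Z), ← Category.assoc, h1, Category.assoc,
      ← S.shift.map_comp, invariantsπ_ι, h2, ← Category.assoc, invariantsπ_ι]
  exact key _ (invariantsπ_comp_map_ω h) (comp_shift_invariantsIdem h)

/-- The triangle of invariants is a retract of the underlying triangle, through the projections and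
inclusions of the invariants. -/
lemma invariantsFunctor_map_exact [S.shift.Additive] (hS : S.RetractClosed)
    {X Y Z : A.dualAction.EquivariantObject} (f : X ⟶ Y) (g : Y ⟶ Z)
    (h : Z ⟶ A.dualAction.equivariantShift.obj X) (hE : S.Exact f.f.f g.f.f h.f.f) :
    S.Exact ((invariantsFunctor A).map f) ((invariantsFunctor A).map g)
      ((invariantsFunctor A).map h ≫ (invariantsω A).hom.app X) :=
  hS.exact_of_retract hE (invariantsπ X) (invariantsπ Y) (invariantsπ Z) (invariantsι X)
    (invariantsι Y) (invariantsι Z) (invariantsπ_comp_map f).symm (invariantsπ_comp_map g).symm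
    (invariantsπ_comp_map_ω h).symm (map_comp_invariantsι f) (map_comp_invariantsι g)
    (map_ω_comp_invariantsι h) (invariantsι_π X) (invariantsι_π Y) (invariantsι_π Z)

lemma _root_.CategoryTheory.comp₃_eq {C : Type*} [Category* C] {X₀ X₁ X₂ X₃ X₄ : C} {p : X₀ ⟶ X₁}
    {a : X₁ ⟶ X₂} {b : X₂ ⟶ X₃} {c : X₃ ⟶ X₄} {q : X₀ ⟶ X₂} {r : X₀ ⟶ X₃} {s : X₀ ⟶ X₄}
    (h₁ : p ≫ a = q) (h₂ : q ≫ b = r) (h₃ : r ≫ c = s) : p ≫ a ≫ b ≫ c = s := by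
  subst h₁ h₂ h₃
  simp only [Category.assoc]

/-- The functor of invariants, as a `G`-equivariant triangle functor from the double dual. -/
noncomputable def invariantsTri [S.shift.Additive] (hS : S.RetractClosed) (A : TriangleAction G S) :
    EquivariantTriFunctor (A.dualAction.dualAction.restrict MonoidHom.eval) A where
  functor := invariantsFunctor A
  additive := inferInstance
  linear := inferInstance
  ω := invariantsω A
  map_exact f g h hE := invariantsFunctor_map_exact hS f g h hE
  δ g := invariantsδ A g
  -- Both coherence identities are tested after precomposition with the epimorphic projection from
  -- the underlying object. There every factor is induced by a map of underlying objects, and the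
  -- squares `h1` to `h6` paste together.
  δ_triangle g Z := (cancel_epi (twistπ g (A.dualAction.equivariantShift.obj Z))).mp (by
    have h1 : twistπ g (A.dualAction.equivariantShift.obj Z) ≫ (invariantsFunctor A).map
        ((A.dualAction.dualFunctor (MonoidHom.eval g)).ω.hom.app Z) =
          shiftπ ((A.dualAction.twistFunctor (MonoidHom.eval g)).obj Z) :=
      (invariantsπ_comp_map ((A.dualAction.dualFunctor (MonoidHom.eval g)).ω.hom.app Z)).trans
        (Category.id_comp _)
    have h2 := shiftπ_comp_shiftIso ((A.dualAction.twistFunctor (MonoidHom.eval g)).obj Z)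
    have h3 : S.shift.map (twistπ g Z) ≫ S.shift.map (invariantsTwistIso g Z).hom =
        S.shift.map (Z.obj.α g).hom ≫ S.shift.map ((A.F g).functor.map (invariantsπ Z)) := by
      rw [← S.shift.map_comp, twistπ_comp_twistIso, S.shift.map_comp]
    have h4 := twistπ_comp_twistIso g (A.dualAction.equivariantShift.obj Z)
    have h5 : (S.shift.map (Z.obj.α g).hom ≫ (A.F g).ω.inv.app Z.obj.obj) ≫
        (A.F g).functor.map (shiftπ Z) ≫ (A.F g).functor.map (invariantsShiftIso Z).hom =
          S.shift.map (Z.obj.α g).hom ≫ (A.F g).ω.inv.app Z.obj.obj ≫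
            (A.F g).functor.map (S.shift.map (invariantsπ Z)) := by
      rw [← Functor.map_comp, shiftπ_comp_shiftIso, Category.assoc]
    have h6 : (S.shift.map (Z.obj.α g).hom ≫ (A.F g).ω.inv.app Z.obj.obj ≫
        (A.F g).functor.map (S.shift.map (invariantsπ Z))) ≫
          (A.F g).ω.hom.app ((invariantsFunctor A).obj Z) =
        S.shift.map (Z.obj.α g).hom ≫ S.shift.map ((A.F g).functor.map (invariantsπ Z)) := by
      have h := (A.F g).ω.hom.naturality (invariantsπ Z)
      dsimp at h
      rw [Category.assoc, Category.assoc, h, Iso.inv_hom_id_app_assoc]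
    exact (comp₃_eq h1 h2 h3).trans (comp₃_eq h4 ((Category.assoc _ _ _).trans h5) h6).symm)
  δ_mul {g h m} e Z := (cancel_epi (twistπ g
      ((A.dualAction.twistFunctor (MonoidHom.eval h)).obj Z))).mp (by
    have e' : MonoidHom.eval g * MonoidHom.eval h = (MonoidHom.eval m : (G →* kˣ) →* kˣ) := by
      rw [← map_mul, e]
    have h1 : twistπ g ((A.dualAction.twistFunctor (MonoidHom.eval h)).obj Z) ≫
        (invariantsFunctor A).map ((A.dualAction.dualAction.ε e').hom.app Z) = twistπ m Z :=
      (invariantsπ_comp_map ((A.dualAction.dualAction.ε e').hom.app Z)).trans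
        (Category.id_comp _)
    have h2 := twistπ_comp_twistIso m Z
    have h4 := twistπ_comp_twistIso g ((A.dualAction.twistFunctor (MonoidHom.eval h)).obj Z)
    have h5 : (Z.obj.α g).hom ≫ (A.F g).functor.map (twistπ h Z) ≫
        (A.F g).functor.map (invariantsTwistIso h Z).hom =
          (Z.obj.α g).hom ≫ (A.F g).functor.map (Z.obj.α h).hom ≫
            (A.F g).functor.map ((A.F h).functor.map (invariantsπ Z)) := by
      rw [← Functor.map_comp, twistπ_comp_twistIso, Functor.map_comp]
    have h6 : ((Z.obj.α g).hom ≫ (A.F g).functor.map (Z.obj.α h).hom ≫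
        (A.F g).functor.map ((A.F h).functor.map (invariantsπ Z))) ≫
          (A.ε e).hom.app ((invariantsFunctor A).obj Z) =
        (Z.obj.α m).hom ≫ (A.F m).functor.map (invariantsπ Z) := by
      have h := (A.ε e).hom.naturality (invariantsπ Z)
      dsimp at h
      rw [Category.assoc, Category.assoc, h, Z.obj.α_mul e, Category.assoc, Category.assoc]
    exact ((Category.assoc _ _ _).symm.trans ((congrArg (· ≫ _) h1).trans h2)).trans
      (comp₃_eq h4 ((Category.assoc _ _ _).trans h5) h6).symm)

end TriangleAction

end

/-! ### The functor of invariants is fully faithful and reflects exact triangles. -/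

section

variable {k : Type*} [Field k] {C : Type*} [Category* C] [Preadditive C] [Linear k C]
  {S : TriangleData k C}

namespace TriangleAction

section Conj

variable {G : Type*} [Group G] {A : TriangleAction G S}

/-- The action of a group element on the morphisms between the underlying objects of two equivariant
objects. -/
def conj (X Y : A.EquivariantObject) (g : G) (t : X.obj ⟶ Y.obj) : X.obj ⟶ Y.obj :=
  (X.α g).hom ≫ (A.F g).functor.map t ≫ (Y.α g).inv

/-- This is the associativity of the `G`-action `conj` with the inverse of `α_g` moved to the other
side, in the shape needed for `sumConj`. -/
lemma conj_comp_α {X Y : A.EquivariantObject} {g h m : G} (e : g * h = m) (t : X.obj ⟶ Y.obj) :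
    conj X Y m t ≫ (Y.α g).hom = (X.α g).hom ≫ (A.F g).functor.map (conj X Y h t) := by
  have h1 := X.α_mul e
  have h2 := Y.α_mul e
  have h3 := (A.ε e).hom.naturality t
  dsimp at h3
  have h4 : (Y.α m).inv ≫ (Y.α g).hom =
      (A.ε e).inv.app Y.obj ≫ (A.F g).functor.map (Y.α h).inv := by
    rw [Iso.inv_comp_eq, h2, Category.assoc, Category.assoc, Iso.hom_inv_id_app_assoc]
    rw [← Functor.map_comp, Iso.hom_inv_id, CategoryTheory.Functor.map_id, Category.comp_id]
  rw [conj, conj, Category.assoc, Category.assoc, h4, h1, Functor.map_comp, Functor.map_comp,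
    Category.assoc, Category.assoc, ← reassoc_of% h3, Iso.hom_inv_id_app_assoc]

/-- The cocycle condition at `(1, 1)` shows that `α_1` is inverse to the unit of the action;
naturality of the unit does the rest. -/
lemma conj_one {X Y : A.EquivariantObject} (t : X.obj ⟶ Y.obj) : conj X Y 1 t = t := by
  have h : ∀ Z : A.EquivariantObject, (Z.α 1).hom ≫ A.unit.hom.app Z.obj = 𝟙 Z.obj := fun Z => by
    have h1 := Z.α_mul (mul_one (1 : G))
    have h2 := A.map_unit_hom_app Z.obj
    have := A.isEquivalence 1
    apply (A.F 1).functor.map_injective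
    rw [← cancel_epi (Z.α 1).hom, Functor.map_comp, h2, ← h1, CategoryTheory.Functor.map_id,
      Category.comp_id]
  have h1 := A.unit.hom.naturality t
  dsimp at h1
  have h2 : A.unit.hom.app Y.obj = (Y.α 1).inv := by
    rw [← cancel_epi (Y.α 1).hom, h, Iso.hom_inv_id]
  rw [conj, ← h2, h1, ← Category.assoc, h, Category.id_comp]

lemma conj_comp_hom {X Y Z : A.EquivariantObject} (g : G) (t : X.obj ⟶ Y.obj) (f : Y ⟶ Z) :
    conj X Y g t ≫ f.f = conj X Z g (t ≫ f.f) := by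
  rw [conj, conj, Functor.map_comp, Category.assoc, Category.assoc, Category.assoc]
  congr 2
  rw [Iso.inv_comp_eq, ← Category.assoc, ← f.comm, Category.assoc, Iso.hom_inv_id,
    Category.comp_id]

/-- The sum of the conjugates of a morphism is a morphism of equivariant objects. -/
def sumConj [Fintype G] {X Y : A.EquivariantObject} (t : X.obj ⟶ Y.obj) : X ⟶ Y where
  f := ∑ g, conj X Y g t
  comm g := by
    have := (A.F g).additive
    rw [Preadditive.sum_comp, Functor.map_sum, Preadditive.comp_sum]
    exact (Fintype.sum_equiv (Equiv.mulLeft g) _ _ fun h => (conj_comp_α rfl t).symm).symm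

end Conj

variable {G : Type*} [CommGroup G] {A : TriangleAction G S}

lemma charMap_comp_conj (Z W : A.dualAction.EquivariantObject) (χ : G →* kˣ) (g : G)
    (t : Z.obj.obj ⟶ W.obj.obj) :
    charMap Z χ ≫ conj Z.obj W.obj g t = (χ g : k) • conj Z.obj W.obj g (charMap Z χ ≫ t) := by
  rw [conj, ← Category.assoc, charMap_comp_α, Linear.smul_comp, conj, Functor.map_comp,
    Category.assoc, Category.assoc]

lemma conj_comp_charMap (Z W : A.dualAction.EquivariantObject) (χ : G →* kˣ) (g : G)
    (t : Z.obj.obj ⟶ W.obj.obj) :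
    conj Z.obj W.obj g t ≫ charMap W χ = (χ g : k) • conj Z.obj W.obj g (t ≫ charMap W χ) := by
  have h : (W.obj.α g).inv ≫ charMap W χ =
      (χ g : k) • (A.F g).functor.map (charMap W χ) ≫ (W.obj.α g).inv := by
    rw [Iso.inv_comp_eq, Linear.comp_smul, ← Category.assoc, ← Linear.smul_comp,
      ← charMap_comp_α, Category.assoc, Iso.hom_inv_id, Category.comp_id]
  rw [conj, Category.assoc, Category.assoc, h, Linear.comp_smul, Linear.comp_smul, conj,
    Functor.map_comp, Category.assoc]

variable [Finite G] [Fintype (G →* kˣ)] [HasEnoughRootsOfUnity k (Monoid.exponent G)]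

/-- The conjugates of the projector are the isotypic projectors, with sum the identity. A morphism
is thus determined by its restriction to the invariants, which yields faithfulness. -/
lemma sum_conj_idem_comp [Fintype G] {Z W : A.dualAction.EquivariantObject}
    (f : Z ⟶ W) : ∑ g, conj Z.obj W.obj g (invariantsIdem Z ≫ f.f.f) = f.f.f := by
  have h : ∀ g, conj Z.obj W.obj g (invariantsIdem Z ≫ f.f.f) =
      conj Z.obj Z.obj g (invariantsIdem Z) ≫ f.f.f := fun g => (conj_comp_hom g _ f.f).symm
  simp only [h]
  rw [← Preadditive.sum_comp]
  exact (congrArg (· ≫ f.f.f) (sum_conj_invariantsIdem Z)).trans (Category.id_comp _)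

/-- The conjugate of `t` by `g` is supported on the component of `g`: averaging over the characters
produces the factor `∑ χ g`, which vanishes. -/
lemma invariantsIdem_comp_conj {Z W : A.dualAction.EquivariantObject}
    {t : Z.obj.obj ⟶ W.obj.obj} (ht : ∀ χ, charMap Z χ ≫ t = t) {g : G} (hg : g ≠ 1) :
    invariantsIdem Z ≫ conj Z.obj W.obj g t = 0 := by
  rw [invariantsIdem, Linear.smul_comp, Preadditive.sum_comp]
  simp only [charMap_comp_conj, ht]
  rw [← Finset.sum_smul, sum_characters_apply g hg, zero_smul, smul_zero]

variable [IsIdempotentComplete C]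

instance invariantsFunctor_faithful : (invariantsFunctor A).Faithful := ⟨fun {Z W} f f' h => by
  have := Fintype.ofFinite G
  apply hom_ext
  apply hom_ext
  have h1 : invariantsIdem Z ≫ f.f.f = invariantsIdem Z ≫ f'.f.f := by
    rw [← invariantsπ_map_ι, ← invariantsπ_map_ι, h]
  rw [← sum_conj_idem_comp f, ← sum_conj_idem_comp f', h1]⟩

instance invariantsFunctor_full : (invariantsFunctor A).Full := ⟨fun {Z W} m => by
  have := Fintype.ofFinite G
  -- Extend `m` by zero to the underlying objects. Summing over the conjugates makes it
  -- `G`-equivariant. It is also `Ĝ`-equivariant, since a character moves past a conjugate on either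
  -- side with the same scalar `χ g`.
  let t : Z.obj.obj ⟶ W.obj.obj := invariantsπ Z ≫ m ≫ invariantsι W
  have hι : ∀ V : A.dualAction.EquivariantObject, invariantsι V = invariantsι V ≫
      invariantsIdem V := fun V => by
    rw [← invariantsπ_ι, ← Category.assoc, invariantsι_π, Category.id_comp]
  have hπ : ∀ V : A.dualAction.EquivariantObject, invariantsπ V = invariantsIdem V ≫
      invariantsπ V := fun V => by
    rw [← invariantsπ_ι, Category.assoc, invariantsι_π, Category.comp_id]
  have ht : ∀ χ, charMap Z χ ≫ t = t := fun χ => by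
    change charMap Z χ ≫ invariantsπ Z ≫ _ = invariantsπ Z ≫ _
    rw [hπ, Category.assoc, ← Category.assoc, charMap_comp_invariantsIdem]
  have ht' : ∀ χ, t ≫ charMap W χ = t := fun χ => by
    change (invariantsπ Z ≫ m ≫ invariantsι W) ≫ charMap W χ = invariantsπ Z ≫ m ≫ invariantsι W
    rw [hι, Category.assoc, Category.assoc, Category.assoc, invariantsIdem_comp_charMap]
  let f : Z ⟶ W := ⟨sumConj t, fun χ => hom_ext (by
    change (∑ g, conj Z.obj W.obj g t) ≫ charMap W χ = charMap Z χ ≫ ∑ g, conj Z.obj W.obj g t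
    rw [Preadditive.sum_comp, Preadditive.comp_sum]
    simp only [conj_comp_charMap, charMap_comp_conj, ht, ht'])⟩
  refine ⟨f, ?_⟩
  -- On the invariants only the summand of `g = 1` survives, and it is `t`.
  have h1 : invariantsIdem Z ≫ (∑ g, conj Z.obj W.obj g t) = t := by
    rw [Preadditive.comp_sum, Finset.sum_eq_single 1
      (fun g _ hg => invariantsIdem_comp_conj ht hg) (fun h => absurd (Finset.mem_univ _) h),
      conj_one, invariantsIdem_comp_of_charMap_comp ht]
  have h2 : invariantsπ Z ≫ (invariantsFunctor A).map f ≫ invariantsι W = t :=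
    (invariantsπ_map_ι f).trans h1
  have : Mono (invariantsι W) :=
    have : IsSplitMono (invariantsι W) := ⟨⟨invariantsπ W, invariantsι_π W⟩⟩
    inferInstance
  rw [← cancel_mono (invariantsι W), ← cancel_epi (invariantsπ Z)]
  exact h2⟩

/-- By the isotypic decomposition, the underlying triangle is a direct sum over `a : G` of the
images under `F_a` of the triangle of invariants, each of which is exact. -/
lemma exact_of_invariantsFunctor_map_exact [S.shift.Additive] (hS : S.RetractClosed)
    {X Y Z : A.dualAction.EquivariantObject} (f : X ⟶ Y) (g : Y ⟶ Z)
    (h : Z ⟶ A.dualAction.equivariantShift.obj X)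
    (hE : S.Exact ((invariantsFunctor A).map f) ((invariantsFunctor A).map g)
      ((invariantsFunctor A).map h ≫ (invariantsω A).hom.app X)) :
    S.Exact f.f.f g.f.f h.f.f := by
  have := Fintype.ofFinite G
  have hsum : ∀ V : A.dualAction.EquivariantObject,
      ∑ g, ((V.obj.α g).hom ≫ (A.F g).functor.map (invariantsπ V)) ≫
        (A.F g).functor.map (invariantsι V) ≫ (V.obj.α g).inv = 𝟙 V.obj.obj := fun V => by
    rw [← sum_conj_invariantsIdem V]
    refine Finset.sum_congr rfl fun g _ => ?_
    rw [← invariantsπ_ι, Functor.map_comp]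
    simp only [Category.assoc]
  have hα : ∀ {V W : A.dualAction.EquivariantObject} (u : V ⟶ W) (g : G),
      (V.obj.α g).inv ≫ u.f.f = (A.F g).functor.map u.f.f ≫ (W.obj.α g).inv := fun u g => by
    rw [Iso.inv_comp_eq, ← Category.assoc, Iso.eq_comp_inv]
    exact u.f.comm g
  have hp : ∀ {V W : A.dualAction.EquivariantObject} (u : V ⟶ W) (g : G),
      u.f.f ≫ (W.obj.α g).hom ≫ (A.F g).functor.map (invariantsπ W) =
        ((V.obj.α g).hom ≫ (A.F g).functor.map (invariantsπ V)) ≫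
          (A.F g).functor.map ((invariantsFunctor A).map u) := fun {V W} u g => by
    rw [Category.assoc, ← Functor.map_comp, invariantsπ_comp_map, Functor.map_comp]
    exact (Category.assoc _ _ _).symm.trans ((congrArg (· ≫ _) (u.f.comm g)).trans
      (Category.assoc _ _ _))
  have hi : ∀ {V W : A.dualAction.EquivariantObject} (u : V ⟶ W) (g : G),
      (A.F g).functor.map ((invariantsFunctor A).map u) ≫
        (A.F g).functor.map (invariantsι W) ≫ (W.obj.α g).inv =
      ((A.F g).functor.map (invariantsι V) ≫ (V.obj.α g).inv) ≫ u.f.f := fun {V W} u g => by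
    rw [Category.assoc, hα, ← Category.assoc, ← Category.assoc, ← Functor.map_comp,
      ← Functor.map_comp, map_comp_invariantsι]
  -- The square ending in a translate involves `ω_a`. Its naturality moves it past the inclusion of
  -- the invariants, where it cancels the inverse of `ω_a` in the equivariant structure of the
  -- translate. `key₂` does the same for the projection.
  have key₁ : ∀ (a : G) (h' : Z.obj.obj ⟶ S.shift.obj X.obj.obj)
      (q : (invariantsFunctor A).obj Z ⟶ S.shift.obj ((invariantsFunctor A).obj X)),
      q ≫ S.shift.map (invariantsι X) = invariantsι Z ≫ h' →
      h' ≫ S.shift.map (X.obj.α a).hom ≫ (A.F a).ω.inv.app X.obj.obj =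
        (Z.obj.α a).hom ≫ (A.F a).functor.map h' →
      ((A.F a).functor.map q ≫ (A.F a).ω.hom.app ((invariantsFunctor A).obj X)) ≫
          S.shift.map ((A.F a).functor.map (invariantsι X) ≫ (X.obj.α a).inv) =
        ((A.F a).functor.map (invariantsι Z) ≫ (Z.obj.α a).inv) ≫ h' := by
    intro a h' q h1 h2
    have h3 := (A.F a).ω.hom.naturality (invariantsι X)
    have h4 := congrArg (A.F a).functor.map h1
    have h5 : (A.F a).functor.map h' ≫ (A.F a).ω.hom.app X.obj.obj ≫
        S.shift.map (X.obj.α a).inv = (Z.obj.α a).inv ≫ h' := by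
      rw [Iso.eq_inv_comp, ← reassoc_of% h2, Iso.inv_hom_id_app_assoc, ← S.shift.map_comp,
        Iso.hom_inv_id, S.shift.map_id, Category.comp_id]
    rw [Functor.map_comp, Functor.map_comp] at h4
    dsimp at h3
    rw [Functor.map_comp, Category.assoc, Category.assoc, ← reassoc_of% h3, reassoc_of% h4, h5]
  have key₂ : ∀ (a : G) (h' : Z.obj.obj ⟶ S.shift.obj X.obj.obj)
      (q : (invariantsFunctor A).obj Z ⟶ S.shift.obj ((invariantsFunctor A).obj X)),
      invariantsπ Z ≫ q = h' ≫ S.shift.map (invariantsπ X) →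
      h' ≫ S.shift.map (X.obj.α a).hom ≫ (A.F a).ω.inv.app X.obj.obj =
        (Z.obj.α a).hom ≫ (A.F a).functor.map h' →
      h' ≫ S.shift.map ((X.obj.α a).hom ≫ (A.F a).functor.map (invariantsπ X)) =
        ((Z.obj.α a).hom ≫ (A.F a).functor.map (invariantsπ Z)) ≫
          (A.F a).functor.map q ≫ (A.F a).ω.hom.app ((invariantsFunctor A).obj X) := by
    intro a h' q h1 h2
    have h3 := (A.F a).ω.hom.naturality (invariantsπ X)
    have h4 := congrArg (A.F a).functor.map h1
    rw [Functor.map_comp, Functor.map_comp] at h4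
    dsimp at h3
    rw [Category.assoc, reassoc_of% h4, h3, ← reassoc_of% h2, Iso.inv_hom_id_app_assoc,
      Functor.map_comp]
  refine hS.exact_of_fintype (J := G) _ _ _ _ _ _ _ _ _
    (fun a => (A.F a).map_exact _ _ _ hE)
    (fun a => (A.F a).functor.map (invariantsι X) ≫ (X.obj.α a).inv)
    (fun a => (A.F a).functor.map (invariantsι Y) ≫ (Y.obj.α a).inv)
    (fun a => (A.F a).functor.map (invariantsι Z) ≫ (Z.obj.α a).inv)
    (fun a => (X.obj.α a).hom ≫ (A.F a).functor.map (invariantsπ X))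
    (fun a => (Y.obj.α a).hom ≫ (A.F a).functor.map (invariantsπ Y))
    (fun a => (Z.obj.α a).hom ≫ (A.F a).functor.map (invariantsπ Z))
    (fun a => hi f a) (fun a => hi g a) (fun a => ?_) (fun a => hp f a) (fun a => hp g a)
    (fun a => ?_) (hsum X) (hsum Y) (hsum Z)
  · exact key₁ a _ _ (map_ω_comp_invariantsι h) (h.f.comm a)
  · exact key₂ a _ _ (invariantsπ_comp_map_ω h) (h.f.comm a)

end TriangleAction

end

/-! ### Direct sums, induced objects, and essential surjectivity of the functor of invariants. -/

section SumDecomposition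

open Limits

/-- A decomposition of `B` as a finite direct sum of the objects `X j`. -/
structure SumDecomposition {C : Type*} [Category* C] [Preadditive C] {J : Type*} [Fintype J]
    (X : J → C) (B : C) where
  ι : ∀ j, X j ⟶ B
  π : ∀ j, B ⟶ X j
  ι_π_self : ∀ j, ι j ≫ π j = 𝟙 (X j)
  ι_π_ne : ∀ i j, i ≠ j → ι i ≫ π j = 0
  total : ∑ j, π j ≫ ι j = 𝟙 B

namespace SumDecomposition

variable {C : Type*} [Category* C] [Preadditive C] {J : Type*} [Fintype J] {X X' : J → C}
  {B B' : C}

/-- The decomposition of a biproduct. -/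
noncomputable def biproduct (X : J → C) [HasBiproduct X] : SumDecomposition X (⨁ X) where
  ι := biproduct.ι X
  π := biproduct.π X
  ι_π_self := biproduct.ι_π_self X
  ι_π_ne _ _ h := biproduct.ι_π_ne X h
  total := biproduct.hom_ext' _ _ fun j => by
    rw [Preadditive.comp_sum, Finset.sum_eq_single j, ← Category.assoc, biproduct.ι_π_self,
      Category.id_comp, Category.comp_id]
    · intro i _ h
      rw [← Category.assoc, biproduct.ι_π_ne X h.symm, zero_comp]
    · exact fun h => absurd (Finset.mem_univ _) h

/-- The image of a decomposition under an additive functor. -/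
def map {D : Type*} [Category* D] [Preadditive D] (d : SumDecomposition X B) (F : C ⥤ D)
    [F.Additive] : SumDecomposition (fun j => F.obj (X j)) (F.obj B) where
  ι j := F.map (d.ι j)
  π j := F.map (d.π j)
  ι_π_self j := by rw [← F.map_comp, d.ι_π_self, F.map_id]
  ι_π_ne i j h := by rw [← F.map_comp, d.ι_π_ne i j h, F.map_zero]
  total := by
    simp only [← F.map_comp]
    rw [← F.map_sum, d.total, F.map_id]

lemma hom_ext (d : SumDecomposition X B) {Y : C} {f f' : B ⟶ Y}
    (h : ∀ j, d.ι j ≫ f = d.ι j ≫ f') : f = f' := by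
  rw [← Category.id_comp f, ← Category.id_comp f', ← d.total, Preadditive.sum_comp,
    Preadditive.sum_comp]
  exact Finset.sum_congr rfl fun j _ => by rw [Category.assoc, h, Category.assoc]

/-- The morphism between direct sums given by morphisms between the summands. -/
def desc (d : SumDecomposition X B) {Y : C} (w : ∀ j, X j ⟶ Y) : B ⟶ Y :=
  ∑ j, d.π j ≫ w j

@[simp] lemma ι_desc (d : SumDecomposition X B) {Y : C} (w : ∀ j, X j ⟶ Y) (j : J) :
    d.ι j ≫ d.desc w = w j := by
  rw [desc, Preadditive.comp_sum, Finset.sum_eq_single j, ← Category.assoc, d.ι_π_self,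
    Category.id_comp]
  · intro i _ h
    rw [← Category.assoc, d.ι_π_ne j i h.symm, zero_comp]
  · exact fun h => absurd (Finset.mem_univ _) h

/-- The isomorphism between direct sums given by isomorphisms between the summands. -/
def iso (d : SumDecomposition X B) (d' : SumDecomposition X' B') (σ : J ≃ J)
    (w : ∀ j, X j ≅ X' (σ j)) : B ≅ B' where
  hom := d.desc fun j => (w j).hom ≫ d'.ι (σ j)
  inv := ∑ j, d'.π (σ j) ≫ (w j).inv ≫ d.ι j
  hom_inv_id := d.hom_ext fun j => by
    rw [← Category.assoc, ι_desc, Preadditive.comp_sum, Finset.sum_eq_single j, Category.assoc,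
      ← Category.assoc (d'.ι _), d'.ι_π_self, Category.id_comp, Iso.hom_inv_id_assoc,
      Category.comp_id]
    · intro i _ h
      rw [Category.assoc, ← Category.assoc (d'.ι _), d'.ι_π_ne _ _ (σ.injective.ne h.symm),
        zero_comp, comp_zero]
    · exact fun h => absurd (Finset.mem_univ _) h
  inv_hom_id := by
    simp only [Preadditive.sum_comp, Category.assoc, ι_desc, Iso.inv_hom_id_assoc]
    exact (σ.sum_comp fun j => d'.π j ≫ d'.ι j).trans d'.total

lemma ι_comp_iso_hom (d : SumDecomposition X B) (d' : SumDecomposition X' B') (σ : J ≃ J)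
    (w : ∀ j, X j ≅ X' (σ j)) (j : J) : d.ι j ≫ (d.iso d' σ w).hom = (w j).hom ≫ d'.ι (σ j) :=
  d.ι_desc _ j

end SumDecomposition

end SumDecomposition

section

variable {k : Type*} [Field k] {C : Type*} [Category* C] [Preadditive C] [Linear k C]
  {S : TriangleData k C}

namespace TriangleAction

open Limits

section Group

variable {G : Type*} [Group G] {A : TriangleAction G S}

/-- Split the underlying idempotent. Since the idempotent is equivariant, each `α_g` restricts to
its image, and the cocycle condition may be checked after precomposing with the split epimorphism
`e`. -/
instance [IsIdempotentComplete C] : IsIdempotentComplete A.EquivariantObject where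
  idempotents_split X p hp := by
    obtain ⟨Y, i, e, hie, hei⟩ := IsIdempotentComplete.idempotents_split X.obj p.f
      (congrArg (fun t => EquivariantHom.f t) hp)
    have h : ∀ g, (e ≫ i) ≫ (X.α g).hom =
        (X.α g).hom ≫ (A.F g).functor.map e ≫ (A.F g).functor.map i := fun g => by
      rw [← Functor.map_comp, hei, p.comm]
    have h' : ∀ g, (A.F g).functor.map i ≫ (A.F g).functor.map e = 𝟙 _ := fun g => by
      rw [← Functor.map_comp, hie, CategoryTheory.Functor.map_id]
    have : IsSplitEpi e := ⟨⟨i, hie⟩⟩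
    have hα : ∀ g, e ≫ (Iso.image (X.α g) hie (h' g) (h g)).hom =
        (X.α g).hom ≫ (A.F g).functor.map e := fun g => Iso.comp_image_hom _ _ _ _
    let Y' : A.EquivariantObject :=
      { obj := Y
        α := fun g => Iso.image (X.α g) hie (h' g) (h g)
        α_mul := fun {a b m} E => (cancel_epi e).mp (by
          have h1 := congrArg (A.F a).functor.map (hα b)
          have h2 := (A.ε E).hom.naturality e
          dsimp at h1 h2
          rw [Functor.map_comp, Functor.map_comp] at h1
          rw [hα, reassoc_of% hα, reassoc_of% h1, h2, X.α_mul E]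
          simp only [Category.assoc]) }
    let e' : X ⟶ Y' := ⟨e, hα⟩
    let i' : Y' ⟶ X := ⟨i, fun g => (cancel_epi e).mp (by
      rw [reassoc_of% hα, ← Category.assoc, h])⟩
    exact ⟨Y', i', e', hom_ext hie, hom_ext hei⟩

lemma hom_sum_f {X Y : A.EquivariantObject} {J : Type*} (s : Finset J) (a : J → (X ⟶ Y)) :
    (∑ i ∈ s, a i).f = ∑ i ∈ s, (a i).f :=
  map_sum (⟨⟨fun t => t.f, rfl⟩, fun _ _ => rfl⟩ : (X ⟶ Y) →+ (X.obj ⟶ Y.obj)) a s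

/-- The direct sum of a family of equivariant objects. -/
def directSum {J : Type*} [Fintype J] {X : J → A.EquivariantObject} {B : C}
    (d : SumDecomposition (fun j => (X j).obj) B) : A.EquivariantObject where
  obj := B
  α g :=
    have := (A.F g).additive
    d.iso (d.map (A.F g).functor) (Equiv.refl J) fun j => (X j).α g
  α_mul {g h m} e := d.hom_ext fun j => by
    have := (A.F g).additive
    have := (A.F m).additive
    have := (A.F h).additive
    have h1 := (A.ε e).hom.naturality (d.ι j)
    have h2 : ∀ a [(A.F a).functor.Additive], d.ι j ≫ (d.iso (d.map (A.F a).functor)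
        (Equiv.refl J) fun j => (X j).α a).hom =
          ((X j).α a).hom ≫ (A.F a).functor.map (d.ι j) := fun a _ => d.ι_comp_iso_hom _ _ _ j
    dsimp at h1
    rw [h2, ← Category.assoc, h2, Category.assoc, ← Functor.map_comp_assoc, h2, Functor.map_comp,
      Category.assoc, h1, (X j).α_mul e]
    simp only [Category.assoc]

lemma ι_comp_directSum_α {J : Type*} [Fintype J] {X : J → A.EquivariantObject} {B : C}
    (d : SumDecomposition (fun j => (X j).obj) B) (j : J) (g : G) :
    d.ι j ≫ ((directSum d).α g).hom = ((X j).α g).hom ≫ (A.F g).functor.map (d.ι j) :=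
  d.ι_comp_iso_hom _ _ _ j

/-- The decomposition of a direct sum of equivariant objects. -/
def directSumDecomposition {J : Type*} [Fintype J] {X : J → A.EquivariantObject} {B : C}
    (d : SumDecomposition (fun j => (X j).obj) B) : SumDecomposition X (directSum d) where
  ι j := ⟨d.ι j, ι_comp_directSum_α d j⟩
  π j := ⟨d.π j, fun g => d.hom_ext fun i => by
    have := (A.F g).additive
    have key : ∀ a : B ⟶ (A.F g).functor.obj B,
        d.ι i ≫ a = ((X i).α g).hom ≫ (A.F g).functor.map (d.ι i) →
        d.ι i ≫ d.π j ≫ ((X j).α g).hom = d.ι i ≫ a ≫ (A.F g).functor.map (d.π j) := by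
      intro a ha
      rw [← Category.assoc (d.ι i) a, ha, Category.assoc, ← Functor.map_comp, ← Category.assoc]
      by_cases hij : i = j
      · subst hij
        rw [d.ι_π_self, CategoryTheory.Functor.map_id, Category.comp_id, Category.id_comp]
      · rw [d.ι_π_ne _ _ hij, Functor.map_zero, comp_zero, zero_comp]
    exact key _ (ι_comp_directSum_α d i g)⟩
  ι_π_self j := hom_ext (d.ι_π_self j)
  ι_π_ne i j h := hom_ext (d.ι_π_ne i j h)
  total := hom_ext ((hom_sum_f _ _).trans d.total)

instance [HasFiniteBiproducts C] : HasFiniteBiproducts A.EquivariantObject where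
  out n := ⟨fun X => by
    let d := directSumDecomposition (SumDecomposition.biproduct fun j => (X j).obj)
    refine hasBiproduct_of_total
      { pt := _
        π := d.π
        ι := d.ι
        ι_π := fun i j => ?_ } d.total
    split_ifs with h
    · subst h
      exact d.ι_π_self i
    · exact d.ι_π_ne i j h⟩

instance [S.shift.Additive] : A.equivariantShift.Additive where
  map_add {_ _ f g} := hom_ext (S.shift.map_add (f := f.f) (g := g.f))

instance [S.shift.Additive] : A.equivariantTriangleData.shift.Additive :=
  inferInstanceAs A.equivariantShift.Additive

/-- Exactness, composites and sums are all computed on underlying objects. This is what allows the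
argument to be repeated for the dual action. -/
lemma equivariantTriangleData_retractClosed (hS : S.RetractClosed) :
    A.equivariantTriangleData.RetractClosed := by
  intro n X Y Z f g h X' Y' Z' f' g' h' hE iX iY iZ pX pY pZ h1 h2 h3 h4 h5 h6 hX hY hZ
  have hs : ∀ {V : A.EquivariantObject} {V' : Fin n → A.EquivariantObject} (p : ∀ j, V ⟶ V' j)
      (i : ∀ j, V' j ⟶ V), ∑ j, p j ≫ i j = 𝟙 V → ∑ j, (p j).f ≫ (i j).f = 𝟙 V.obj :=
    fun p i H => (hom_sum_f _ _).symm.trans (congrArg (fun t => EquivariantHom.f t) H)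
  exact hS n f.f g.f h.f (fun j => (X' j).obj) (fun j => (Y' j).obj) (fun j => (Z' j).obj)
    (fun j => (f' j).f) (fun j => (g' j).f) (fun j => (h' j).f) hE (fun j => (iX j).f)
    (fun j => (iY j).f) (fun j => (iZ j).f) (fun j => (pX j).f) (fun j => (pY j).f)
    (fun j => (pZ j).f) (fun j => congrArg (fun t => EquivariantHom.f t) (h1 j))
    (fun j => congrArg (fun t => EquivariantHom.f t) (h2 j))
    (fun j => congrArg (fun t => EquivariantHom.f t) (h3 j))
    (fun j => congrArg (fun t => EquivariantHom.f t) (h4 j))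
    (fun j => congrArg (fun t => EquivariantHom.f t) (h5 j))
    (fun j => congrArg (fun t => EquivariantHom.f t) (h6 j)) (hs _ _ hX) (hs _ _ hY) (hs _ _ hZ)

section Induced

variable [Fintype G]

/-- The equivariant object `⨁ F_h X` induced by an object `X`. -/
def induced {X B : C} (d : SumDecomposition (fun h => (A.F h).functor.obj X) B) :
    A.EquivariantObject where
  obj := B
  -- `α_g` sends the summand `F_m X` to the summand `F_g (F_{g⁻¹m} X)` by the inverse of `ε`.
  α g :=
    have := (A.F g).additive
    d.iso (d.map (A.F g).functor) (Equiv.mulLeft g⁻¹)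
      fun m => ((A.ε (mul_inv_cancel_left g m)).app X).symm
  α_mul {g h m} e := d.hom_ext fun j => by
    have h1 : m * (m⁻¹ * j) = j := by simp
    have h2 : ∀ {a b c : G} (E : a * b = c) [(A.F a).functor.Additive],
        d.ι c ≫ (d.iso (d.map (A.F a).functor) (Equiv.mulLeft a⁻¹)
          fun m => ((A.ε (mul_inv_cancel_left a m)).app X).symm).hom =
        (A.ε E).inv.app X ≫ (A.F a).functor.map (d.ι b) := by
      intro a b c E _
      obtain rfl : b = a⁻¹ * c := by rw [← E, inv_mul_cancel_left]
      exact d.ι_comp_iso_hom _ _ _ c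
    have h3 : g * (h * (m⁻¹ * j)) = j := by rw [← mul_assoc, e, h1]
    have h4 := (A.ε e).hom.naturality (d.ι (m⁻¹ * j))
    have h5 := A.cocycle e (rfl : h * (m⁻¹ * j) = _) h1 h3 X
    have := (A.F g).additive
    have := (A.F m).additive
    have := (A.F h).additive
    dsimp at h4
    rw [h2 h1, ← Category.assoc, h2 h3, Category.assoc, ← Functor.map_comp_assoc,
      h2 (rfl : h * (m⁻¹ * j) = _), Functor.map_comp, Category.assoc, h4,
      ← cancel_epi ((A.ε h3).hom.app X), Iso.hom_inv_id_app_assoc,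
      ← cancel_epi ((A.F g).functor.map ((A.ε (rfl : h * (m⁻¹ * j) = _)).hom.app X)),
      ← Functor.map_comp_assoc, Iso.hom_inv_id_app]
    rw [← reassoc_of% h5, Iso.hom_inv_id_app_assoc]
    erw [CategoryTheory.Functor.map_id, Category.id_comp]

lemma ι_comp_induced_α {X B : C} (d : SumDecomposition (fun h => (A.F h).functor.obj X) B)
    {g h m : G} (e : g * h = m) :
    d.ι m ≫ ((induced d).α g).hom = (A.ε e).inv.app X ≫ (A.F g).functor.map (d.ι h) := by
  have := (A.F g).additive
  obtain rfl : h = g⁻¹ * m := by rw [← e, inv_mul_cancel_left]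
  exact d.ι_comp_iso_hom _ _ _ m

end Induced

end Group

variable {G : Type*} [CommGroup G] {A : TriangleAction G S} [Fintype G]

/-- The action of a character on an induced object. -/
def inducedChar {X B : C} (d : SumDecomposition (fun h => (A.F h).functor.obj X) B)
    (χ : G →* kˣ) : B ≅ B :=
  d.iso d (Equiv.refl G) fun h => scaleIso (χ h) (Iso.refl ((A.F h).functor.obj X))

lemma ι_comp_inducedChar {X B : C} (d : SumDecomposition (fun h => (A.F h).functor.obj X) B)
    (χ : G →* kˣ) (h : G) : d.ι h ≫ (inducedChar d χ).hom = (χ h : k) • d.ι h :=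
  (d.ι_comp_iso_hom _ _ _ h).trans ((Linear.smul_comp _ _ _ _ _ _).trans
    (congrArg _ (Category.id_comp _)))

lemma inducedChar_comp_α {X B : C} (d : SumDecomposition (fun h => (A.F h).functor.obj X) B)
    (χ : G →* kˣ) (g : G) : (inducedChar d χ).hom ≫ ((twist χ (induced d)).α g).hom =
      ((induced d).α g).hom ≫ (A.F g).functor.map (inducedChar d χ).hom := by
  have := (A.F g).linear
  refine d.hom_ext fun m => ?_
  -- As `α_g` moves the index `m` to `g⁻¹ * m`, the scalar `χ m` on the summand, rescaled by `χ g⁻¹`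
  -- from the twist, matches the scalar on the new summand.
  have key : ∀ a : B ⟶ (A.F g).functor.obj B, d.ι m ≫ a =
      (A.ε (mul_inv_cancel_left g m)).inv.app X ≫ (A.F g).functor.map (d.ι (g⁻¹ * m)) →
      d.ι m ≫ (inducedChar d χ).hom ≫ ((χ g⁻¹ : k) • a) =
        d.ι m ≫ a ≫ (A.F g).functor.map (inducedChar d χ).hom := by
    intro a ha
    rw [← Category.assoc, ι_comp_inducedChar, Linear.comp_smul, Linear.smul_comp, smul_smul,
      ← Category.assoc, ha, Category.assoc, ← Functor.map_comp, ι_comp_inducedChar,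
      Functor.map_smul, Linear.comp_smul, ← Units.val_mul, ← map_mul]
  exact key _ (ι_comp_induced_α d _)

/-- The `Ĝ`-equivariant structure on an induced object. -/
def inducedObject {X B : C} (d : SumDecomposition (fun h => (A.F h).functor.obj X) B) :
    A.dualAction.EquivariantObject where
  obj := induced d
  α χ := isoMk (Y := twist χ (induced d)) (inducedChar d χ) (inducedChar_comp_α d χ)
  α_mul {χ ψ ρ} e := hom_ext (d.hom_ext fun h => by
    subst e
    have key : d.ι h ≫ (inducedChar d (χ * ψ)).hom =
        d.ι h ≫ (inducedChar d χ).hom ≫ (inducedChar d ψ).hom ≫ 𝟙 B := by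
      rw [Category.comp_id, ← Category.assoc, ι_comp_inducedChar, ι_comp_inducedChar,
        Linear.smul_comp, ι_comp_inducedChar, smul_smul]
      rfl
    exact key)

variable [Fintype (G →* kˣ)] [HasEnoughRootsOfUnity k (Monoid.exponent G)]

/-- A character `χ` acts on the summand `F_h X` by `χ h`; averaging kills every summand but that of
`h = 1`. The invariants are therefore `F_1 X`, isomorphic to `X` by the unit. -/
lemma invariantsIdem_inducedObject {X B : C}
    (d : SumDecomposition (fun h => (A.F h).functor.obj X) B) :
    invariantsIdem (inducedObject d) = d.π 1 ≫ d.ι 1 := by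
  refine d.hom_ext fun h => ?_
  have key : d.ι h ≫ ((Nat.card G : k)⁻¹ • ∑ χ : G →* kˣ, (inducedChar d χ).hom) =
      d.ι h ≫ d.π 1 ≫ d.ι 1 := by
    rw [Linear.comp_smul, Preadditive.comp_sum]
    simp only [ι_comp_inducedChar]
    by_cases hh : h = 1
    · subst hh
      simp only [map_one, Units.val_one, one_smul]
      rw [card_characters_smul, ← Category.assoc, d.ι_π_self, Category.id_comp]
    · rw [← Finset.sum_smul, sum_characters_apply h hh, zero_smul, smul_zero, ← Category.assoc,
        d.ι_π_ne h 1 hh, zero_comp]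
  exact key

variable [IsIdempotentComplete C]

/-- The invariants of an induced object. -/
noncomputable def invariantsInduced {X B : C}
    (d : SumDecomposition (fun h => (A.F h).functor.obj X) B) :
    (invariantsFunctor A).obj (inducedObject d) ≅ X :=
  Iso.image (Iso.refl B) (i := invariantsι (inducedObject d)) (p := invariantsπ (inducedObject d))
    (i' := d.ι 1) (p' := d.π 1) (invariantsι_π _) (d.ι_π_self 1) (by
      have h := (invariantsπ_ι (inducedObject d)).trans (invariantsIdem_inducedObject d)
      exact (Category.comp_id _).trans (h.trans (Category.id_comp _).symm)) ≪≫
    A.unit.app X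

instance invariantsFunctor_isEquivalence [HasFiniteBiproducts C] :
    (invariantsFunctor A).IsEquivalence where
  essSurj := ⟨fun X => ⟨inducedObject (SumDecomposition.biproduct _), ⟨invariantsInduced _⟩⟩⟩

end TriangleAction

end

/-! ### Double equivariantization corresponds to the original functor under taking invariants. -/

section

variable {k : Type*} [Field k] {C : Type*} [Category* C] [Preadditive C] [Linear k C]
  {S : TriangleData k C} {G : Type*} [CommGroup G] {A : TriangleAction G S} [Finite G]
  [Fintype (G →* kˣ)] [HasEnoughRootsOfUnity k (Monoid.exponent G)] [IsIdempotentComplete C]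

namespace TriangleAction

section DoubleDual

variable (P : A.EquivariantAutoequivalence)

/-- The double equivariantization of an equivariant autoequivalence. -/
def doubleEquivariant : A.dualAction.EquivariantObject ⥤ A.dualAction.EquivariantObject :=
  equivariantFunctor (equivariantize P)

/-- The projection onto the invariants of the double equivariantization. -/
noncomputable def doubleπ (Z : A.dualAction.EquivariantObject) :
    P.toTriangleFunctor.functor.obj Z.obj.obj ⟶
      (invariantsFunctor A).obj ((doubleEquivariant P).obj Z) :=
  (invariantsπ ((doubleEquivariant P).obj Z) :)

/-- The inclusion of the invariants of the double equivariantization. -/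
noncomputable def doubleι (Z : A.dualAction.EquivariantObject) :
    (invariantsFunctor A).obj ((doubleEquivariant P).obj Z) ⟶
      P.toTriangleFunctor.functor.obj Z.obj.obj :=
  (invariantsι ((doubleEquivariant P).obj Z) :)

instance (Z : A.dualAction.EquivariantObject) : Epi (doubleπ P Z) :=
  have h : Epi (invariantsπ ((doubleEquivariant P).obj Z)) := inferInstance
  h

lemma doubleι_π (Z : A.dualAction.EquivariantObject) : doubleι P Z ≫ doubleπ P Z = 𝟙 _ := by
  have h := invariantsι_π ((doubleEquivariant P).obj Z)
  exact h

lemma doubleπ_comp_map {Z W : A.dualAction.EquivariantObject} (f : Z ⟶ W) :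
    doubleπ P Z ≫ (invariantsFunctor A).map ((doubleEquivariant P).map f) =
      P.toTriangleFunctor.functor.map f.f.f ≫ doubleπ P W := by
  have h := invariantsπ_comp_map ((doubleEquivariant P).map f)
  exact h

/-- Characters act on the double equivariantization by `P` of their action, and `P` is linear, so
the projector is `P` of the projector. -/
lemma doubleπ_ι (Z : A.dualAction.EquivariantObject) :
    doubleπ P Z ≫ doubleι P Z = P.toTriangleFunctor.functor.map (invariantsIdem Z) := by
  have := P.toTriangleFunctor.linear
  have := P.toTriangleFunctor.additive
  have h := invariantsπ_ι ((doubleEquivariant P).obj Z)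
  refine h.trans ?_
  rw [invariantsIdem, invariantsIdem, Functor.map_smul, Functor.map_sum]
  congr 1
  exact Finset.sum_congr rfl fun χ _ =>
    Category.comp_id (P.toTriangleFunctor.functor.map (charMap Z χ))

/-- The functor of invariants intertwines an equivariant autoequivalence with its double
equivariantization. -/
noncomputable def doubleIso (Z : A.dualAction.EquivariantObject) :
    (invariantsFunctor A).obj ((doubleEquivariant P).obj Z) ≅
      P.toTriangleFunctor.functor.obj ((invariantsFunctor A).obj Z) :=
  Iso.image (Iso.refl (P.toTriangleFunctor.functor.obj Z.obj.obj)) (i := doubleι P Z)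
    (p := doubleπ P Z) (i' := P.toTriangleFunctor.functor.map (invariantsι Z))
    (p' := P.toTriangleFunctor.functor.map (invariantsπ Z)) (doubleι_π P Z)
    (by rw [← Functor.map_comp, invariantsι_π, CategoryTheory.Functor.map_id])
    (by rw [← Functor.map_comp, invariantsπ_ι, doubleπ_ι]; simp)

lemma doubleπ_comp_doubleIso (Z : A.dualAction.EquivariantObject) :
    doubleπ P Z ≫ (doubleIso P Z).hom = P.toTriangleFunctor.functor.map (invariantsπ Z) :=
  (Iso.comp_image_hom _ _ _ _).trans (Category.id_comp _)

/-- The functor of invariants intertwines an equivariant autoequivalence with its double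
equivariantization. -/
noncomputable def doubleNatIso : doubleEquivariant P ⋙ invariantsFunctor A ≅
    invariantsFunctor A ⋙ P.toTriangleFunctor.functor :=
  NatIso.ofComponents (doubleIso P) (fun {Z W} f => (cancel_epi (doubleπ P Z)).mp (by
    change doubleπ P Z ≫ (invariantsFunctor A).map ((doubleEquivariant P).map f) ≫
        (doubleIso P W).hom =
      doubleπ P Z ≫ (doubleIso P Z).hom ≫
        P.toTriangleFunctor.functor.map ((invariantsFunctor A).map f)
    rw [reassoc_of% doubleπ_comp_map, doubleπ_comp_doubleIso, reassoc_of% doubleπ_comp_doubleIso,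
      ← Functor.map_comp, ← Functor.map_comp]
    exact congrArg _ (invariantsπ_comp_map f).symm))

/-- A functor preserves split idempotents, so invariants commute with `P`. The content is that this
identification respects both the connecting isomorphisms and the equivariant structures; each is
checked after the epimorphism `doubleπ`. -/
lemma doubleEquivariant_comp_invariantsTri [S.shift.Additive] (hS : S.RetractClosed) :
    (((equivariantize (equivariantize P)).toTri.restrict MonoidHom.eval).comp
      (invariantsTri hS A)).IsIsomorphic ((invariantsTri hS A).comp P.toTri) := by
  refine ⟨doubleNatIso P, fun Z => ?_, fun g Z => ?_⟩
  · refine (cancel_epi (doubleπ P (A.dualAction.equivariantShift.obj Z))).mp ?_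
    have h1 : doubleπ P (A.dualAction.equivariantShift.obj Z) ≫ (invariantsFunctor A).map
        ((equivariantize (equivariantize P)).toTriangleFunctor.ω.hom.app Z) =
          P.toTriangleFunctor.ω.hom.app Z.obj.obj ≫ shiftπ ((doubleEquivariant P).obj Z) :=
      (invariantsπ_comp_map
        ((equivariantize (equivariantize P)).toTriangleFunctor.ω.hom.app Z) :)
    have h2 : (P.toTriangleFunctor.ω.hom.app Z.obj.obj ≫ shiftπ ((doubleEquivariant P).obj Z)) ≫
        (invariantsShiftIso ((doubleEquivariant P).obj Z)).hom =
          P.toTriangleFunctor.ω.hom.app Z.obj.obj ≫ S.shift.map (doubleπ P Z) :=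
      (Category.assoc _ _ _).trans (congrArg _ (shiftπ_comp_shiftIso _))
    have h3 : (P.toTriangleFunctor.ω.hom.app Z.obj.obj ≫ S.shift.map (doubleπ P Z)) ≫
        S.shift.map (doubleIso P Z).hom = P.toTriangleFunctor.ω.hom.app Z.obj.obj ≫
          S.shift.map (P.toTriangleFunctor.functor.map (invariantsπ Z)) := by
      rw [Category.assoc, ← S.shift.map_comp, doubleπ_comp_doubleIso]
    have h4 := doubleπ_comp_doubleIso P (A.dualAction.equivariantShift.obj Z)
    have h5 : P.toTriangleFunctor.functor.map (shiftπ Z) ≫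
        P.toTriangleFunctor.functor.map (invariantsShiftIso Z).hom =
          P.toTriangleFunctor.functor.map (S.shift.map (invariantsπ Z)) := by
      rw [← Functor.map_comp, shiftπ_comp_shiftIso]
    have h6 := P.toTriangleFunctor.ω.hom.naturality (invariantsπ Z)
    exact ((congrArg _ (Category.assoc _ _ _)).trans (comp₃_eq h1 h2 h3)).trans
      (comp₃_eq h4 h5 h6).symm
  · refine (cancel_epi (doubleπ P ((A.dualAction.twistFunctor (MonoidHom.eval g)).obj Z))).mp ?_
    have h1 : doubleπ P ((A.dualAction.twistFunctor (MonoidHom.eval g)).obj Z) ≫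
        (invariantsFunctor A).map
          (((equivariantize (equivariantize P)).δ (MonoidHom.eval g)).hom.app Z) =
            twistπ g ((doubleEquivariant P).obj Z) :=
      (invariantsπ_comp_map
        (((equivariantize (equivariantize P)).δ (MonoidHom.eval g)).hom.app Z)).trans
        (Category.id_comp _)
    have h2 : twistπ g ((doubleEquivariant P).obj Z) ≫
        (invariantsTwistIso g ((doubleEquivariant P).obj Z)).hom =
          (P.toTriangleFunctor.functor.map (Z.obj.α g).hom ≫ (P.δ g).hom.app Z.obj.obj) ≫
            (A.F g).functor.map (doubleπ P Z) :=
      (twistπ_comp_twistIso g ((doubleEquivariant P).obj Z) :)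
    have h3 : ((P.toTriangleFunctor.functor.map (Z.obj.α g).hom ≫ (P.δ g).hom.app Z.obj.obj) ≫
        (A.F g).functor.map (doubleπ P Z)) ≫ (A.F g).functor.map (doubleIso P Z).hom =
          P.toTriangleFunctor.functor.map (Z.obj.α g).hom ≫ (P.δ g).hom.app Z.obj.obj ≫
            (A.F g).functor.map (P.toTriangleFunctor.functor.map (invariantsπ Z)) := by
      rw [Category.assoc, Category.assoc, ← Functor.map_comp, doubleπ_comp_doubleIso]
    have h4 := doubleπ_comp_doubleIso P ((A.dualAction.twistFunctor (MonoidHom.eval g)).obj Z)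
    have h5 : P.toTriangleFunctor.functor.map (twistπ g Z) ≫
        P.toTriangleFunctor.functor.map (invariantsTwistIso g Z).hom =
          P.toTriangleFunctor.functor.map (Z.obj.α g).hom ≫
            P.toTriangleFunctor.functor.map ((A.F g).functor.map (invariantsπ Z)) := by
      rw [← Functor.map_comp, twistπ_comp_twistIso, Functor.map_comp]
    have h6 : (P.toTriangleFunctor.functor.map (Z.obj.α g).hom ≫
        P.toTriangleFunctor.functor.map ((A.F g).functor.map (invariantsπ Z))) ≫
          (P.δ g).hom.app ((invariantsFunctor A).obj Z) =
        P.toTriangleFunctor.functor.map (Z.obj.α g).hom ≫ (P.δ g).hom.app Z.obj.obj ≫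
            (A.F g).functor.map (P.toTriangleFunctor.functor.map (invariantsπ Z)) := by
      have h := (P.δ g).hom.naturality (invariantsπ Z)
      dsimp at h
      rw [Category.assoc, h]
    exact ((congrArg _ (Category.assoc _ _ _)).trans (comp₃_eq h1 h2 h3)).trans
      (comp₃_eq h4 h5 h6).symm

end DoubleDual

end TriangleAction

end

/-! ### Bijectivity of equivariantization. -/

section

variable {k : Type*} [Field k] {C : Type*} [Category* C] [Preadditive C] [Linear k C]
  {S : TriangleData k C} {G : Type*} [CommGroup G] {A : TriangleAction G S} [Finite G]
  [HasEnoughRootsOfUnity k (Monoid.exponent G)] [IsIdempotentComplete C]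
  [Limits.HasFiniteBiproducts C] [S.shift.Additive]

namespace TriangleAction

instance invariantsTri_isEquivalence [Fintype (G →* kˣ)] (hS : S.RetractClosed) :
    (invariantsTri hS A).functor.IsEquivalence := by
  have := Fintype.ofFinite G
  exact inferInstanceAs (invariantsFunctor A).IsEquivalence

/-- Equivariantize once more: the double equivariantizations agree, hence so do `P` and `Q` after
precomposition with the equivalence of invariants, which can be cancelled. -/
lemma isIsomorphic_of_equivariantize (hS : S.RetractClosed) {P Q : A.EquivariantAutoequivalence}
    (h : (equivariantize P).IsIsomorphic (equivariantize Q)) : P.IsIsomorphic Q := by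
  have := Fintype.ofFinite (G →* kˣ)
  have h1 := (EquivariantTriFunctor.isIsomorphic_restrict_iff
    (characterEval_bijective k G).surjective).mpr
      (EquivariantAutoequivalence.isIsomorphic_iff_toTri.mp (equivariantize_congr h))
  have h2 := h1.whiskerRight (invariantsTri hS A)
  exact EquivariantTriFunctor.IsIsomorphic.cancel_left (invariantsTri_isEquivalence hS)
    ((doubleEquivariant_comp_invariantsTri P hS).symm.trans
      (h2.trans (doubleEquivariant_comp_invariantsTri Q hS)))

lemma exists_equivariantize_isIsomorphic (hS : S.RetractClosed)
    (Q : A.dualAction.EquivariantAutoequivalence) :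
    ∃ P : A.EquivariantAutoequivalence, (equivariantize P).IsIsomorphic Q := by
  have := Fintype.ofFinite (G →* kˣ)
  have := hasEnoughRootsOfUnity_characters k G
  -- `P` is the transport of `Q^Ĝ` along the equivalence of invariants, obtained by extending `M`
  -- along it.
  let M := ((equivariantize Q).toTri.restrict MonoidHom.eval).comp (invariantsTri hS A)
  obtain ⟨P, hP⟩ := EquivariantTriFunctor.exists_extension hS hS (invariantsTri hS A)
    (invariantsTri_isEquivalence hS)
    (fun f g h => exact_of_invariantsFunctor_map_exact hS f g h) M
  have hP' : P.functor.IsEquivalence := by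
    obtain ⟨φ, -⟩ := hP
    have h1 : (invariantsTri hS A).functor.IsEquivalence := invariantsTri_isEquivalence hS
    have h2 : (equivariantize Q).toTri.functor.IsEquivalence := (equivariantize Q).isEquivalence
    have h3 : M.functor.IsEquivalence :=
      inferInstanceAs
        ((equivariantize Q).toTri.functor ⋙ (invariantsTri hS A).functor).IsEquivalence
    have h4 : ((invariantsTri hS A).functor ⋙ P.functor).IsEquivalence :=
      Functor.isEquivalence_of_iso φ.symm
    exact Functor.isEquivalence_of_comp_left (invariantsTri hS A).functor P.functor
  -- Injectivity for the dual action reduces the claim to `(P^G)^Ĝ ≅ Q^Ĝ`. As `G` maps onto its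
  -- double dual, this may be tested over `G`; and it may be tested after taking invariants, where
  -- both sides agree with `M`.
  refine ⟨.ofTri P hP', isIsomorphic_of_equivariantize (equivariantTriangleData_retractClosed hS)
    (EquivariantAutoequivalence.isIsomorphic_iff_toTri.mpr
      ((EquivariantTriFunctor.isIsomorphic_restrict_iff
        (characterEval_bijective k G).surjective).mp
      (EquivariantTriFunctor.IsIsomorphic.cancel_right (invariantsTri_isEquivalence hS)
        ((doubleEquivariant_comp_invariantsTri (.ofTri P hP') hS).trans hP))))⟩

lemma equivariantization_bijective (hS : S.RetractClosed) :
    Function.Bijective A.equivariantization := by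
  constructor
  · rintro ⟨P⟩ ⟨Q⟩ h
    exact EquivariantAutoequivalence.mk_eq_mk_iff.mpr
      (isIsomorphic_of_equivariantize hS (EquivariantAutoequivalence.mk_eq_mk_iff.mp h))
  · rintro ⟨Q⟩
    obtain ⟨P, hP⟩ := exists_equivariantize_isIsomorphic hS Q
    exact ⟨Aut.mk P, EquivariantAutoequivalence.mk_eq_mk_iff.mpr hP⟩

end TriangleAction

end

/-! ### Invertibility in the monoids of isoclasses. -/

section

variable {k : Type*} [Field k]

open Pretriangulated in
/-- A fully faithful triangle endofunctor of a pre-triangulated category reflects exact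
triangles. -/
lemma TriangleFunctor.exact_of_map_exact {T : Type*} [Category* T]
    [Preadditive T] [Linear k T] [Limits.HasZeroObject T] [HasShift T ℤ]
    [∀ n : ℤ, (shiftFunctor T n).Additive] [∀ n : ℤ, (shiftFunctor T n).Linear k]
    [Pretriangulated T] (P : TriangleFunctor (TriangleData.ofPretriangulated k T))
    [P.functor.Full] [P.functor.Faithful] {X Y Z : T} (f : X ⟶ Y) (g : Y ⟶ Z)
    (h : Z ⟶ (TriangleData.ofPretriangulated k T).shift.obj X)
    (hE : (TriangleData.ofPretriangulated k T).Exact (P.functor.map f) (P.functor.map g)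
      (P.functor.map h ≫ P.ω.hom.app X)) :
    (TriangleData.ofPretriangulated k T).Exact f g h := by
  -- Complete `f` to a distinguished triangle. Its image and the image of the given triangle are two
  -- distinguished triangles on the same morphism, so they are isomorphic; the isomorphism of cones
  -- lifts by full faithfulness.
  obtain ⟨W, g₁, h₁, hW⟩ := distinguished_cocone_triangle f
  let Δ := Triangle.mk (P.functor.map f) (P.functor.map g)
    (P.functor.map h ≫ P.ω.hom.app X : _ ⟶ (P.functor.obj X)⟦(1 : ℤ)⟧)
  let Δ₁ := Triangle.mk (P.functor.map f) (P.functor.map g₁)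
    (P.functor.map h₁ ≫ P.ω.hom.app X : _ ⟶ (P.functor.obj X)⟦(1 : ℤ)⟧)
  have hΔ : Δ ∈ distTriang T := hE
  have hΔ₁ : Δ₁ ∈ distTriang T := P.map_exact f g₁ h₁ hW
  obtain ⟨u, hu, hu'⟩ := complete_distinguished_triangle_morphism Δ₁ Δ hΔ₁ hΔ (𝟙 _) (𝟙 _)
    ((Category.comp_id _).trans (Category.id_comp _).symm)
  let φ : Δ₁ ⟶ Δ :=
    { hom₁ := 𝟙 _
      hom₂ := 𝟙 _
      hom₃ := u
      comm₁ := (Category.comp_id _).trans (Category.id_comp _).symm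
      comm₂ := hu
      comm₃ := hu' }
  have : IsIso u := isIso₃_of_isIso₁₂ φ hΔ₁ hΔ
    (inferInstanceAs (IsIso (𝟙 _))) (inferInstanceAs (IsIso (𝟙 _)))
  obtain ⟨v, hv⟩ := P.functor.map_surjective (u : P.functor.obj W ⟶ P.functor.obj Z)
  have : IsIso (P.functor.map v) := by
    rw [hv]
    assumption
  have hv' : IsIso v := isIso_of_reflects_iso v P.functor
  have h1 : g₁ ≫ v = g := P.functor.map_injective (by
    rw [Functor.map_comp, hv]
    exact hu.trans (Category.id_comp _))
  have h2 : v ≫ h = h₁ := P.functor.map_injective (by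
    rw [Functor.map_comp, hv, ← cancel_mono (P.ω.hom.app X)]
    refine (Category.assoc _ _ _).trans (hu'.symm.trans ?_)
    exact (congrArg _ (CategoryTheory.Functor.map_id _ _)).trans (Category.comp_id _))
  refine isomorphic_distinguished _ hW _
    (Triangle.isoMk (Triangle.mk f g h : Triangle T) (Triangle.mk f g₁ h₁) (Iso.refl _)
      (Iso.refl _) (asIso v).symm ?_ ?_ ?_)
  · exact (Category.comp_id _).trans (Category.id_comp _).symm
  · change g ≫ inv v = 𝟙 _ ≫ g₁
    rw [IsIso.comp_inv_eq, Category.id_comp, h1]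
  · change h ≫ (𝟙 X)⟦(1 : ℤ)⟧' = inv v ≫ h₁
    rw [IsIso.eq_inv_comp, CategoryTheory.Functor.map_id, ← h2]
    exact congrArg _ (Category.comp_id h)

variable {C : Type*} [Category* C] [Preadditive C] [Linear k C]
  {S : TriangleData k C} {G : Type*} [Group G] {A : TriangleAction G S}

/-- Extending the identity functor along `P` gives an equivariant triangle functor `Q` with `QP ≅
Id`. -/
lemma TriangleAction.exists_mul_eq_one (hS : S.RetractClosed) (P : A.EquivariantAutoequivalence)
    (hP : ∀ {X Y Z : C} (f : X ⟶ Y) (g : Y ⟶ Z) (h : Z ⟶ S.shift.obj X),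
      S.Exact (P.toTriangleFunctor.functor.map f) (P.toTriangleFunctor.functor.map g)
        (P.toTriangleFunctor.functor.map h ≫ P.toTriangleFunctor.ω.hom.app X) → S.Exact f g h) :
    ∃ y : A.Aut, y * Aut.mk P = 1 := by
  obtain ⟨Q, hQ⟩ := EquivariantTriFunctor.exists_extension hS hS P.toTri P.isEquivalence hP
    (EquivariantAutoequivalence.one A).toTri
  have hQ' : Q.functor.IsEquivalence := by
    obtain ⟨φ, -⟩ := hQ
    have h1 : P.toTri.functor.IsEquivalence := P.isEquivalence
    have h2 : (EquivariantAutoequivalence.one A).toTri.functor.IsEquivalence :=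
      inferInstanceAs (𝟭 C).IsEquivalence
    have h3 : (P.toTri.functor ⋙ Q.functor).IsEquivalence := Functor.isEquivalence_of_iso φ.symm
    exact Functor.isEquivalence_of_comp_left P.toTri.functor Q.functor
  exact ⟨Aut.mk (.ofTri Q hQ'), EquivariantAutoequivalence.mk_eq_mk_iff.mpr hQ⟩

lemma isUnit_of_forall_exists_mul_eq_one {M : Type*} [Monoid M] (h : ∀ x : M, ∃ y, y * x = 1)
    (x : M) : IsUnit x := by
  obtain ⟨y, hy⟩ := h x
  obtain ⟨z, hz⟩ := h y
  have hzx : z = x := by rw [← mul_one z, ← hy, ← mul_assoc, hz, one_mul]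
  exact ⟨⟨x, y, hzx ▸ hz, hy⟩, rfl⟩

/-- `Q ≅ F_{a⁻¹} F_a Q ≅ F_{a⁻¹} P Q ≅ F_{a⁻¹}`. This closes `Act` under inverses. -/
lemma TriangleAction.isIsomorphic_F_inv {P Q : TriangleFunctor S} {a : G}
    (hP : P.IsIsomorphic (A.F a)) (h : (P.comp Q).IsIsomorphic (TriangleFunctor.id S)) :
    Q.IsIsomorphic (A.F a⁻¹) := by
  have hQ := TriangleFunctor.IsIsomorphic.refl Q
  have hu : (A.F 1).IsIsomorphic (TriangleFunctor.id S) := ⟨A.unit, A.unit_triangle⟩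
  have h1 : ((TriangleFunctor.id S).comp Q).IsIsomorphic Q :=
    ⟨Functor.rightUnitor _, fun X => by simp⟩
  have h2 : ((A.F a⁻¹).comp (TriangleFunctor.id S)).IsIsomorphic (A.F a⁻¹) :=
    ⟨Functor.leftUnitor _, fun X => by simp⟩
  have h3 : (((A.F a⁻¹).comp P).comp Q).IsIsomorphic ((A.F a⁻¹).comp (P.comp Q)) :=
    ⟨(Functor.associator _ _ _).symm, fun X => by simp⟩
  have h4 : ((A.F a⁻¹).comp P).IsIsomorphic (TriangleFunctor.id S) :=
    ((TriangleFunctor.IsIsomorphic.refl _).comp hP).trans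
      (TriangleFunctor.IsIsomorphic.trans ⟨A.ε (inv_mul_cancel a), A.ε_triangle _⟩ hu)
  exact h1.symm.trans ((h4.symm.comp hQ).trans
    (h3.trans (((TriangleFunctor.IsIsomorphic.refl _).comp h).trans h2)))

lemma TriangleAction.act_isUnit (hA : ∀ x : A.Aut, IsUnit x) (x : A.Act) : IsUnit x := by
  obtain ⟨x, P, rfl, a, ha⟩ := x
  obtain ⟨u, hu⟩ := hA (Aut.mk P)
  obtain ⟨Q, hQ⟩ : ∃ Q, Aut.mk Q = (↑u⁻¹ : A.Aut) := Quotient.exists_rep _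
  have h1 : Aut.mk P * Aut.mk Q = 1 := by rw [hQ, ← hu, Units.mul_inv]
  have h2 : Aut.mk Q * Aut.mk P = 1 := by rw [hQ, ← hu, Units.inv_mul]
  obtain ⟨φ, hφ, -⟩ := EquivariantAutoequivalence.mk_eq_mk_iff.mp h1
  exact ⟨⟨⟨Aut.mk P, P, rfl, a, ha⟩,
    ⟨Aut.mk Q, Q, rfl, a⁻¹, isIsomorphic_F_inv ha ⟨φ, hφ⟩⟩, Subtype.ext h1, Subtype.ext h2⟩, rfl⟩

end

/-! ### Triangle centers and the subgroups of autoequivalences coming from the action. -/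

section

variable {k : Type*} [Field k] {C : Type*} [Category* C] [Preadditive C] [Linear k C]
  {S : TriangleData k C}

/-- An automorphism of an equivalence `P` is `z P` for a unique endomorphism `z` of the identity
functor, by descent along `P`; compatibility with `ω` puts `z` in the triangle center. -/
lemma TriangleData.CenterEqScalars.exists_smul (hS : S.CenterEqScalars) (P : TriangleFunctor S)
    [P.functor.IsEquivalence] (φ : P.functor ≅ P.functor)
    (hφ : TriangleFunctor.IsTriangleNatTrans P P φ.hom) :
    ∃ c : k, ∀ X, φ.hom.app X = c • 𝟙 (P.functor.obj X) := by
  let Ψ := TriFunctor.ofEndo P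
  have : Ψ.functor.IsEquivalence := ‹_›
  let I := TriFunctor.ofEndo (TriangleFunctor.id S)
  let σ : Ψ.functor ⋙ I.functor ≅ Ψ.functor ⋙ I.functor := φ
  have hσ : TriFunctor.Compatible (P := Ψ.comp I) (Q := Ψ.comp I) σ.hom := fun X => by
    have h : ∀ {U V W : C} (a : U ⟶ V) (b : V ⟶ W), (a ≫ 𝟙 V) ≫ b = a ≫ b := fun a b => by simp
    exact (h _ _).trans ((hφ X).trans (congrArg _ (Category.comp_id _).symm))
  let z : CatCenter C := (Ψ.functor.descendIso σ).hom
  have hz : z ∈ S.center := fun X =>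
    (Category.id_comp _).symm.trans ((hσ.descend X).trans (Category.comp_id _))
  obtain ⟨c, -, hc⟩ := hS.surjOn hz
  refine ⟨c, fun X => ?_⟩
  have h1 : z.app (P.functor.obj X) = φ.hom.app X := Ψ.functor.descendIso_hom_app σ X
  rw [← h1, ← hc]
  simp

lemma TriangleData.CenterEqScalars.eq_of_smul (hS : S.CenterEqScalars) {D : Type*} [Category* D]
    [Preadditive D] [Linear k D] (F : C ⥤ D) [F.Faithful] [F.Additive] [F.Linear k] {c c' : k}
    (h : ∀ X, c • 𝟙 (F.obj X) = c' • 𝟙 (F.obj X)) : c = c' := by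
  refine hS.injOn (Set.mem_univ _) (Set.mem_univ _) ?_
  ext X
  have : c • 𝟙 X = c' • 𝟙 X := F.map_injective (by
    rw [Functor.map_smul, Functor.map_smul, CategoryTheory.Functor.map_id, h])
  simpa using this

namespace TriangleAction

variable {G : Type*} [CommGroup G] {A : TriangleAction G S}

/-- The two identifications of `F F_g` with `F_{ga}` given by an isomorphism `φ : F ≅ F_a`, one of
them using the equivariant structure of `F`, differ by a scalar. -/
lemma exists_δ_eq_smul (hS : S.CenterEqScalars) (P : A.EquivariantAutoequivalence) {a : G}
    (φ : P.toTriangleFunctor.functor ≅ (A.F a).functor)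
    (hφ : TriangleFunctor.IsTriangleNatTrans P.toTriangleFunctor (A.F a) φ.hom) (g : G) :
    ∃ c : kˣ, ∀ X, (P.δ g).hom.app X ≫ (A.F g).functor.map (φ.hom.app X) ≫
      (A.ε (rfl : g * a = g * a)).hom.app X =
        (c : k) • φ.hom.app ((A.F g).functor.obj X) ≫ (A.ε (mul_comm a g)).hom.app X := by
  have := A.isEquivalence (g * a)
  have := (A.F (g * a)).additive
  have := (A.F (g * a)).linear
  -- `σ` is the discrepancy between the two identifications, as an automorphism of `F_{ga}`;
  -- commutativity of `G` gives `ag = ga`.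
  let σ : (A.F (g * a)).functor ≅ (A.F (g * a)).functor :=
    (A.ε (mul_comm a g)).symm ≪≫ Functor.isoWhiskerLeft (A.F g).functor φ.symm ≪≫ P.δ g ≪≫
      Functor.isoWhiskerRight φ (A.F g).functor ≪≫ A.ε (rfl : g * a = g * a)
  have hσX : ∀ X, φ.hom.app ((A.F g).functor.obj X) ≫ (A.ε (mul_comm a g)).hom.app X ≫
      σ.hom.app X = (P.δ g).hom.app X ≫ (A.F g).functor.map (φ.hom.app X) ≫
        (A.ε (rfl : g * a = g * a)).hom.app X := fun X => by
    simp [σ]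
  have hσ : TriangleFunctor.IsTriangleNatTrans (A.F (g * a)) (A.F (g * a)) σ.hom := fun X => by
    have h1 := A.ε_triangle (mul_comm a g) X
    have h2 := A.ε_triangle (rfl : g * a = g * a) X
    have h3 := P.δ_triangle g X
    have h4 := hφ ((A.F g).functor.obj X)
    have h5 := congrArg (A.F g).functor.map (hφ X)
    have h6 := φ.hom.naturality ((A.F g).ω.hom.app X)
    have h7 := (A.F g).ω.hom.naturality (φ.hom.app X)
    have h8 := hσX (S.shift.obj X)
    have h9 := congrArg S.shift.map (hσX X)
    rw [← cancel_epi ((A.ε (mul_comm a g)).hom.app (S.shift.obj X)),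
      ← cancel_epi (φ.hom.app ((A.F g).functor.obj (S.shift.obj X)))]
    dsimp at h1 h2 h3 h4 h5 h6 h7 h8 h9 ⊢
    simp only [Functor.map_comp, Category.assoc] at *
    rw [reassoc_of% h8, ← h2, ← reassoc_of% h1, ← reassoc_of% h6, ← reassoc_of% h4, h9,
      reassoc_of% h3, ← reassoc_of% h7, reassoc_of% h5]
  obtain ⟨c, hc⟩ := hS.exists_smul _ σ hσ
  have hc0 : c ≠ 0 := by
    rintro rfl
    refine zero_ne_one (hS.eq_of_smul (A.F (g * a)).functor (fun X => ?_) : (0 : k) = 1)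
    rw [zero_smul, one_smul, ← Iso.hom_inv_id_app σ X, hc X, zero_smul, Limits.zero_comp]
  refine ⟨Units.mk0 c hc0, fun X => ?_⟩
  rw [← hσX, hc, Linear.comp_smul, Linear.comp_smul, Category.comp_id]
  rfl

/-- The scalars are multiplicative because `δ` and `ε` satisfy their cocycle conditions. -/
lemma exists_monoidHom_δ_eq_smul (hS : S.CenterEqScalars) (P : A.EquivariantAutoequivalence)
    {a : G} (φ : P.toTriangleFunctor.functor ≅ (A.F a).functor)
    (hφ : TriangleFunctor.IsTriangleNatTrans P.toTriangleFunctor (A.F a) φ.hom) :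
    ∃ χ : G →* kˣ, ∀ g X, (P.δ g).hom.app X ≫ (A.F g).functor.map (φ.hom.app X) ≫
      (A.ε (rfl : g * a = g * a)).hom.app X =
        (χ g : k) • φ.hom.app ((A.F g).functor.obj X) ≫ (A.ε (mul_comm a g)).hom.app X := by
  choose c hc using exists_δ_eq_smul hS P φ hφ
  refine ⟨MonoidHom.mk' c fun g h => ?_, hc⟩
  have := A.isEquivalence (g * h * a)
  have := (A.F (g * h * a)).additive
  have := (A.F (g * h * a)).linear
  have := (A.F g).additive
  have := (A.F g).linear
  apply Units.ext
  refine hS.eq_of_smul (A.F (g * h * a)).functor fun X => ?_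
  -- Scalars are compared after precomposition with the isomorphism `i` from `P F_g F_h X`. The
  -- scalar of `gh` arises from `δ_{gh}`, the product of scalars from `δ_g` and `δ_h`; the cocycle
  -- identities for `(g,h,a)`, `(g,a,h)` and `(a,g,h)` reconcile the paths.
  let i : P.toTriangleFunctor.functor.obj ((A.F g).functor.obj ((A.F h).functor.obj X)) ⟶
      (A.F (g * h * a)).functor.obj X :=
    φ.hom.app ((A.F g).functor.obj ((A.F h).functor.obj X)) ≫
      (A.F a).functor.map ((A.ε (rfl : g * h = g * h)).hom.app X) ≫
        (A.ε (mul_comm a (g * h))).hom.app X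
  rw [← cancel_epi i, Linear.comp_smul, Linear.comp_smul, Category.comp_id]
  have h1 := P.δ_mul (rfl : g * h = g * h) X
  have h2 := hc (g * h) X
  have h3 := φ.hom.naturality ((A.ε (rfl : g * h = g * h)).hom.app X)
  have h4 := (A.ε (rfl : g * h = g * h)).hom.naturality (φ.hom.app X)
  have h5 := A.cocycle (rfl : g * h = g * h) (rfl : h * a = h * a) rfl (mul_assoc g h a).symm X
  have h6 := congrArg (A.F g).functor.map (hc h X)
  have h7 := A.cocycle (rfl : g * a = g * a) (mul_comm a h) (by rw [mul_assoc, mul_comm a h,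
    mul_assoc]) (mul_assoc g h a).symm X
  have h8 := hc g ((A.F h).functor.obj X)
  have h9 := A.cocycle (mul_comm a g) (rfl : g * h = g * h) (by rw [mul_assoc, mul_comm a h,
    mul_assoc]) (mul_comm a (g * h)) X
  rw [Functor.map_smul] at h6
  dsimp at h1 h2 h3 h4 h5 h6 h7 h8 h9
  simp only [Functor.map_comp] at h6
  have e1 : ((c (g * h) : kˣ) : k) • i = P.toTriangleFunctor.functor.map
      ((A.ε (rfl : g * h = g * h)).hom.app X) ≫ (P.δ (g * h)).hom.app X ≫
        (A.F (g * h)).functor.map (φ.hom.app X) ≫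
          (A.ε (rfl : g * h * a = g * h * a)).hom.app X := by
    rw [h2, Linear.comp_smul, reassoc_of% h3]
  rw [e1, reassoc_of% h1, ← reassoc_of% h4, h5, reassoc_of% h6, Linear.smul_comp,
    Linear.comp_smul, Category.assoc, ← h7, reassoc_of% h8, Linear.smul_comp, smul_smul,
    Category.assoc, h9, mul_comm (c h : k), Units.val_mul]

/-- On an equivariant object `F_a X` is identified with `X` by `α_a`. Hence `F^G` leaves the
underlying object unchanged up to isomorphism and only rescales its equivariant structure by the
character `χ`. -/
lemma equivariantTriangleFunctor_isIsomorphic_dualFunctor (hS : S.CenterEqScalars)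
    (P : A.EquivariantAutoequivalence) {a : G}
    (hP : P.toTriangleFunctor.IsIsomorphic (A.F a)) :
    ∃ χ : G →* kˣ, (equivariantTriangleFunctor P).IsIsomorphic (A.dualFunctor χ) := by
  obtain ⟨φ, hφ⟩ := hP
  obtain ⟨χ, hχ⟩ := exists_monoidHom_δ_eq_smul hS P φ hφ
  let θ : ∀ X : A.EquivariantObject, P.toTriangleFunctor.functor.obj X.obj ≅ X.obj := fun X =>
    φ.app X.obj ≪≫ (X.α a).symm
  have hθ : ∀ (X : A.EquivariantObject) (g : G), (θ X).hom ≫ ((χ g : k) • (X.α g).hom) =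
      (P.toTriangleFunctor.functor.map (X.α g).hom ≫ (P.δ g).hom.app X.obj) ≫
        (A.F g).functor.map (θ X).hom := by
    intro X g
    have h1 := X.α_mul (rfl : g * a = g * a)
    have h2 := X.α_mul (mul_comm a g)
    have h3 := φ.hom.naturality (X.α g).hom
    have h4 := hχ g X.obj
    rw [← cancel_mono ((A.F g).functor.map (X.α a).hom),
      ← cancel_mono ((A.ε (rfl : g * a = g * a)).hom.app X.obj)]
    have h5 : (θ X).hom = φ.hom.app X.obj ≫ (X.α a).inv := rfl
    have h6 : (A.F g).functor.map (X.α a).inv ≫ (A.F g).functor.map (X.α a).hom = 𝟙 _ := by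
      rw [← Functor.map_comp, Iso.inv_hom_id, CategoryTheory.Functor.map_id]
    rw [h5, Functor.map_comp]
    simp only [Linear.comp_smul, Linear.smul_comp, Category.assoc, reassoc_of% h6, h4]
    rw [← h1, h2, Iso.inv_hom_id_assoc, reassoc_of% h3]
  -- The inverse appears because the dual action twists `α_g` by the value at `g⁻¹`.
  refine ⟨χ⁻¹, NatIso.ofComponents (fun X => isoMk (Y := twist χ⁻¹ X) (θ X) fun g => ?_)
    fun {X Y} f => hom_ext ?_, fun X => hom_ext ?_⟩
  · have h : ∀ c : kˣ, c = χ g → (θ X).hom ≫ ((c : k) • (X.α g).hom) =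
        (P.toTriangleFunctor.functor.map (X.α g).hom ≫ (P.δ g).hom.app X.obj) ≫
          (A.F g).functor.map (θ X).hom := by
      rintro _ rfl
      exact hθ X g
    exact h (χ⁻¹ g⁻¹) (by simp)
  · have h1 := φ.hom.naturality f.f
    have h2 : (X.α a).inv ≫ f.f = (A.F a).functor.map f.f ≫ (Y.α a).inv := by
      rw [Iso.inv_comp_eq, ← Category.assoc, ← f.comm, Category.assoc, Iso.hom_inv_id,
        Category.comp_id]
    change P.toTriangleFunctor.functor.map f.f ≫ φ.hom.app Y.obj ≫ (Y.α a).inv =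
      (φ.hom.app X.obj ≫ (X.α a).inv) ≫ f.f
    rw [Category.assoc, h2, reassoc_of% h1]
  · change P.toTriangleFunctor.ω.hom.app X.obj ≫ S.shift.map (φ.hom.app X.obj ≫ (X.α a).inv) =
      (φ.hom.app (S.shift.obj X.obj) ≫ (A.F a).ω.hom.app X.obj ≫ S.shift.map (X.α a).inv) ≫ 𝟙 _
    rw [Category.comp_id, Functor.map_comp, ← reassoc_of% hφ X.obj]

/-- The functor of invariants intertwines the double dual action with the action. -/
lemma dualFunctor_comp_invariantsTri [Finite G] [Fintype (G →* kˣ)]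
    [HasEnoughRootsOfUnity k (Monoid.exponent G)] [IsIdempotentComplete C] [S.shift.Additive]
    (hS : S.RetractClosed) (a : G) :
    ((TriFunctor.ofEndo (A.dualAction.dualFunctor (MonoidHom.eval a))).comp
      (invariantsTri hS A).toTriFunctor).IsIsomorphic
        ((invariantsTri hS A).toTriFunctor.comp (.ofEndo (A.F a))) :=
  ⟨(invariantsTri hS A).δ a, fun X =>
    (Category.assoc _ _ _).trans ((invariantsTri hS A).δ_triangle a X)⟩

/-- Every character of `Ĝ` is evaluation at some `a`. Taking invariants turns the twist by it into
`F_a` and the double equivariantization into `P`. -/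
lemma isIsomorphic_F_of_double [Finite G] [HasEnoughRootsOfUnity k (Monoid.exponent G)]
    [IsIdempotentComplete C] [Limits.HasFiniteBiproducts C] [S.shift.Additive]
    (hS : S.RetractClosed) (P : A.EquivariantAutoequivalence) {ξ : (G →* kˣ) →* kˣ}
    (h : (equivariantTriangleFunctor (equivariantize P)).IsIsomorphic
      (A.dualAction.dualFunctor ξ)) :
    ∃ a : G, P.toTriangleFunctor.IsIsomorphic (A.F a) := by
  have := Fintype.ofFinite (G →* kˣ)
  obtain ⟨a, rfl⟩ := (characterEval_bijective k G).surjective ξ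
  obtain ⟨φ, hφ, -⟩ := doubleEquivariant_comp_invariantsTri P hS
  have h1 : ((TriFunctor.ofEndo (equivariantTriangleFunctor (equivariantize P))).comp
      (invariantsTri hS A).toTriFunctor).IsIsomorphic
        ((invariantsTri hS A).toTriFunctor.comp (.ofEndo P.toTriangleFunctor)) := ⟨φ, hφ⟩
  have h2 : (TriFunctor.ofEndo (equivariantTriangleFunctor (equivariantize P))).IsIsomorphic
      (.ofEndo (A.dualAction.dualFunctor (MonoidHom.eval a))) := h
  exact ⟨a, TriFunctor.IsIsomorphic.cancel_left (invariantsTri_isEquivalence hS)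
    (h1.symm.trans ((h2.whiskerRight _).trans (dualFunctor_comp_invariantsTri hS a)))⟩

lemma equivariantization_mem_act (hS : S.CenterEqScalars) {x : A.Aut} (hx : x ∈ A.Act) :
    A.equivariantization x ∈ A.dualAction.Act := by
  obtain ⟨P, rfl, a, ha⟩ := hx
  exact ⟨equivariantize P, rfl, equivariantTriangleFunctor_isIsomorphic_dualFunctor hS P ha⟩

/-- The scalar argument for the dual action, using the center of `T^G`, shows that the double
equivariantization is a twist by a character of `Ĝ`; it is then brought back to `T`. -/
lemma mem_act_of_equivariantization_mem_act [Finite G]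
    [HasEnoughRootsOfUnity k (Monoid.exponent G)] [IsIdempotentComplete C]
    [Limits.HasFiniteBiproducts C] [S.shift.Additive] (hS : S.RetractClosed)
    (hC : A.equivariantTriangleData.CenterEqScalars) {x : A.Aut}
    (hx : A.equivariantization x ∈ A.dualAction.Act) : x ∈ A.Act := by
  obtain ⟨P, rfl⟩ : ∃ P, Aut.mk P = x := Quotient.exists_rep x
  obtain ⟨Q, hQ, χ, hχ⟩ := hx
  obtain ⟨φ, hφ, -⟩ := EquivariantAutoequivalence.mk_eq_mk_iff.mp hQ.symm
  obtain ⟨ξ, hξ⟩ := equivariantTriangleFunctor_isIsomorphic_dualFunctor hC (equivariantize P)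
    (TriangleFunctor.IsIsomorphic.trans ⟨φ, hφ⟩ hχ)
  exact ⟨P, rfl, isIsomorphic_F_of_double hS P hξ⟩

/-- If both triangle centers are the scalars, equivariantization restricts to an isomorphism of the
subgroups of those autoequivalences that come from the action. -/
lemma exists_act_mulEquiv [Finite G]
    [HasEnoughRootsOfUnity k (Monoid.exponent G)] [IsIdempotentComplete C]
    [Limits.HasFiniteBiproducts C] [S.shift.Additive] (hS : S.RetractClosed)
    (hC : S.CenterEqScalars) (hC' : A.equivariantTriangleData.CenterEqScalars) :
    ∃ Φ : A.Act ≃* A.dualAction.Act,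
      ∀ x : A.Act, (Φ x : A.dualAction.Aut) = A.equivariantization x := by
  have hE := equivariantization_bijective (A := A) hS
  refine ⟨MulEquiv.ofBijective ((A.equivariantization.comp A.Act.subtype).codRestrict
    A.dualAction.Act fun x => equivariantization_mem_act hC x.2) ⟨fun x y h => ?_, fun y => ?_⟩,
    fun x => rfl⟩
  · exact Subtype.ext (hE.injective (congrArg Subtype.val h))
  · obtain ⟨x, hx⟩ := hE.surjective y
    exact ⟨⟨x, mem_act_of_equivariantization_mem_act hS hC' (hx ▸ y.2)⟩, Subtype.ext hx⟩

end TriangleAction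

end

/-! ### The main theorem. -/

theorem theorem6p2 {k : Type*} [Field k]
    {T : Type*} [Category* T] [Preadditive T] [Linear k T] [Limits.HasZeroObject T]
    [HasShift T ℤ] [∀ n : ℤ, (shiftFunctor T n).Additive] [∀ n : ℤ, (shiftFunctor T n).Linear k]
    [Pretriangulated T] [IsIdempotentComplete T]
    {G : Type*} [CommGroup G] [Finite G] (hG : SplitsOver k G)
    (A : TriangleAction G (TriangleData.ofPretriangulated k T)) :
    -- the monoids of isoclasses are groups
    ((∀ x : A.Aut, IsUnit x) ∧ (∀ y : A.dualAction.Aut, IsUnit y) ∧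
      (∀ x : A.Act, IsUnit x) ∧ (∀ y : A.dualAction.Act, IsUnit y)) ∧
    -- the equivariantization homomorphism is an isomorphism
    Function.Bijective A.equivariantization ∧
    -- it restricts to an isomorphism of the subgroups, if both triangle centers are `k`
    ((TriangleData.ofPretriangulated k T).CenterEqScalars →
      A.equivariantTriangleData.CenterEqScalars →
      ∃ Φ : A.Act ≃* A.dualAction.Act,
        ∀ x : A.Act, (Φ x : A.dualAction.Aut) = A.equivariantization x) := by
  have := hG.hasEnoughRootsOfUnity
  have hS := TriangleData.ofPretriangulated_retractClosed k T
  have : (TriangleData.ofPretriangulated k T).shift.Additive :=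
    inferInstanceAs (shiftFunctor T (1 : ℤ)).Additive
  have hE : Function.Bijective A.equivariantization :=
    TriangleAction.equivariantization_bijective hS
  have h1 : ∀ x : A.Aut, IsUnit x := isUnit_of_forall_exists_mul_eq_one (by
    rintro ⟨P⟩
    have := P.isEquivalence
    exact TriangleAction.exists_mul_eq_one hS P P.toTriangleFunctor.exact_of_map_exact)
  -- Inverses upstairs come from surjectivity of the homomorphism, so no completion of morphisms to
  -- triangles in `T^G` is required.
  have h2 : ∀ y : A.dualAction.Aut, IsUnit y := fun y => by
    obtain ⟨x, rfl⟩ := hE.surjective y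
    exact (h1 x).map _
  exact ⟨⟨h1, h2, TriangleAction.act_isUnit h1, TriangleAction.act_isUnit h2⟩, hE,
    TriangleAction.exists_act_mulEquiv hS⟩
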